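/- **Setting.** Let $N\in\mathbb N$, $v_0>0$, and let $\boldsymbol a_1,\dots,\boldsymbol a_N\in\mathbb R^3\setminus\{0\}$. On $L^2(\mathbb R^{3(N+1)})$, with variables $(\boldsymbol R,\boldsymbol r_1,\dots,\boldsymbol r_N)$ and norm $\|\cdot\|$, put for $\varepsilon>0$ and $V:\mathbb R^3\to\mathbb R$ $$H_0^\varepsilon=-\tfrac{\varepsilon^4}{2}\Delta_{\boldsymbol R}+\sum_{j=1}^N\varepsilon^{-1}\Big[-\tfrac{\varepsilon^4}{2}\Delta_{\boldsymbol r_j}+\tfrac12|\boldsymbol r_j-\boldsymbol a_j|^2\Big],\qquad V^\varepsilon=\sum_{j=1}^N V\big(\varepsilon^{-1}(\boldsymbol R-\boldsymbol r_j)\big),\qquad H^\varepsilon=H_0^\varepsilon+\varepsilon^2V^\varepsilon,$$ $\mathcal U_0^\varepsilon(t)=e^{-i\frac{t}{\varepsilon^2}H_0^\varepsilon}$ and $\mathcal U^\varepsilon(t)=e^{-i\frac{t}{\varepsilon^2}H^\varepsilon}$. Let $f(\boldsymbol x)=\pi^{-3/4}e^{-|\boldsymbol x|^2/2}$ and let the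 initial state be $$\Psi_0^\varepsilon=\psi^\varepsilon(\boldsymbol R)\prod_{j=1}^N\varphi^\varepsilon_{0,j}(\boldsymbol r_j),\qquad \psi^\varepsilon(\boldsymbol R)=\frac{\mathcal N_\varepsilon}{\varepsilon^{5/2}}f(\varepsilon^{-1}\boldsymbol R)\int_{S^2}d\hat{\boldsymbol u}\,e^{\frac{i}{\varepsilon^2}v_0\hat{\boldsymbol u}\cdot\boldsymbol R},\qquad \varphi^\varepsilon_{0,j}(\boldsymbol r)=\varepsilon^{-3/2}f(\varepsilon^{-1}(\boldsymbol r-\boldsymbol a_j)),$$ where $\mathcal N_\varepsilon>0$ is such that $\|\psi^\varepsilon\|_{L^2}=1$. With strong integrals define $$J^\varepsilon(t)=-\int_0^t ds\int_0^s d\sigma\;\mathcal U_0^\varepsilon(-s)V^\varepsilon\,\mathcal U_0^\varepsilon(s)\,\mathcal U_0^\varepsilon(-\sigma)V^\varepsilon\,\mathcal U_0^\varepsilon(\sigma),$$ $$\mathcal R^\varepsilon(t)=\mathcal U_0^\varepsilon(t)J^\varepsilon(t)\Psi_0^\varepsilon-i\int_0^t ds\;\mathcal U^\varepsilon(t-s)V^\varepsilon\,\mathcal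 U_0^\varepsilon(s)J^\varepsilon(s)\Psi_0^\varepsilon .$$ For $g:\mathbb R^3\to\mathbb C$ let $\|g\|_{W^{4,1}_4}=\sum_{|\alpha|\le4}\int(1+|\boldsymbol x|^2)^2|D^\alpha g(\boldsymbol x)|\,d\boldsymbol x$ (weak derivatives), and let $\widetilde V(\boldsymbol\xi)=(2\pi)^{-3/2}\int e^{-i\boldsymbol\xi\cdot\boldsymbol x}V(\boldsymbol x)\,d\boldsymbol x$. The assumptions are: (A) $V\in L^1(\mathbb R^3)$ is real valued and $\widetilde V\in W^{4,1}_4(\mathbb R^3)$; (B) $|\boldsymbol a_1|<\dots<|\boldsymbol a_N|$, and $\boldsymbol a_i\cdot\boldsymbol a_j\ne|\boldsymbol a_i||\boldsymbol a_j|$ for $i\ne j$. **Proposition 3.3.** Assume (B). For every $t>0$ there is a constant $C^3(t)>0$, depending only on $t$, $N$, $v_0$ and $\boldsymbol a_1,\dots,\boldsymbol a_N$, such that for all $V$ with (A) and all $\varepsilon>0$ $$\|\mathcal R^\varepsilon(t)\|\;\le\;\big(1+tN\|V\|_{L^\infty}\big)\sup_{0\le s\le t}\|J^\varepsilon(s)\Psi_0^\varepsilon\|\;\le\;C^3(t)\,\big(1+t\|V\|_{L^\infty}\big)\,\|\widetilde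 V\|_{W^{4,1}_4}^2\,\varepsilon^3,$$ the supremum being finite. In particular, the probability that at time $t$ at least two oscillators are excited, that is, the squared norm of the component of $\mathcal U^\varepsilon(t)\Psi_0^\varepsilon$ orthogonal to all states in which at most one oscillator is not in its ground state $\varphi^\varepsilon_{0,j}$, is at most $\big(C^3(t)(1+t\|V\|_{L^\infty})\|\widetilde V\|_{W^{4,1}_4}^2\,\varepsilon^3\big)^2$. -/

import Mathlib

open MeasureTheory Set Filter Topology
open scoped ENNReal ContDiff SchwartzMap Laplacian

noncomputable section

namespace SphericalWave

/-- Physical space `ℝ³` with its Euclidean norm. -/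
abbrev E3 : Type := EuclideanSpace ℝ (Fin 3)

/-- Configurations `(R, r₁, …, r_N)`: the position of the test particle and those of the `N`
harmonic oscillators. -/
abbrev Config (N : ℕ) : Type := E3 × (Fin N → E3)

/-- The state space `L²(ℝ^{3(N+1)})`. -/
abbrev L2 (N : ℕ) : Type := Lp (α := Config N) ℂ 2 volume

/-- The class in `L²` of a square integrable function (and `0` if the function is not square
integrable). -/
def toL2 {N : ℕ} (g : Config N → ℂ) : L2 N := by
  classical
  exact if h : MemLp g 2 (volume : Measure (Config N)) then h.toLp g else 0

/-! ### Fourier transform and weighted Sobolev norms on `ℝ³` -/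

/-- The unitary Fourier transform `(2π)^{-3/2} ∫ e^{-i ξ·x} V(x) dx`. -/
def fourierT (V : E3 → ℝ) (ξ : E3) : ℂ :=
  (((2 * Real.pi) ^ (-(3 / 2) : ℝ) : ℝ) : ℂ) *
    ∫ x : E3, Complex.exp (-(Complex.I * ((inner ℝ ξ x : ℝ) : ℂ))) * ((V x : ℝ) : ℂ)

/-- The partial derivative in the `i`-th coordinate of a real function on `ℝ³`. -/
def partialD (i : Fin 3) (φ : E3 → ℝ) (x : E3) : ℝ :=
  fderiv ℝ φ x (EuclideanSpace.single i 1)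

/-- `D^α` for a multi-index `α`. -/
def multiD (α : Fin 3 → ℕ) (φ : E3 → ℝ) : E3 → ℝ :=
  (partialD 0)^[α 0] ((partialD 1)^[α 1] ((partialD 2)^[α 2] φ))

/-- `g` is the weak derivative `D^α f`. -/
def HasWeakDeriv (α : Fin 3 → ℕ) (f g : E3 → ℂ) : Prop :=
  LocallyIntegrable f volume ∧ LocallyIntegrable g volume ∧
    ∀ φ : E3 → ℝ, ContDiff ℝ ∞ φ → HasCompactSupport φ →
      ∫ x, f x * ((multiD α φ x : ℝ) : ℂ) = (-1) ^ (∑ i, α i) * ∫ x, g x * ((φ x : ℝ) : ℂ)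

/-- The weak derivative `D^α f`, which is unique up to null sets (and `0` if there is none). -/
def weakDeriv (α : Fin 3 → ℕ) (f : E3 → ℂ) : E3 → ℂ := by
  classical
  exact if h : ∃ g, HasWeakDeriv α f g then h.choose else 0

/-- The multi-indices with `|α| ≤ n`. -/
def multiIndices (n : ℕ) : Finset (Fin 3 → ℕ) :=
  (Fintype.piFinset fun _ : Fin 3 => Finset.range (n + 1)).filter fun α => ∑ i, α i ≤ n

/-- The weight `⟨x⟩^s = (1 + |x|²)^{s/2}`. -/
def weight (s : ℝ) (x : E3) : ℝ := (1 + ‖x‖ ^ 2) ^ (s / 2)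

/-- `f` belongs to the weighted Sobolev space `W^{n,1}_s(ℝ³)`. -/
def MemWeightedSobolev (n : ℕ) (s : ℝ) (f : E3 → ℂ) : Prop :=
  ∀ α ∈ multiIndices n, (∃ g, HasWeakDeriv α f g) ∧
    Integrable (fun x => weight s x * ‖weakDeriv α f x‖) volume

/-- The norm of `W^{n,1}_s(ℝ³)`. -/
def weightedSobolevNorm (n : ℕ) (s : ℝ) (f : E3 → ℂ) : ℝ :=
  ∑ α ∈ multiIndices n, ∫ x, weight s x * ‖weakDeriv α f x‖

/-- The norm of `L^∞(ℝ³)`. -/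
def supNorm (V : E3 → ℝ) : ℝ := (eLpNorm V ∞ volume).toReal

/-! ### The rescaled Hamiltonians -/

/-- The interaction potential `V^ε(R, r) = ∑ⱼ V(ε⁻¹ (R - rⱼ))`. -/
def interaction {N : ℕ} (ε : ℝ) (V : E3 → ℝ) (X : Config N) : ℝ :=
  ∑ j, V (ε⁻¹ • (X.1 - X.2 j))

/-- The differential expression
`H₀^ε = -(ε⁴/2) Δ_R + ∑ⱼ ε⁻¹ [ -(ε⁴/2) Δ_{rⱼ} + |rⱼ - aⱼ|²/2 ]`. -/
def freeHam {N : ℕ} (ε : ℝ) (a : Fin N → E3) (φ : Config N → ℂ) (X : Config N) : ℂ :=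
  -((ε ^ 4 / 2 : ℝ) : ℂ) * (Δ (fun R : E3 => φ (R, X.2)) X.1) +
    ∑ j, ((ε⁻¹ : ℝ) : ℂ) *
      (-((ε ^ 4 / 2 : ℝ) : ℂ) * (Δ (fun r : E3 => φ (X.1, Function.update X.2 j r)) (X.2 j)) +
        ((‖X.2 j - a j‖ ^ 2 / 2 : ℝ) : ℂ) * φ X)

/-- The differential expression `H^ε = H₀^ε + ε² V^ε`. -/
def fullHam {N : ℕ} (ε : ℝ) (a : Fin N → E3) (V : E3 → ℝ) (φ : Config N → ℂ)
    (X : Config N) : ℂ :=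
  freeHam ε a φ X + ((ε ^ 2 * interaction ε V X : ℝ) : ℂ) * φ X

/-- `U` is a strongly continuous one-parameter unitary group whose self-adjoint generator extends
the expression `H` on Schwartz functions: `d/dt U(t) φ = -i H φ` at `t = 0`.
For the Hamiltonians above (with `V` bounded) the operator `H` is essentially self-adjoint on
Schwartz functions, so that there is exactly one such group, namely `e^{-itH}`. -/
def IsUnitaryGroupOf {N : ℕ} (H : (Config N → ℂ) → Config N → ℂ)
    (U : ℝ → (L2 N ≃ₗᵢ[ℂ] L2 N)) : Prop :=
  (∀ s t : ℝ, ∀ Ψ : L2 N, U (s + t) Ψ = U s (U t Ψ)) ∧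
  (∀ Ψ : L2 N, Continuous fun t : ℝ => U t Ψ) ∧
  ∀ φ : 𝓢(Config N, ℂ), ∃ x y : L2 N,
    (x : Config N → ℂ) =ᵐ[volume] φ ∧ (y : Config N → ℂ) =ᵐ[volume] H φ ∧
      HasDerivAt (fun t : ℝ => U t x) (-Complex.I • y) 0

/-- The unitary group `e^{-itH}`. -/
def unitaryGroup {N : ℕ} (H : (Config N → ℂ) → Config N → ℂ) : ℝ → (L2 N ≃ₗᵢ[ℂ] L2 N) := by
  classical
  exact if h : ∃ U, IsUnitaryGroupOf H U then h.choose
    else fun _ => LinearIsometryEquiv.refl ℂ (L2 N)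

/-- The free propagator `𝒰₀^ε(t) = e^{-i (t/ε²) H₀^ε}`. -/
def freeProp {N : ℕ} (ε : ℝ) (a : Fin N → E3) (t : ℝ) : L2 N ≃ₗᵢ[ℂ] L2 N :=
  unitaryGroup (freeHam ε a) (t / ε ^ 2)

/-- The full propagator `𝒰^ε(t) = e^{-i (t/ε²) H^ε}`. -/
def fullProp {N : ℕ} (ε : ℝ) (a : Fin N → E3) (V : E3 → ℝ) (t : ℝ) : L2 N ≃ₗᵢ[ℂ] L2 N :=
  unitaryGroup (fullHam ε a V) (t / ε ^ 2)

/-- Multiplication by `V^ε` on `L²`. -/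
def mulV {N : ℕ} (ε : ℝ) (V : E3 → ℝ) (Ψ : L2 N) : L2 N :=
  toL2 fun X => ((interaction ε V X : ℝ) : ℂ) * (Ψ : Config N → ℂ) X

/-! ### The initial state -/

/-- The normalized Gaussian `π^{-3/4} e^{-|x|²/2}`; it is both the profile `f` of the spherical
wave and the product `φ_{(0,0,0)}` of the Hermite functions of order zero. -/
def gauss (x : E3) : ℝ := Real.pi ^ (-(3 / 4) : ℝ) * Real.exp (-(‖x‖ ^ 2 / 2))

/-- The rescaled spherical wave without its normalization constant:
`ε^{-5/2} f(ε⁻¹ R) ∫_{S²} e^{(i/ε²) v₀ u·R} du`, with the surface measure on the sphere. -/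
def waveShape (ε v₀ : ℝ) (R : E3) : ℂ :=
  ((ε ^ (-(5 / 2) : ℝ) * gauss (ε⁻¹ • R) : ℝ) : ℂ) *
    ∫ u : Metric.sphere (0 : E3) 1,
      Complex.exp (Complex.I * ((v₀ / ε ^ 2 * inner ℝ (u : E3) R : ℝ) : ℂ))
        ∂((volume : Measure E3).toSphere)

/-- The normalization constant `𝒩_ε > 0`, which makes the spherical wave a unit vector. -/
def normConst (ε v₀ : ℝ) : ℝ := (Real.sqrt (∫ R : E3, ‖waveShape ε v₀ R‖ ^ 2))⁻¹

/-- The rescaled spherical wave `ψ^ε`. -/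
def wave (ε v₀ : ℝ) (R : E3) : ℂ := ((normConst ε v₀ : ℝ) : ℂ) * waveShape ε v₀ R

/-- The ground state `ε^{-3/2} φ_0(ε⁻¹ (r - a))` of the oscillator centred at `a`. -/
def groundState (ε : ℝ) (a r : E3) : ℝ := ε ^ (-(3 / 2) : ℝ) * gauss (ε⁻¹ • (r - a))

/-- The initial state `Ψ₀^ε(R, r) = ψ^ε(R) ∏ⱼ φ^ε_{0,j}(rⱼ)`. -/
def initialState {N : ℕ} (ε v₀ : ℝ) (a : Fin N → E3) : L2 N :=
  toL2 fun X => wave ε v₀ X.1 * ∏ j, ((groundState ε (a j) (X.2 j) : ℝ) : ℂ)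

/-! ### The second-order Duhamel terms -/

/-- The interaction in the interaction picture, `𝒰₀^ε(-s) V^ε 𝒰₀^ε(s)`. -/
def intPic {N : ℕ} (ε : ℝ) (a : Fin N → E3) (V : E3 → ℝ) (s : ℝ) (Ψ : L2 N) : L2 N :=
  freeProp ε a (-s) (mulV ε V (freeProp ε a s Ψ))

/-- `J^ε(t) = -∫₀ᵗ ds ∫₀ˢ dσ 𝒰₀^ε(-s) V^ε 𝒰₀^ε(s) 𝒰₀^ε(-σ) V^ε 𝒰₀^ε(σ)` (strong integrals). -/
def J {N : ℕ} (ε : ℝ) (a : Fin N → E3) (V : E3 → ℝ) (t : ℝ) (Ψ : L2 N) : L2 N :=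
  -∫ s in (0 : ℝ)..t, ∫ σ in (0 : ℝ)..s, intPic ε a V s (intPic ε a V σ Ψ)

/-- The second-order Duhamel remainder
`ℛ^ε(t) = 𝒰₀^ε(t) J^ε(t) Ψ₀^ε - i ∫₀ᵗ ds 𝒰^ε(t-s) V^ε 𝒰₀^ε(s) J^ε(s) Ψ₀^ε`. -/
def remainder {N : ℕ} (ε v₀ : ℝ) (a : Fin N → E3) (V : E3 → ℝ) (t : ℝ) : L2 N :=
  freeProp ε a t (J ε a V t (initialState ε v₀ a)) -
    Complex.I • ∫ s in (0 : ℝ)..t,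
      fullProp ε a V (t - s)
        (mulV ε V (freeProp ε a s (J ε a V s (initialState ε v₀ a))))

/-! ### Excitation of two oscillators -/

/-- The span of the states in which all oscillators, except those of a set `A` with at most one
element, are in their ground state. -/
def atMostOneExcited {N : ℕ} (ε : ℝ) (a : Fin N → E3) : Submodule ℂ (L2 N) :=
  Submodule.span ℂ {Ψ : L2 N | ∃ A : Finset (Fin N), A.card ≤ 1 ∧
    ∃ G : E3 → (A → E3) → ℂ, (Ψ : Config N → ℂ) =ᵐ[volume] fun X =>
      G X.1 (fun k => X.2 k) * ∏ k ∈ Finset.univ \ A, ((groundState ε (a k) (X.2 k) : ℝ) : ℂ)}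

/-- The probability, in the state `Ψ`, that at least two oscillators are excited: the squared norm
of the component of `Ψ` orthogonal to the states with at most one excited oscillator. -/
def probTwoExcited {N : ℕ} (ε : ℝ) (a : Fin N → E3) (Ψ : L2 N) : ℝ :=
  ‖(atMostOneExcited ε a)ᗮ.starProjection Ψ‖ ^ 2

end SphericalWave

end

open MeasureTheory Set Filter Topology
open scoped ENNReal ContDiff SchwartzMap Laplacian

noncomputable section

namespace SphericalWave

/-! ### Gaussian exponentials: Schwartz regularity and derivatives. -/

section

/-! The first inequality is soft: the propagators are isometries and `V^ε` is bounded by `N ‖V‖_∞`.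
The substance is that `‖J^ε(s) Ψ₀‖ = O(ε³)`, and, for the probability, the second-order Duhamel
expansion.

Everything is computed on Gaussian wave packets `exp (packetExp ...)`, whose exponents are quadratic
polynomials with explicit free evolution: the centres move classically, the particle packet has
width `ε √(1 + t²)`, the oscillator packets keep width `ε`. Multiplication by `exp (i w·q)`, where
`q = ε⁻¹ (R - r_j)` and `w` may be complex, only changes the parameters of a packet (`kick`). The
initial state is an integral over `u ∈ S²` of packets with momentum `v₀ u / ε²`, and `V` is a
Fourier integral of the exponentials `exp (i η·q)`. Hence `V^ε` turns packets into superpositions of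
kicked packets.

Let `A_i(s) = ε⁻¹ (s v₀ u - a_i)`. A kick displaces the centres only by `O(ε (1 + |η|))`, so the
second interaction, with `V = O((1 + |q|²)⁻²)`, still contributes `(1 + |A_i(s)|²)⁻²` at the price
of `(1 + |η|²)²`, which is the weight in the Sobolev norm (`exists_pairCLM_kicked`). Decay in the
first impact parameter `A = A_j(σ)` comes from `A_k² = q_k² - 2 q_k (q_k - A_k) + (q_k - A_k)²`:
powers of `q_k` times `V` are Fourier integrals of derivatives of the transform, and powers of `q_k
- A_k` are, by Cauchy's formula, averages over `θ` of `exp (e^{iθ} (q_k - A_k))`, which are kicks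
with complex momentum (`norm_apply_pairCLM_le`).

Power counting: the `σ` integral along a straight line gives `ε`. The `s` integral averaged over `u`
is, in polar coordinates, an integral over `ℝ³` of a bump of size `ε` around `a_i ≠ 0`, hence `ε³`.
Amplitude times `L²` norm of the packets is of order `𝒩_ε / ε`, and `𝒩_ε ≤ C (1 + ε)` by a lower
bound for spherical caps. For `ε ≤ 1` the product is `ε⁻¹ · ε · ε³`; for `ε > 1` the trivial bound
of order `(t N ‖V‖_∞)²` suffices.

In the Duhamel expansion the zeroth-order term has all oscillators in their ground states and each
kick of the first-order term touches one oscillator, so the projection defining the probability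
leaves only the remainder. Since the propagators are defined by choice, the free one is identified
by building a group from packets (`exists_freeGroup`) and by uniqueness from the differential
Duhamel formula without potential. -/

theorem norm_iteratedFDeriv_cexp (n : ℕ) (z : ℂ) :
    ‖iteratedFDeriv ℝ n Complex.exp z‖ =
      Real.exp z.re * ‖iteratedFDeriv ℝ n Complex.exp (0 : ℂ)‖ := by
  have h1 : (fun w : ℂ => Complex.exp (w + z)) = fun w => Complex.exp z • Complex.exp w := by
    funext w; rw [Complex.exp_add, smul_eq_mul, mul_comm]
  have h2 := iteratedFDeriv_comp_add_right (𝕜 := ℝ) (f := Complex.exp) n z (0 : ℂ)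
  rw [zero_add] at h2
  rw [← h2, h1]
  have h3 : iteratedFDeriv ℝ n (fun w : ℂ => Complex.exp z • Complex.exp w) (0 : ℂ) =
      Complex.exp z • iteratedFDeriv ℝ n Complex.exp (0 : ℂ) :=
    iteratedFDeriv_const_smul_apply (𝕜 := ℝ) (a := Complex.exp z) (f := Complex.exp)
      (Complex.contDiff_exp (𝕜 := ℝ)).contDiffAt
  rw [h3, norm_smul, Complex.norm_exp]

theorem exists_pow_mul_exp_neg_sq_le (n : ℕ) {c : ℝ} (hc : 0 < c) :
    ∃ M : ℝ, 0 < M ∧ ∀ x : ℝ, 0 ≤ x → (1 + x) ^ n * Real.exp (-(c * x ^ 2)) ≤ M := by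
  obtain ⟨M, hM⟩ : ∃ M : ℝ, ∀ y : ℝ, 0 ≤ y → y ^ n * Real.exp (-y) ≤ M := by
    refine ⟨n.factorial, fun y hy => ?_⟩
    rw [Real.exp_neg, ← div_eq_mul_inv, div_le_iff₀ (Real.exp_pos _)]
    have := Real.pow_div_factorial_le_exp y hy n
    rw [div_le_iff₀ (by positivity)] at this
    linarith
  refine ⟨|M| * Real.exp (1 + 1 / (4 * c)) + 1, by positivity, fun x hx => ?_⟩
  have h1 := hM (1 + x) (by linarith)
  -- Completing the square, `x ≤ c x² + 1 / (4 c)`, reduces the Gaussian to a simple exponential.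
  have h2 : -(c * x ^ 2) ≤ -(1 + x) + (1 + 1 / (4 * c)) := by
    have : (1 / (4 * c)) = c * (1 / (2 * c)) ^ 2 := by field_simp; norm_num
    rw [this]
    have h3 : c * x ^ 2 - x + c * (1 / (2 * c)) ^ 2 = c * (x - 1 / (2 * c)) ^ 2 := by
      field_simp; ring
    nlinarith [mul_nonneg hc.le (sq_nonneg (x - 1 / (2 * c)))]
  calc (1 + x) ^ n * Real.exp (-(c * x ^ 2))
      ≤ (1 + x) ^ n * Real.exp (-(1 + x) + (1 + 1 / (4 * c))) := by gcongr
    _ = (1 + x) ^ n * Real.exp (-(1 + x)) * Real.exp (1 + 1 / (4 * c)) := by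
        rw [Real.exp_add]; ring
    _ ≤ |M| * Real.exp (1 + 1 / (4 * c)) := by gcongr; exact h1.trans (le_abs_self M)
    _ ≤ _ := by linarith

section ExpSchwartz

variable {E : Type*} [NormedAddCommGroup E] [NormedSpace ℝ E]

/-- The exponential of a function of temperate growth whose real part is at most `C - c |x|²`. -/
def expSchwartz (w : E → ℂ) (hw : w.HasTemperateGrowth)
    (hre : ∃ C c : ℝ, 0 < c ∧ ∀ x, (w x).re ≤ C - c * ‖x‖ ^ 2) : 𝓢(E, ℂ) where
  toFun := Complex.exp ∘ w
  smooth' := (Complex.contDiff_exp (𝕜 := ℝ)).comp hw.1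
  decay' := by
    intro k n
    obtain ⟨C, c, hc, hC⟩ := hre
    obtain ⟨m, K, hK0, hK⟩ := hw.norm_iteratedFDeriv_le_uniform n
    set A : ℝ := ∑ i ∈ Finset.range (n + 1), ‖iteratedFDeriv ℝ i Complex.exp (0 : ℂ)‖ with hA
    obtain ⟨M, hM0, hM⟩ := exists_pow_mul_exp_neg_sq_le (k + m * n) hc
    refine ⟨n.factorial * A * (K + 1) ^ n * Real.exp C * M, fun x => ?_⟩
    have hA' : ∀ i ≤ n, ‖iteratedFDeriv ℝ i Complex.exp (w x)‖ ≤ Real.exp (w x).re * A := by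
      intro i hi
      rw [norm_iteratedFDeriv_cexp]
      gcongr
      exact Finset.single_le_sum (f := fun i => ‖iteratedFDeriv ℝ i Complex.exp (0 : ℂ)‖)
        (fun _ _ => norm_nonneg _) (Finset.mem_range.2 (by omega))
    have hx1 : 1 ≤ 1 + ‖x‖ := by linarith [norm_nonneg x]
    -- Faà di Bruno's estimate wants the `i`-th derivative of the exponent below an `i`-th power.
    -- With `K + 1` instead of `K` the base is at least one and so lies below its own powers.
    have hD : ∀ i, 1 ≤ i → i ≤ n →
        ‖iteratedFDeriv ℝ i w x‖ ≤ ((K + 1) * (1 + ‖x‖) ^ m) ^ i := by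
      intro i hi hin
      refine (hK i hin x).trans ?_
      have h1 : 1 ≤ (K + 1) * (1 + ‖x‖) ^ m :=
        one_le_mul_of_one_le_of_one_le (by linarith) (one_le_pow₀ hx1)
      calc K * (1 + ‖x‖) ^ m ≤ (K + 1) * (1 + ‖x‖) ^ m := by gcongr; linarith
        _ ≤ _ := le_self_pow₀ h1 (by omega)
    have h := norm_iteratedFDeriv_comp_le (𝕜 := ℝ) (N := ∞) (Complex.contDiff_exp (𝕜 := ℝ))
      hw.1 (n := n) (by exact_mod_cast le_top) x hA' hD
    have hA0 : 0 ≤ A := Finset.sum_nonneg fun _ _ => norm_nonneg _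
    calc ‖x‖ ^ k * ‖iteratedFDeriv ℝ n (Complex.exp ∘ w) x‖
        ≤ (1 + ‖x‖) ^ k * (n.factorial * (Real.exp (C - c * ‖x‖ ^ 2) * A) *
            ((K + 1) * (1 + ‖x‖) ^ m) ^ n) := by
          gcongr
          · linarith
          · refine h.trans ?_
            gcongr
            exact hC x
      _ = n.factorial * A * (K + 1) ^ n * Real.exp C *
            ((1 + ‖x‖) ^ (k + m * n) * Real.exp (-(c * ‖x‖ ^ 2))) := by
          rw [sub_eq_add_neg, Real.exp_add, pow_add, pow_mul, mul_pow]; ring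
      _ ≤ _ := by gcongr; exact hM _ (norm_nonneg _)

end ExpSchwartz

/-- The complex bilinear pairing of a complex covector with a point of `ℝ³`. -/
def cdot (b : Fin 3 → ℂ) (x : E3) : ℂ := ∑ k, b k * (x k : ℂ)

theorem laplacian_eq_sum_fderiv {f : E3 → ℂ} (x : E3) (hf : ContDiff ℝ 2 f) :
    (Δ f) x = ∑ k : Fin 3, fderiv ℝ (fun y => fderiv ℝ f y (EuclideanSpace.single k 1)) x
      (EuclideanSpace.single k 1) := by
  rw [InnerProductSpace.laplacian_eq_iteratedFDeriv_orthonormalBasis f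
    (EuclideanSpace.basisFun (Fin 3) ℝ)]
  refine Finset.sum_congr rfl fun k _ => ?_
  rw [iteratedFDeriv_two_apply]
  have h : DifferentiableAt ℝ (fderiv ℝ f) x :=
    ((hf.fderiv_right (m := 1) (by norm_num)).differentiable (by norm_num)) x
  rw [fderiv_clm_apply h (differentiableAt_const _)]
  simp

theorem hasFDerivAt_cdot (b : Fin 3 → ℂ) (x : E3) :
    HasFDerivAt (cdot b) (∑ k, (EuclideanSpace.proj k : E3 →L[ℝ] ℝ).smulRight (b k)) x := by
  have h : cdot b = fun y => ∑ k, (EuclideanSpace.proj k : E3 →L[ℝ] ℝ).smulRight (b k) y := by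
    funext y
    simp [cdot, mul_comm]
  rw [h]
  have := (∑ k, (EuclideanSpace.proj k : E3 →L[ℝ] ℝ).smulRight (b k)).hasFDerivAt (x := x)
  convert this using 1
  ext y
  simp

/-- The quadratic polynomial `-(α/2) |y|² + b·y + c`. -/
def quadExp (α : ℂ) (b : Fin 3 → ℂ) (c : ℂ) (y : E3) : ℂ :=
  -(α / 2) * ((‖y‖ ^ 2 : ℝ) : ℂ) + cdot b y + c

theorem hasTemperateGrowth_cdot (b : Fin 3 → ℂ) : (cdot b).HasTemperateGrowth := by
  have h : cdot b = ⇑(∑ k, (EuclideanSpace.proj k : E3 →L[ℝ] ℝ).smulRight (b k)) := by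
    funext y
    simp [cdot, mul_comm]
  rw [h]
  exact ContinuousLinearMap.hasTemperateGrowth _

theorem hasTemperateGrowth_quadExp (α : ℂ) (b : Fin 3 → ℂ) (c : ℂ) :
    (quadExp α b c).HasTemperateGrowth := by
  have h1 : (fun y : E3 => ((‖y‖ ^ 2 : ℝ) : ℂ)).HasTemperateGrowth :=
    Function.HasTemperateGrowth.comp Function.Complex.hasTemperateGrowth_ofReal (Function.hasTemperateGrowth_norm_sq (H := E3))
  exact (((Function.HasTemperateGrowth.const _).mul h1).add (hasTemperateGrowth_cdot b)).add
    (Function.HasTemperateGrowth.const _)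

theorem fderiv_cexp_quadExp (α : ℂ) (b : Fin 3 → ℂ) (c : ℂ) (a y : E3) (k : Fin 3) :
    fderiv ℝ (fun x => Complex.exp (quadExp α b c (x - a))) y (EuclideanSpace.single k 1) =
      (b k - α * ((y - a) k : ℝ)) * Complex.exp (quadExp α b c (y - a)) := by
  have h1 : HasFDerivAt (fun x : E3 => x - a) (ContinuousLinearMap.id ℝ E3) y :=
    (hasFDerivAt_id y).sub_const a
  have h2 := (Complex.ofRealCLM.hasFDerivAt (x := ‖y - a‖ ^ 2)).comp y h1.norm_sq
  have h3 := (hasFDerivAt_cdot b (y - a)).comp y h1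
  have h4 := (((h2.const_mul (-(α / 2))).add h3).add_const c).cexp
  have h5 : HasFDerivAt (fun x => Complex.exp (quadExp α b c (x - a))) _ y := h4
  rw [h5.fderiv]
  simp [quadExp, PiLp.inner_apply, mul_comm]
  ring

/-- Each derivative brings down the component `b k - α (y - a) k` of the gradient of the exponent.
The second derivative also hits this factor, which contributes `-α` for each of the three
coordinates. -/
theorem laplacian_cexp_quadExp (α : ℂ) (b : Fin 3 → ℂ) (c : ℂ) (a y : E3) :
    (Δ (fun x => Complex.exp (quadExp α b c (x - a)))) y =
      ((∑ k, (b k - α * ((y - a) k : ℝ)) ^ 2) - 3 * α) *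
        Complex.exp (quadExp α b c (y - a)) := by
  have hc : ContDiff ℝ 2 (fun x => Complex.exp (quadExp α b c (x - a))) :=
    (Complex.contDiff_exp (𝕜 := ℝ)).comp
      ((contDiff_infty.1 (hasTemperateGrowth_quadExp α b c).1 2).comp
        (contDiff_id.sub contDiff_const))
  rw [laplacian_eq_sum_fderiv y hc]
  have h : ∀ k : Fin 3, fderiv ℝ (fun x => fderiv ℝ
        (fun x => Complex.exp (quadExp α b c (x - a))) x (EuclideanSpace.single k 1)) y
        (EuclideanSpace.single k 1) =
      ((b k - α * ((y - a) k : ℝ)) ^ 2 - α) * Complex.exp (quadExp α b c (y - a)) := by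
    intro k
    have h0 : (fun x => fderiv ℝ (fun x => Complex.exp (quadExp α b c (x - a))) x
        (EuclideanSpace.single k 1)) = fun x => (b k - α * ((x - a) k : ℝ)) *
          Complex.exp (quadExp α b c (x - a)) := by
      funext x; exact fderiv_cexp_quadExp α b c a x k
    have h1 : HasFDerivAt (fun x : E3 => x - a) (ContinuousLinearMap.id ℝ E3) y :=
      (hasFDerivAt_id y).sub_const a
    have h2 : HasFDerivAt (fun x : E3 => (x - a) k)
        ((EuclideanSpace.proj k : E3 →L[ℝ] ℝ).comp (ContinuousLinearMap.id ℝ E3)) y :=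
      HasFDerivAt.comp (g := fun x : E3 => x k) y
        ((EuclideanSpace.proj k : E3 →L[ℝ] ℝ).hasFDerivAt (x := y - a)) h1
    have h3 := (((Complex.ofRealCLM.hasFDerivAt (x := (y - a) k)).comp y h2).const_mul α).const_sub (b k)
    have h4 := (hc.differentiable (by norm_num) y).hasFDerivAt
    have h6 : HasFDerivAt (fun x => (b k - α * ((x - a) k : ℝ)) *
          Complex.exp (quadExp α b c (x - a))) _ y := h3.mul h4
    rw [h0, h6.fderiv]
    have h5 := fderiv_cexp_quadExp α b c a y k
    simp only [add_apply, smul_apply, h5]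
    simp
    ring
  rw [Finset.sum_congr rfl fun k _ => h k, ← Finset.sum_mul, Finset.sum_sub_distrib]
  simp

end

/-! ### Exponents under the free and the harmonic evolution. -/

section

/-- Time evolved exponent of a Gaussian wave packet of the free test particle. -/
def freeExp (ε t : ℝ) (b : Fin 3 → ℂ) (R : E3) : ℂ :=
  quadExp ((ε : ℂ) ^ 2 * (1 + Complex.I * t))⁻¹ (fun k => b k / (1 + Complex.I * t))
    (Complex.I * ε ^ 2 / 2 * (∑ k, b k ^ 2) * (t / (1 + Complex.I * t)) -
      3 / 2 * Complex.log (1 + Complex.I * t)) R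

/-- Time evolved exponent of a coherent state of an oscillator. -/
def oscExp (ε t : ℝ) (z : Fin 3 → ℂ) (y : E3) : ℂ :=
  quadExp ((ε : ℂ) ^ 2)⁻¹ (fun k => Complex.exp (-(Complex.I * t / ε)) * z k)
    (ε ^ 2 / 4 * (∑ k, z k ^ 2) * (1 - Complex.exp (-(Complex.I * t / ε)) ^ 2) -
      3 / 2 * Complex.I * t / ε) y

/-- Centre of the Gaussian wave packet of the test particle. -/
def freeCenter (ε t : ℝ) (b : Fin 3 → ℂ) : E3 :=
  WithLp.toLp 2 fun k => ε ^ 2 * ((b k).re + t * (b k).im)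

/-- Centre of the coherent state of an oscillator, relative to its equilibrium. -/
def oscCenter (ε t : ℝ) (z : Fin 3 → ℂ) : E3 :=
  WithLp.toLp 2 fun k => ε ^ 2 * (Complex.exp (-(Complex.I * t / ε)) * z k).re

theorem one_add_I_mul_ne_zero (t : ℝ) : (1 + Complex.I * t : ℂ) ≠ 0 := by
  intro h
  have := congrArg Complex.re h
  simp at this

theorem exp_neg_I_mul_div (ε t : ℝ) : Complex.exp (-(Complex.I * t / ε)) =
    (Real.cos (t / ε) : ℂ) - Complex.I * (Real.sin (t / ε) : ℂ) := by
  have : -(Complex.I * t / ε) = -((t / ε : ℝ) : ℂ) * Complex.I := by push_cast; ring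
  rw [this, Complex.exp_mul_I]
  push_cast
  rw [Complex.cos_neg, Complex.sin_neg]
  ring

/-- Complete the square. The modulus is a Gaussian of width `ε √(1 + t²)` around the classical
position. Apart from the logarithm, which expresses the spreading, its height does not depend on
time; this is what later carries a bound on the size of a kicked packet from one time to all others.
-/
theorem re_freeExp {ε : ℝ} (hε : 0 < ε) (t : ℝ) (b : Fin 3 → ℂ) (R : E3) :
    (freeExp ε t b R).re = ε ^ 2 / 2 * (∑ k, (b k).re ^ 2) - 3 / 4 * Real.log (1 + t ^ 2) -
      ‖R - freeCenter ε t b‖ ^ 2 / (2 * ε ^ 2 * (1 + t ^ 2)) := by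
  have h0 : (1 + t ^ 2 : ℝ) ≠ 0 := by positivity
  have hinv : (1 + Complex.I * t : ℂ)⁻¹ = ((1 / (1 + t ^ 2) : ℝ) : ℂ) * (1 - Complex.I * t) := by
    have := one_add_I_mul_ne_zero t
    rw [inv_eq_iff_eq_inv, mul_inv]
    push_cast
    have h1 : (1 - Complex.I * t : ℂ) ≠ 0 := by
      have := one_add_I_mul_ne_zero (-t); push_cast at this; simpa [sub_eq_add_neg] using this
    have h2 : (1 + (t : ℂ) ^ 2) ≠ 0 := by exact_mod_cast h0
    field_simp
    ring_nf
    simp [Complex.I_sq]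
  have hlog : (Complex.log (1 + Complex.I * t)).re = 1 / 2 * Real.log (1 + t ^ 2) := by
    rw [Complex.log_re, Complex.norm_def, Real.log_sqrt (Complex.normSq_nonneg _)]
    simp [Complex.normSq_apply]
    ring_nf
  have he : (ε : ℂ) ≠ 0 := by exact_mod_cast hε.ne'
  have hε' := hε.ne'
  unfold freeExp quadExp cdot
  simp only [div_eq_mul_inv, mul_inv, hinv, EuclideanSpace.real_norm_sq_eq, Fin.sum_univ_three,
    freeCenter, PiLp.sub_apply, ← Complex.ofReal_pow, ← Complex.ofReal_inv]
  simp only [Complex.add_re, Complex.sub_re, Complex.mul_re, Complex.mul_im, Complex.ofReal_re,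
    Complex.ofReal_im, Complex.I_re, Complex.I_im, Complex.neg_re, Complex.neg_im, Complex.add_im,
    Complex.sub_im, Complex.one_re, Complex.one_im, hlog, pow_two]
  norm_num
  field_simp
  ring

/-- A coherent state: the phase `exp (-it/ε)` rotates `z` in phase space, and neither the width nor
the maximal modulus changes. The quadratic constant in `oscExp` is what lets `cos² + sin² = 1`
remove the time dependence. -/
theorem re_oscExp {ε : ℝ} (hε : 0 < ε) (t : ℝ) (z : Fin 3 → ℂ) (y : E3) :
    (oscExp ε t z y).re = ε ^ 2 / 2 * (∑ k, (z k).re ^ 2) -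
      ‖y - oscCenter ε t z‖ ^ 2 / (2 * ε ^ 2) := by
  have he : (ε : ℂ) ≠ 0 := by exact_mod_cast hε.ne'
  have hε' := hε.ne'
  have hcs : Real.cos (t / ε) ^ 2 = 1 - Real.sin (t / ε) ^ 2 := by
    linarith [Real.sin_sq_add_cos_sq (t / ε)]
  unfold oscExp quadExp cdot
  simp only [oscCenter, exp_neg_I_mul_div]
  set cs := Real.cos (t / ε)
  set sn := Real.sin (t / ε)
  simp only [div_eq_mul_inv, mul_inv, EuclideanSpace.real_norm_sq_eq, Fin.sum_univ_three,
    PiLp.sub_apply, ← Complex.ofReal_pow, ← Complex.ofReal_inv]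
  simp only [Complex.add_re, Complex.sub_re, Complex.mul_re, Complex.mul_im, Complex.ofReal_re,
    Complex.ofReal_im, Complex.I_re, Complex.I_im, Complex.neg_re, Complex.neg_im, Complex.add_im,
    Complex.sub_im, Complex.one_re, Complex.one_im, pow_two]
  norm_num
  field_simp
  ring_nf
  simp only [show cs ^ 2 = 1 - sn ^ 2 from hcs]
  ring

/-- The Schrödinger equation in logarithmic form, `∂ₜ w = (i ε²/2) (∇w·∇w + Δw)` with the bilinear
square. The prefactor is `(ε⁴/2) / ε²` because time is measured in units of `ε²`. -/
theorem hasDerivAt_freeExp {ε : ℝ} (hε : 0 < ε) (t : ℝ) (b : Fin 3 → ℂ) (R : E3) :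
    HasDerivAt (fun s : ℝ => freeExp ε s b R)
      (Complex.I * ε ^ 2 / 2 * ((∑ k, (b k / (1 + Complex.I * t) -
        ((ε : ℂ) ^ 2 * (1 + Complex.I * t))⁻¹ * ((R k : ℝ) : ℂ)) ^ 2) -
          3 * ((ε : ℂ) ^ 2 * (1 + Complex.I * t))⁻¹)) t := by
  have he : (ε : ℂ) ≠ 0 := by exact_mod_cast hε.ne'
  have h0 := one_add_I_mul_ne_zero t
  have h1 : HasDerivAt (fun s : ℝ => (s : ℂ)) 1 t := Complex.ofRealCLM.hasDerivAt
  have h2 : HasDerivAt (fun s : ℝ => (1 + Complex.I * s : ℂ)) Complex.I t := by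
    simpa using (h1.const_mul Complex.I).const_add 1
  have h3 := h2.inv h0
  have h4 : HasDerivAt (fun s : ℝ => Complex.log (1 + Complex.I * s))
      (Complex.I / (1 + Complex.I * t)) t := by
    refine h2.clog_real ?_
    left; simp
  have h5 := ((h3.const_mul (-(((‖R‖ ^ 2 : ℝ) : ℂ) / (2 * (ε : ℂ) ^ 2)))).add
    (h3.const_mul (cdot b R))).add (((h1.mul h3).const_mul
      (Complex.I * ε ^ 2 / 2 * (∑ k, b k ^ 2))).sub (h4.const_mul (3 / 2)))
  refine (h5.congr_of_eventuallyEq (f₁ := fun s : ℝ => freeExp ε s b R)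
    (Eventually.of_forall fun s => ?_)).congr_deriv ?_
  · have h0 := one_add_I_mul_ne_zero s
    simp only [freeExp, quadExp, cdot, Pi.add_apply, Pi.mul_apply, Pi.sub_apply,
      Fin.sum_univ_three, Pi.inv_apply]
    field_simp
  simp only [cdot, Fin.sum_univ_three, EuclideanSpace.real_norm_sq_eq]
  push_cast
  simp only [Pi.inv_apply]
  field_simp
  ring_nf

/-- The same logarithmic equation with the extra factor `ε⁻¹` of the oscillators: `ε/2` in front of
the kinetic part and `ε⁻³` in front of the potential. -/
theorem hasDerivAt_oscExp {ε : ℝ} (hε : 0 < ε) (t : ℝ) (z : Fin 3 → ℂ) (y : E3) :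
    HasDerivAt (fun s : ℝ => oscExp ε s z y)
      (Complex.I * ε / 2 * ((∑ k, (Complex.exp (-(Complex.I * t / ε)) * z k -
        ((ε : ℂ) ^ 2)⁻¹ * ((y k : ℝ) : ℂ)) ^ 2) - 3 * ((ε : ℂ) ^ 2)⁻¹) -
        Complex.I / ε ^ 3 * (((‖y‖ ^ 2 : ℝ) : ℂ) / 2)) t := by
  have he : (ε : ℂ) ≠ 0 := by exact_mod_cast hε.ne'
  have h1 : HasDerivAt (fun s : ℝ => (s : ℂ)) 1 t := Complex.ofRealCLM.hasDerivAt
  have h2 : HasDerivAt (fun s : ℝ => Complex.exp (-(Complex.I * s / ε)))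
      (Complex.exp (-(Complex.I * t / ε)) * (-(Complex.I * 1 / ε))) t :=
    (((h1.const_mul Complex.I).div_const (ε : ℂ)).neg).cexp
  have h3 := ((h2.const_mul (cdot z y)).const_add
      (-(((ε : ℂ) ^ 2)⁻¹ / 2) * ((‖y‖ ^ 2 : ℝ) : ℂ))).add
      ((((h2.pow 2).const_sub 1).const_mul (ε ^ 2 / 4 * (∑ k, z k ^ 2))).sub
        ((h1.const_mul (3 / 2 * Complex.I)).div_const (ε : ℂ)))
  refine (h3.congr_of_eventuallyEq (f₁ := fun s : ℝ => oscExp ε s z y)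
    (Eventually.of_forall fun s => ?_)).congr_deriv ?_
  · simp only [oscExp, quadExp, cdot, Pi.add_apply, Pi.sub_apply, Pi.pow_apply, Finset.sum_mul]
    congr 2
    refine Finset.sum_congr rfl fun k _ => ?_
    ring
  simp only [cdot, Fin.sum_univ_three, EuclideanSpace.real_norm_sq_eq]
  push_cast
  field_simp
  ring

end

/-! ### Differentiation in `L²`, and wave packets on configuration space. -/

section

section L2Convergence

variable {X : Type*} [MeasurableSpace X] {μ : Measure X}

theorem tendsto_Lp_two_of_dominated {ι : Type*} {l : Filter ι} [l.IsCountablyGenerated]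
    {f : ι → Lp ℂ 2 μ} {g : Lp ℂ 2 μ} {F : ι → X → ℂ} {G : X → ℂ} {B : X → ℝ}
    (hf : ∀ i, (f i : X → ℂ) =ᵐ[μ] F i) (hg : (g : X → ℂ) =ᵐ[μ] G)
    (hF : ∀ i, Measurable (F i)) (hG : Measurable G) (hB : MemLp B 2 μ)
    (hbound : ∀ᶠ i in l, ∀ x, ‖F i x - G x‖ ≤ B x)
    (hlim : ∀ x, Tendsto (fun i => F i x) l (𝓝 (G x))) : Tendsto f l (𝓝 g) := by
  rw [Lp.tendsto_Lp_iff_tendsto_eLpNorm']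
  have h1 : ∀ i, eLpNorm (⇑(f i) - ⇑g) 2 μ = (∫⁻ x, ‖F i x - G x‖ₑ ^ (2 : ℝ) ∂μ) ^ (1 / 2 : ℝ) := by
    intro i
    rw [eLpNorm_congr_ae ((hf i).sub hg), eLpNorm_eq_lintegral_rpow_enorm_toReal (by norm_num)
      (by norm_num)]
    simp
  simp_rw [h1]
  have h2 : Tendsto (fun i => ∫⁻ x, ‖F i x - G x‖ₑ ^ (2 : ℝ) ∂μ) l (𝓝 (∫⁻ _ : X, 0 ∂μ)) := by
    refine tendsto_lintegral_filter_of_dominated_convergence (fun x => ‖B x‖ₑ ^ (2 : ℝ)) ?_ ?_ ?_ ?_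
    · exact Eventually.of_forall fun i => ((hF i).sub hG).enorm.pow_const _
    · filter_upwards [hbound] with i hi
      refine Eventually.of_forall fun x => ?_
      refine ENNReal.rpow_le_rpow ?_ (by norm_num)
      rw [enorm_le_iff_norm_le]
      exact (hi x).trans (le_abs_self _)
    · have := hB.2
      rw [eLpNorm_lt_top_iff_lintegral_rpow_enorm_lt_top (by norm_num) (by norm_num)] at this
      simpa using this.ne
    · refine Eventually.of_forall fun x => ?_
      have h3 : Tendsto (fun i => F i x - G x) l (𝓝 0) := by
        simpa using (hlim x).sub_const (G x)
      have h4 := (h3.enorm).ennrpow_const (2 : ℝ)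
      simpa using h4
  have h3 := h2.ennrpow_const (1 / 2 : ℝ)
  simpa using h3

/-- By the mean value inequality a bound `B` for the pointwise time derivative also bounds the
difference quotients, so that `2 B` dominates their distance to the derivative. -/
theorem hasDerivAt_Lp_two_of_dominated {f : ℝ → Lp ℂ 2 μ} {g : Lp ℂ 2 μ} {F F' : ℝ → X → ℂ}
    {B : X → ℝ} {t₀ : ℝ} (hf : ∀ t, (f t : X → ℂ) =ᵐ[μ] F t) (hg : (g : X → ℂ) =ᵐ[μ] F' t₀)
    (hF : ∀ t, Measurable (F t)) (hF' : Measurable (F' t₀)) (hB : MemLp B 2 μ)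
    (hderiv : ∀ t ∈ Metric.ball t₀ 1, ∀ x, HasDerivAt (fun s => F s x) (F' t x) t)
    (hbound : ∀ t ∈ Metric.ball t₀ 1, ∀ x, ‖F' t x‖ ≤ B x) : HasDerivAt f g t₀ := by
  rw [hasDerivAt_iff_tendsto_slope_zero]
  have ht₀ : t₀ ∈ Metric.ball t₀ 1 := Metric.mem_ball_self one_pos
  refine tendsto_Lp_two_of_dominated (F := fun h x => h⁻¹ • (F (t₀ + h) x - F t₀ x))
    (G := F' t₀) (B := fun x => 2 * B x) ?_ hg ?_ hF' (hB.const_mul 2) ?_ ?_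
  · intro h
    have h1 := Lp.coeFn_smul (h⁻¹ : ℝ) (f (t₀ + h) - f t₀)
    have h2 := Lp.coeFn_sub (f (t₀ + h)) (f t₀)
    filter_upwards [h1, h2, hf (t₀ + h), hf t₀] with x h1 h2 h3 h4
    rw [h1, Pi.smul_apply, h2, Pi.sub_apply, h3, h4]
  · intro h
    simp only [Complex.real_smul]
    exact ((hF _).sub (hF _)).const_mul _
  · rw [eventually_nhdsWithin_iff]
    filter_upwards [Metric.ball_mem_nhds (0 : ℝ) one_pos] with h hh hh0 x
    have hmem : t₀ + h ∈ Metric.ball t₀ 1 := by simpa [Metric.mem_ball, dist_eq_norm] using hh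
    have h1 := (convex_ball t₀ 1).norm_image_sub_le_of_norm_hasDerivWithin_le
      (fun t ht => (hderiv t ht x).hasDerivWithinAt) (fun t ht => hbound t ht x) ht₀ hmem
    have h2 : ‖h⁻¹ • (F (t₀ + h) x - F t₀ x)‖ ≤ B x := by
      rw [norm_smul, norm_inv]
      have : 0 < ‖h‖ := norm_pos_iff.2 hh0
      rw [inv_mul_le_iff₀ this]
      have h3 : t₀ + h - t₀ = h := by ring
      rw [h3] at h1
      linarith
    calc _ ≤ ‖h⁻¹ • (F (t₀ + h) x - F t₀ x)‖ + ‖F' t₀ x‖ := norm_sub_le _ _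
      _ ≤ 2 * B x := by linarith [hbound t₀ ht₀ x]
  · intro x
    exact (hderiv t₀ ht₀ x).tendsto_slope_zero

end L2Convergence

/-- Parameters of the wave packets: complex momenta of the test particle and of the oscillators. -/
abbrev Params (N : ℕ) : Type := (Fin 3 → ℂ) × (Fin N → Fin 3 → ℂ)

variable {N : ℕ}

instance isAddHaarMeasure_pi : (volume : Measure (Fin N → E3)).IsAddHaarMeasure :=
  inferInstanceAs (Measure.IsAddHaarMeasure (Measure.pi fun _ : Fin N => (volume : Measure E3)))

instance isAddHaarMeasure_config : (volume : Measure (Config N)).IsAddHaarMeasure :=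
  Measure.prod.instIsAddHaarMeasure (volume : Measure E3) (volume : Measure (Fin N → E3))

/-- The exponent of the Gaussian wave packet with parameters `p` at time `t`. -/
def packetExp (ε : ℝ) (a : Fin N → E3) (t : ℝ) (p : Params N) (X : Config N) : ℂ :=
  freeExp ε t p.1 X.1 + ∑ j, oscExp ε t (p.2 j) (X.2 j - a j)

/-- `Config N` carries the maximum norm. The comparison merges Gaussian bounds in the separate
variables into one Gaussian in `‖X‖`. -/
theorem norm_sq_config_le (X : Config N) : ‖X‖ ^ 2 ≤ ‖X.1‖ ^ 2 + ∑ j, ‖X.2 j‖ ^ 2 := by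
  have hs : 0 ≤ ∑ j, ‖X.2 j‖ ^ 2 := Finset.sum_nonneg fun _ _ => sq_nonneg _
  have h1 : ‖X‖ ≤ Real.sqrt (‖X.1‖ ^ 2 + ∑ j, ‖X.2 j‖ ^ 2) := by
    rw [Prod.norm_def]
    refine max_le (Real.le_sqrt_of_sq_le (by linarith)) ?_
    refine (pi_norm_le_iff_of_nonneg (Real.sqrt_nonneg _)).2 fun j => ?_
    refine Real.le_sqrt_of_sq_le ?_
    have := Finset.single_le_sum (f := fun j => ‖X.2 j‖ ^ 2) (fun _ _ => sq_nonneg _)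
      (Finset.mem_univ j)
    nlinarith [sq_nonneg ‖X.1‖]
  calc ‖X‖ ^ 2 ≤ Real.sqrt (‖X.1‖ ^ 2 + ∑ j, ‖X.2 j‖ ^ 2) ^ 2 := by gcongr
    _ = _ := Real.sq_sqrt (by positivity)

theorem half_norm_sq_sub_le (x c : E3) : ‖x‖ ^ 2 / 2 - ‖c‖ ^ 2 ≤ ‖x - c‖ ^ 2 := by
  have h1 : ‖x‖ ≤ ‖x - c‖ + ‖c‖ := by simpa using norm_add_le (x - c) c
  have h2 : ‖x‖ ^ 2 ≤ (‖x - c‖ + ‖c‖) ^ 2 := by gcongr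
  nlinarith [sq_nonneg (‖x - c‖ - ‖c‖)]

/-- The factor by which a packet exceeds a normalized Gaussian profile, logarithmically. -/
def packetMass (ε : ℝ) (p : Params N) : ℝ :=
  ε ^ 2 / 2 * ((∑ k, (p.1 k).re ^ 2) + ∑ j, ∑ k, (p.2 j k).re ^ 2)

theorem re_packetExp {ε : ℝ} (hε : 0 < ε) (a : Fin N → E3) (t : ℝ) (p : Params N)
    (X : Config N) :
    (packetExp ε a t p X).re = packetMass ε p - 3 / 4 * Real.log (1 + t ^ 2) -
      ‖X.1 - freeCenter ε t p.1‖ ^ 2 / (2 * ε ^ 2 * (1 + t ^ 2)) -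
      ∑ j, ‖X.2 j - (a j + oscCenter ε t (p.2 j))‖ ^ 2 / (2 * ε ^ 2) := by
  rw [packetExp, Complex.add_re, Complex.re_sum, re_freeExp hε]
  simp_rw [re_oscExp hε]
  rw [Finset.sum_sub_distrib, packetMass, ← Finset.mul_sum]
  simp_rw [sub_add_eq_sub_sub]
  ring

theorem continuous_freeCenter (ε : ℝ) (b : Fin 3 → ℂ) : Continuous fun t => freeCenter ε t b := by
  unfold freeCenter
  exact (PiLp.continuous_toLp 2 _).comp (by fun_prop)

theorem continuous_oscCenter (ε : ℝ) (z : Fin 3 → ℂ) : Continuous fun t => oscCenter ε t z := by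
  unfold oscCenter
  refine (PiLp.continuous_toLp 2 _).comp (continuous_pi fun k => ?_)
  exact continuous_const.mul (Complex.continuous_re.comp (by fun_prop))

/-- On a compact time interval the centres stay bounded and the width is at most that at time `T`,
so a single Gaussian dominates all packets. It makes the packets Schwartz functions and is the
dominating function for differentiation in time. -/
theorem exists_re_packetExp_le {ε : ℝ} (hε : 0 < ε) (a : Fin N → E3) (p : Params N) (T : ℝ) :
    ∃ C c : ℝ, 0 < c ∧ ∀ t ∈ Icc (-T) T, ∀ X : Config N,
      (packetExp ε a t p X).re ≤ C - c * ‖X‖ ^ 2 := by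
  obtain ⟨K₀, hK₀⟩ := (isCompact_Icc (a := -T) (b := T)).exists_bound_of_continuousOn
    (continuous_freeCenter ε p.1).continuousOn
  have h : ∀ j, ∃ K, ∀ t ∈ Icc (-T) T, ‖a j + oscCenter ε t (p.2 j)‖ ≤ K := fun j =>
    (isCompact_Icc (a := -T) (b := T)).exists_bound_of_continuousOn
      (continuous_const.add (continuous_oscCenter ε (p.2 j))).continuousOn
  choose K hK using h
  refine ⟨packetMass ε p + K₀ ^ 2 / (2 * ε ^ 2) + ∑ j, K j ^ 2 / (2 * ε ^ 2),
    1 / (4 * ε ^ 2 * (1 + T ^ 2)), by positivity, fun t ht X => ?_⟩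
  rw [re_packetExp hε]
  have hT : t ^ 2 ≤ T ^ 2 := sq_le_sq' ht.1 ht.2
  have h1 : ‖X.1‖ ^ 2 / (4 * ε ^ 2 * (1 + T ^ 2)) - K₀ ^ 2 / (2 * ε ^ 2) ≤
      ‖X.1 - freeCenter ε t p.1‖ ^ 2 / (2 * ε ^ 2 * (1 + t ^ 2)) := by
    have h2 := half_norm_sq_sub_le X.1 (freeCenter ε t p.1)
    have h3 : ‖freeCenter ε t p.1‖ ^ 2 ≤ K₀ ^ 2 := by gcongr; exact hK₀ t ht
    calc ‖X.1‖ ^ 2 / (4 * ε ^ 2 * (1 + T ^ 2)) - K₀ ^ 2 / (2 * ε ^ 2)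
        ≤ ‖X.1‖ ^ 2 / (4 * ε ^ 2 * (1 + t ^ 2)) - K₀ ^ 2 / (2 * ε ^ 2 * (1 + t ^ 2)) := by
          have h5 : 2 * ε ^ 2 ≤ 2 * ε ^ 2 * (1 + t ^ 2) :=
            le_mul_of_one_le_right (by positivity) (by nlinarith [sq_nonneg t])
          gcongr
      _ = (‖X.1‖ ^ 2 / 2 - K₀ ^ 2) / (2 * ε ^ 2 * (1 + t ^ 2)) := by field_simp; ring
      _ ≤ _ := by gcongr; linarith
  have h4 : ∀ j, ‖X.2 j‖ ^ 2 / (4 * ε ^ 2 * (1 + T ^ 2)) - K j ^ 2 / (2 * ε ^ 2) ≤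
      ‖X.2 j - (a j + oscCenter ε t (p.2 j))‖ ^ 2 / (2 * ε ^ 2) := by
    intro j
    have h2 := half_norm_sq_sub_le (X.2 j) (a j + oscCenter ε t (p.2 j))
    have h3 : ‖a j + oscCenter ε t (p.2 j)‖ ^ 2 ≤ K j ^ 2 := by gcongr; exact hK j t ht
    calc ‖X.2 j‖ ^ 2 / (4 * ε ^ 2 * (1 + T ^ 2)) - K j ^ 2 / (2 * ε ^ 2)
        ≤ ‖X.2 j‖ ^ 2 / (4 * ε ^ 2) - K j ^ 2 / (2 * ε ^ 2) := by
          have h5 : 4 * ε ^ 2 ≤ 4 * ε ^ 2 * (1 + T ^ 2) :=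
            le_mul_of_one_le_right (by positivity) (by nlinarith [sq_nonneg T])
          gcongr
      _ = (‖X.2 j‖ ^ 2 / 2 - K j ^ 2) / (2 * ε ^ 2) := by field_simp; ring
      _ ≤ _ := by gcongr; linarith
  have h5 := Finset.sum_le_sum fun j (_ : j ∈ Finset.univ) => h4 j
  rw [Finset.sum_sub_distrib, ← Finset.sum_div] at h5
  have h6 : 0 ≤ Real.log (1 + t ^ 2) := Real.log_nonneg (by nlinarith [sq_nonneg t])
  have h7 : 1 / (4 * ε ^ 2 * (1 + T ^ 2)) * ‖X‖ ^ 2 ≤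
      ‖X.1‖ ^ 2 / (4 * ε ^ 2 * (1 + T ^ 2)) +
        (∑ j, ‖X.2 j‖ ^ 2) / (4 * ε ^ 2 * (1 + T ^ 2)) := by
    rw [← add_div, one_div, inv_mul_eq_div]
    gcongr
    exact norm_sq_config_le X
  linarith

theorem hasTemperateGrowth_packetExp (ε : ℝ) (a : Fin N → E3) (t : ℝ) (p : Params N) :
    (packetExp ε a t p).HasTemperateGrowth := by
  have h1 : (fun X : Config N => freeExp ε t p.1 X.1).HasTemperateGrowth :=
    Function.HasTemperateGrowth.comp (hasTemperateGrowth_quadExp _ _ _)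
      (ContinuousLinearMap.fst ℝ E3 (Fin N → E3)).hasTemperateGrowth
  have h2 : ∀ j, (fun X : Config N => oscExp ε t (p.2 j) (X.2 j - a j)).HasTemperateGrowth := by
    intro j
    refine Function.HasTemperateGrowth.comp (f := fun X : Config N => X.2 j - a j)
      (hasTemperateGrowth_quadExp _ _ _) ?_
    exact (((ContinuousLinearMap.proj j).comp
      (ContinuousLinearMap.snd ℝ E3 (Fin N → E3))).hasTemperateGrowth).sub
        (Function.HasTemperateGrowth.const _)
  exact h1.add (Function.HasTemperateGrowth.sum fun j _ => h2 j)

/-- The Gaussian wave packet with parameters `p` at time `t`. -/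
def packet {ε : ℝ} (hε : 0 < ε) (a : Fin N → E3) (t : ℝ) (p : Params N) : 𝓢(Config N, ℂ) :=
  expSchwartz (packetExp ε a t p) (hasTemperateGrowth_packetExp ε a t p) (by
    obtain ⟨C, c, hc, h⟩ := exists_re_packetExp_le hε a p |t|
    exact ⟨C, c, hc, h t (abs_le.1 le_rfl)⟩)

theorem packet_apply {ε : ℝ} (hε : 0 < ε) (a : Fin N → E3) (t : ℝ) (p : Params N) (X : Config N) :
    packet hε a t p X = Complex.exp (packetExp ε a t p X) := rfl

/-- The class in `L²` of a wave packet. -/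
def packetL2 {ε : ℝ} (hε : 0 < ε) (a : Fin N → E3) (t : ℝ) (p : Params N) : L2 N :=
  (packet hε a t p).toLp 2 volume

theorem packetL2_coe {ε : ℝ} (hε : 0 < ε) (a : Fin N → E3) (t : ℝ) (p : Params N) :
    (packetL2 hε a t p : Config N → ℂ) =ᵐ[volume] fun X => Complex.exp (packetExp ε a t p X) :=
  (packet hε a t p).coeFn_toLp 2 volume

/-- The logarithmic time derivative of a wave packet. -/
def packetDot (ε : ℝ) (a : Fin N → E3) (t : ℝ) (p : Params N) (X : Config N) : ℂ :=
  Complex.I * ε ^ 2 / 2 * ((∑ k, (p.1 k / (1 + Complex.I * t) -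
        ((ε : ℂ) ^ 2 * (1 + Complex.I * t))⁻¹ * ((X.1 k : ℝ) : ℂ)) ^ 2) -
          3 * ((ε : ℂ) ^ 2 * (1 + Complex.I * t))⁻¹) +
    ∑ j, (Complex.I * ε / 2 * ((∑ k, (Complex.exp (-(Complex.I * t / ε)) * p.2 j k -
        ((ε : ℂ) ^ 2)⁻¹ * (((X.2 j - a j) k : ℝ) : ℂ)) ^ 2) - 3 * ((ε : ℂ) ^ 2)⁻¹) -
        Complex.I / ε ^ 3 * (((‖X.2 j - a j‖ ^ 2 : ℝ) : ℂ) / 2))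

theorem hasDerivAt_packetExp {ε : ℝ} (hε : 0 < ε) (a : Fin N → E3) (t : ℝ) (p : Params N)
    (X : Config N) :
    HasDerivAt (fun s => packetExp ε a s p X) (packetDot ε a t p X) t :=
  (hasDerivAt_freeExp hε t p.1 X.1).add
    (HasDerivAt.fun_sum fun j _ => hasDerivAt_oscExp hε t (p.2 j) (X.2 j - a j))

/-- In one variable alone the exponent is a `quadExp` whose constant absorbs all the others, so each
partial Laplacian is explicit and matches one summand of `packetDot`. -/
theorem freeHam_packet {ε : ℝ} (hε : 0 < ε) (a : Fin N → E3) (t : ℝ) (p : Params N)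
    (X : Config N) :
    freeHam ε a (packet hε a t p) X =
      Complex.I * ε ^ 2 * (packetDot ε a t p X * Complex.exp (packetExp ε a t p X)) := by
  have he : (ε : ℂ) ≠ 0 := by exact_mod_cast hε.ne'
  have h1 : (Δ (fun R : E3 => packet hε a t p (R, X.2))) X.1 =
      ((∑ k, (p.1 k / (1 + Complex.I * t) -
        ((ε : ℂ) ^ 2 * (1 + Complex.I * t))⁻¹ * ((X.1 k : ℝ) : ℂ)) ^ 2) -
          3 * ((ε : ℂ) ^ 2 * (1 + Complex.I * t))⁻¹) * Complex.exp (packetExp ε a t p X) := by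
    have h := laplacian_cexp_quadExp ((ε : ℂ) ^ 2 * (1 + Complex.I * t))⁻¹
      (fun k => p.1 k / (1 + Complex.I * t))
      (Complex.I * ε ^ 2 / 2 * (∑ k, p.1 k ^ 2) * (t / (1 + Complex.I * t)) -
      3 / 2 * Complex.log (1 + Complex.I * t) + ∑ j, oscExp ε t (p.2 j) (X.2 j - a j)) 0 X.1
    have e : ∀ R : E3, quadExp ((ε : ℂ) ^ 2 * (1 + Complex.I * t))⁻¹
      (fun k => p.1 k / (1 + Complex.I * t))
      (Complex.I * ε ^ 2 / 2 * (∑ k, p.1 k ^ 2) * (t / (1 + Complex.I * t)) -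
      3 / 2 * Complex.log (1 + Complex.I * t) + ∑ j, oscExp ε t (p.2 j) (X.2 j - a j)) R =
        packetExp ε a t p (R, X.2) := by
      intro R
      simp only [packetExp, freeExp, quadExp]
      ring
    simp only [sub_zero, e] at h
    exact h
  have h2 : ∀ j, (Δ (fun r : E3 => packet hε a t p (X.1, Function.update X.2 j r))) (X.2 j) =
      ((∑ k, (Complex.exp (-(Complex.I * t / ε)) * p.2 j k -
        ((ε : ℂ) ^ 2)⁻¹ * (((X.2 j - a j) k : ℝ) : ℂ)) ^ 2) - 3 * ((ε : ℂ) ^ 2)⁻¹) *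
        Complex.exp (packetExp ε a t p X) := by
    intro j
    have h := laplacian_cexp_quadExp ((ε : ℂ) ^ 2)⁻¹
      (fun k => Complex.exp (-(Complex.I * t / ε)) * p.2 j k)
      (ε ^ 2 / 4 * (∑ k, p.2 j k ^ 2) * (1 - Complex.exp (-(Complex.I * t / ε)) ^ 2) -
      3 / 2 * Complex.I * t / ε + (freeExp ε t p.1 X.1 +
        ∑ i ∈ Finset.univ \ {j}, oscExp ε t (p.2 i) (X.2 i - a i))) (a j) (X.2 j)
    have e : ∀ r : E3, quadExp ((ε : ℂ) ^ 2)⁻¹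
      (fun k => Complex.exp (-(Complex.I * t / ε)) * p.2 j k)
      (ε ^ 2 / 4 * (∑ k, p.2 j k ^ 2) * (1 - Complex.exp (-(Complex.I * t / ε)) ^ 2) -
      3 / 2 * Complex.I * t / ε + (freeExp ε t p.1 X.1 +
        ∑ i ∈ Finset.univ \ {j}, oscExp ε t (p.2 i) (X.2 i - a i))) (r - a j) =
        packetExp ε a t p (X.1, Function.update X.2 j r) := by
      intro r
      have hs : ∑ i, oscExp ε t (p.2 i) (Function.update X.2 j r i - a i) =
          oscExp ε t (p.2 j) (r - a j) +
            ∑ i ∈ Finset.univ \ {j}, oscExp ε t (p.2 i) (X.2 i - a i) := by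
        rw [← Finset.sum_sdiff (Finset.subset_univ {j}), Finset.sum_singleton, add_comm]
        congr 1
        · simp
        · refine Finset.sum_congr rfl fun i hi => ?_
          rw [Function.update_of_ne (by simpa using hi)]
      simp only [packetExp, hs]
      simp only [oscExp, quadExp]
      ring
    rw [e (X.2 j), Function.update_eq_self] at h
    simp only [e] at h
    exact h
  unfold freeHam
  rw [h1]
  simp only [h2]
  rw [packet_apply, packetDot]
  rw [add_mul, mul_add (Complex.I * (ε : ℂ) ^ 2), Finset.sum_mul, Finset.mul_sum]
  congr 1
  · push_cast
    linear_combination (ε ^ 4 / 2 * ((∑ k, (p.1 k / (1 + Complex.I * t) -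
        ((ε : ℂ) ^ 2 * (1 + Complex.I * t))⁻¹ * ((X.1 k : ℝ) : ℂ)) ^ 2) -
          3 * ((ε : ℂ) ^ 2 * (1 + Complex.I * t))⁻¹) * Complex.exp (packetExp ε a t p X)) *
            (-Complex.I_sq)
  · refine Finset.sum_congr rfl fun j _ => ?_
    push_cast
    set S := ((∑ k, (Complex.exp (-(Complex.I * t / ε)) * p.2 j k -
        ((ε : ℂ) ^ 2)⁻¹ * (((X.2 j - a j) k : ℝ) : ℂ)) ^ 2) - 3 * ((ε : ℂ) ^ 2)⁻¹)
    field_simp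
    ring_nf
    simp only [Complex.I_sq]
    ring

end

/-! ### The free Hamiltonian on Schwartz functions and the evolution of packets in `L²`. -/

section

open scoped LineDeriv

variable {N : ℕ}

theorem memLp_pow_mul_exp {E : Type*} [NormedAddCommGroup E] [NormedSpace ℝ E]
    [FiniteDimensional ℝ E] [MeasurableSpace E] [BorelSpace E] (μ : Measure E) [μ.IsAddHaarMeasure]
    (n : ℕ) (C : ℝ) {c : ℝ} (hc : 0 < c) :
    MemLp (fun x : E => (1 + ‖x‖) ^ n * Real.exp (C - c * ‖x‖ ^ 2)) 2 μ := by
  have hcont : Continuous (fun x : E => (1 + ‖x‖) ^ n * Real.exp (C - c * ‖x‖ ^ 2)) := by fun_prop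
  rw [memLp_two_iff_integrable_sq hcont.aestronglyMeasurable]
  -- The Gaussian pays for `m` further powers, which leave the integrable function `(1 + ‖x‖)^(-m)`.
  set m := Module.finrank ℝ E + 1
  obtain ⟨M, hM0, hM⟩ := exists_pow_mul_exp_neg_sq_le (n + m) hc
  have hint : Integrable (fun x : E => (1 + ‖x‖) ^ (-(m : ℝ))) μ :=
    integrable_one_add_norm (by simp [m])
  refine (hint.const_mul ((M * Real.exp C) ^ 2)).mono' (by fun_prop) (Eventually.of_forall fun x => ?_)
  have h1 := hM ‖x‖ (norm_nonneg x)
  have hx : 1 ≤ 1 + ‖x‖ := by linarith [norm_nonneg x]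
  have hm : (1 + ‖x‖) ^ (-(m : ℝ)) = ((1 + ‖x‖) ^ m)⁻¹ := by
    rw [Real.rpow_neg (by positivity), Real.rpow_natCast]
  have hp : 1 ≤ (1 + ‖x‖) ^ m := one_le_pow₀ hx
  rw [Real.norm_of_nonneg (by positivity), hm, ← div_eq_mul_inv, le_div_iff₀ (by positivity)]
  calc ((1 + ‖x‖) ^ n * Real.exp (C - c * ‖x‖ ^ 2)) ^ 2 * (1 + ‖x‖) ^ m
      ≤ ((1 + ‖x‖) ^ n * Real.exp (C - c * ‖x‖ ^ 2)) ^ 2 * ((1 + ‖x‖) ^ m) ^ 2 := by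
        gcongr; exact le_self_pow₀ hp (by norm_num)
    _ = ((1 + ‖x‖) ^ (n + m) * Real.exp (-(c * ‖x‖ ^ 2)) * Real.exp C) ^ 2 := by
        rw [sub_eq_add_neg, Real.exp_add, pow_add]; ring
    _ ≤ _ := by gcongr

/-- The free Hamiltonian on Schwartz functions. -/
def freeHamS (ε : ℝ) (a : Fin N → E3) (φ : 𝓢(Config N, ℂ)) : 𝓢(Config N, ℂ) :=
  (-(ε ^ 4 / 2)) • (∑ k : Fin 3, ∂_{((EuclideanSpace.single k 1, 0) : Config N)}
    (∂_{((EuclideanSpace.single k 1, 0) : Config N)} φ)) +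
  ∑ j, ε⁻¹ • ((-(ε ^ 4 / 2)) • (∑ k : Fin 3,
      ∂_{((0, Pi.single j (EuclideanSpace.single k 1)) : Config N)}
        (∂_{((0, Pi.single j (EuclideanSpace.single k 1)) : Config N)} φ)) +
      SchwartzMap.smulLeftCLM ℂ (fun X : Config N => ‖X.2 j - a j‖ ^ 2 / 2) φ)

theorem hasTemperateGrowth_potential (a : Fin N → E3) (j : Fin N) :
    (fun X : Config N => ‖X.2 j - a j‖ ^ 2 / 2).HasTemperateGrowth := by
  have h1 : (fun X : Config N => X.2 j - a j).HasTemperateGrowth :=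
    (((ContinuousLinearMap.proj j).comp
      (ContinuousLinearMap.snd ℝ E3 (Fin N → E3))).hasTemperateGrowth).sub
        (Function.HasTemperateGrowth.const _)
  have h2 := Function.HasTemperateGrowth.comp (Function.hasTemperateGrowth_norm_sq (H := E3)) h1
  exact h2.mul (Function.HasTemperateGrowth.const (2⁻¹ : ℝ))

theorem laplacian_comp_schwartz {F : Type*} [NormedAddCommGroup F] [NormedSpace ℝ F]
    (φ : 𝓢(F, ℂ)) (ι : E3 → F) (L : E3 →L[ℝ] F) (hsm : ContDiff ℝ 2 ι)
    (hι : ∀ y, HasFDerivAt ι L y) (x : E3) :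
    (Δ (fun y => φ (ι y))) x = ∑ k : Fin 3, ∂_{L (EuclideanSpace.single k 1)}
      (∂_{L (EuclideanSpace.single k 1)} φ) (ι x) := by
  have h : ∀ (ψ : 𝓢(F, ℂ)) (y v : E3), fderiv ℝ (fun y => ψ (ι y)) y v = ∂_{L v} ψ (ι y) := by
    intro ψ y v
    have h1 : HasFDerivAt (fun y => ψ (ι y)) _ y := (ψ.hasFDerivAt (ι y)).comp y (hι y)
    rw [h1.fderiv, SchwartzMap.lineDerivOp_apply_eq_fderiv]
    rfl
  have hc : ContDiff ℝ 2 (fun y => φ (ι y)) := (φ.smooth 2).comp hsm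
  rw [laplacian_eq_sum_fderiv x hc]
  refine Finset.sum_congr rfl fun k _ => ?_
  have : (fun y => fderiv ℝ (fun y => φ (ι y)) y (EuclideanSpace.single k 1)) =
      fun y => (∂_{L (EuclideanSpace.single k 1)} φ) (ι y) := by
    funext y; rw [h]
  rw [this, h]

theorem freeHamS_apply (ε : ℝ) (a : Fin N → E3) (φ : 𝓢(Config N, ℂ)) (X : Config N) :
    freeHamS ε a φ X = freeHam ε a φ X := by
  have h1 := laplacian_comp_schwartz φ (fun R : E3 => (R, X.2))
    ((ContinuousLinearMap.id ℝ E3).prod 0) (contDiff_id.prodMk contDiff_const)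
    (fun y => (hasFDerivAt_id y).prodMk (hasFDerivAt_const _ _)) X.1
  have h2 : ∀ j, (Δ (fun r : E3 => φ (X.1, Function.update X.2 j r))) (X.2 j) = _ := fun j =>
    laplacian_comp_schwartz φ (fun r : E3 => (X.1, Function.update X.2 j r))
    ((0 : E3 →L[ℝ] E3).prod (ContinuousLinearMap.pi (Pi.single j (ContinuousLinearMap.id ℝ E3))))
    (contDiff_const.prodMk (contDiff_update 2 X.2 j))
    (fun y => (hasFDerivAt_const _ _).prodMk (hasFDerivAt_update (X.2) y)) (X.2 j)
  unfold freeHam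
  rw [h1]
  simp only [h2, Function.update_eq_self]
  have h3 : ∀ (j : Fin N) (v : E3), ((0 : E3 →L[ℝ] E3).prod
      (ContinuousLinearMap.pi (Pi.single j (ContinuousLinearMap.id ℝ E3)))) v =
      ((0, Pi.single j v) : Config N) := by
    intro j v
    ext i : 2
    · rfl
    · by_cases hij : i = j
      · subst hij; simp
      · simp [hij]
  simp only [h3]
  simp only [freeHamS, add_apply, smul_apply, sum_apply,
    SchwartzMap.smulLeftCLM_apply_apply (hasTemperateGrowth_potential a _)]
  simp [mul_add]

/-- The coefficients of this quadratic polynomial are bounded uniformly in time because `|1 + it| ≥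
1` and `|exp (-it/ε)| = 1`. -/
theorem norm_packetDot_le {ε : ℝ} (hε : 0 < ε) (a : Fin N → E3) (p : Params N) :
    ∃ K : ℝ, ∀ (t : ℝ) (X : Config N), ‖packetDot ε a t p X‖ ≤ K * (1 + ‖X‖) ^ 2 := by
  have hone : ∀ t : ℝ, 1 ≤ ‖(1 + Complex.I * t : ℂ)‖ := fun t => by
    have := Complex.abs_re_le_norm (1 + Complex.I * t)
    simpa using this
  have hinv : ∀ t : ℝ, ‖((ε : ℂ) ^ 2 * (1 + Complex.I * t))⁻¹‖ ≤ (ε ^ 2)⁻¹ := fun t => by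
    rw [norm_inv, norm_mul]
    gcongr
    simpa [abs_of_pos hε] using le_mul_of_one_le_right (sq_nonneg ε) (hone t)
  have hexp : ∀ t : ℝ, ‖Complex.exp (-(Complex.I * t / ε))‖ = 1 := fun t => by
    have : -(Complex.I * t / ε) = ((-(t / ε) : ℝ) : ℂ) * Complex.I := by push_cast; ring
    rw [this, Complex.norm_exp_ofReal_mul_I]
  have hcoord : ∀ (x : E3) (k : Fin 3), ‖((x k : ℝ) : ℂ)‖ ≤ ‖x‖ := fun x k => by
    rw [Complex.norm_real]; exact PiLp.norm_apply_le x k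
  have hsub : ∀ (X : Config N) (j : Fin N), ‖X.2 j - a j‖ ≤ (1 + ‖a j‖) * (1 + ‖X‖) := fun X j => by
    have h1 := norm_sub_le (X.2 j) (a j)
    have h2 : ‖X.2 j‖ ≤ ‖X‖ := (norm_le_pi_norm X.2 j).trans (norm_snd_le X)
    nlinarith [norm_nonneg X, norm_nonneg (a j)]
  refine ⟨ε ^ 2 / 2 * ((∑ k, (‖p.1 k‖ + (ε ^ 2)⁻¹) ^ 2) + 3 * (ε ^ 2)⁻¹) +
    ∑ j, (ε / 2 * ((∑ k, (‖p.2 j k‖ + (ε ^ 2)⁻¹ * (1 + ‖a j‖)) ^ 2) + 3 * (ε ^ 2)⁻¹) +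
      1 / ε ^ 3 * ((1 + ‖a j‖) ^ 2 / 2)), fun t X => ?_⟩
  have hX : 1 ≤ 1 + ‖X‖ := by linarith [norm_nonneg X]
  have hX2 : 1 ≤ (1 + ‖X‖) ^ 2 := one_le_pow₀ hX
  rw [packetDot, add_mul, Finset.sum_mul]
  refine (norm_add_le _ _).trans (add_le_add ?_ ((norm_sum_le _ _).trans
    (Finset.sum_le_sum fun j _ => ?_)))
  · rw [norm_mul, mul_assoc]
    have e1 : ‖Complex.I * (ε : ℂ) ^ 2 / 2‖ = ε ^ 2 / 2 := by simp
    rw [e1]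
    gcongr
    refine (norm_sub_le _ _).trans ?_
    rw [add_mul, Finset.sum_mul]
    refine add_le_add ((norm_sum_le _ _).trans (Finset.sum_le_sum fun k _ => ?_)) ?_
    · rw [norm_pow, ← mul_pow]
      gcongr
      refine (norm_sub_le _ _).trans ?_
      rw [norm_div, norm_mul, add_mul]
      refine add_le_add ?_ ?_
      · refine (div_le_self (norm_nonneg _) (hone t)).trans ?_
        exact le_mul_of_one_le_right (norm_nonneg _) hX
      · gcongr
        · exact hinv t
        · exact (hcoord _ _).trans ((norm_fst_le X).trans (by linarith))
    · rw [norm_mul]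
      have := hinv t
      simp only [RCLike.norm_ofNat]
      calc 3 * ‖((ε : ℂ) ^ 2 * (1 + Complex.I * t))⁻¹‖ ≤ 3 * (ε ^ 2)⁻¹ := by gcongr
        _ ≤ _ := le_mul_of_one_le_right (by positivity) hX2
  · rw [add_mul]
    refine (norm_sub_le _ _).trans (add_le_add ?_ ?_)
    · rw [norm_mul, mul_assoc]
      have e1 : ‖Complex.I * (ε : ℂ) / 2‖ = ε / 2 := by simp [abs_of_pos hε]
      rw [e1]
      gcongr
      refine (norm_sub_le _ _).trans ?_
      rw [add_mul, Finset.sum_mul]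
      refine add_le_add ((norm_sum_le _ _).trans (Finset.sum_le_sum fun k _ => ?_)) ?_
      · rw [norm_pow, ← mul_pow]
        gcongr
        refine (norm_sub_le _ _).trans ?_
        rw [norm_mul, norm_mul, add_mul, hexp, one_mul]
        refine add_le_add ?_ ?_
        · exact le_mul_of_one_le_right (norm_nonneg _) hX
        · have e2 : ‖((ε : ℂ) ^ 2)⁻¹‖ = (ε ^ 2)⁻¹ := by simp
          rw [e2, mul_assoc]
          gcongr
          exact (hcoord _ _).trans (hsub X j)
      · have e2 : ‖3 * ((ε : ℂ) ^ 2)⁻¹‖ = 3 * (ε ^ 2)⁻¹ := by simp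
        rw [e2]
        exact le_mul_of_one_le_right (by positivity) hX2
    · rw [norm_mul, mul_assoc]
      have e1 : ‖Complex.I / (ε : ℂ) ^ 3‖ = 1 / ε ^ 3 := by simp [abs_of_pos hε]
      have e2 : ‖((‖X.2 j - a j‖ ^ 2 : ℝ) : ℂ) / 2‖ = ‖X.2 j - a j‖ ^ 2 / 2 := by simp
      rw [e1, e2]
      gcongr
      have := hsub X j
      calc ‖X.2 j - a j‖ ^ 2 / 2 ≤ ((1 + ‖a j‖) * (1 + ‖X‖)) ^ 2 / 2 := by gcongr
        _ = _ := by ring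

theorem continuous_packetDot (ε : ℝ) (a : Fin N → E3) (t : ℝ) (p : Params N) :
    Continuous (packetDot ε a t p) := by
  unfold packetDot
  fun_prop

theorem continuous_packetExp (ε : ℝ) (a : Fin N → E3) (t : ℝ) (p : Params N) :
    Continuous (packetExp ε a t p) :=
  (hasTemperateGrowth_packetExp ε a t p).1.continuous

/-- Wave packets solve the free Schrödinger equation in `L²`. -/
theorem hasDerivAt_packetL2 {ε : ℝ} (hε : 0 < ε) (a : Fin N → E3) (t : ℝ) (p : Params N) :
    HasDerivAt (fun s => packetL2 hε a s p)
      ((-Complex.I * ((ε : ℂ) ^ 2)⁻¹) • (freeHamS ε a (packet hε a t p)).toLp 2 volume) t := by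
  have he : (ε : ℂ) ≠ 0 := by exact_mod_cast hε.ne'
  obtain ⟨K, hK⟩ := norm_packetDot_le hε a p
  obtain ⟨C, c, hc, hC⟩ := exists_re_packetExp_le hε a p (|t| + 1)
  refine hasDerivAt_Lp_two_of_dominated
    (F := fun s X => Complex.exp (packetExp ε a s p X))
    (F' := fun s X => packetDot ε a s p X * Complex.exp (packetExp ε a s p X))
    (B := fun X => K * ((1 + ‖X‖) ^ 2 * Real.exp (C - c * ‖X‖ ^ 2)))
    (fun s => packetL2_coe hε a s p) ?_ ?_ ?_ ((memLp_pow_mul_exp _ 2 C hc).const_mul K) ?_ ?_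
  · have h1 := Lp.coeFn_smul (-Complex.I * ((ε : ℂ) ^ 2)⁻¹)
      ((freeHamS ε a (packet hε a t p)).toLp 2 volume)
    have h2 := (freeHamS ε a (packet hε a t p)).coeFn_toLp 2 (volume : Measure (Config N))
    filter_upwards [h1, h2] with X h1 h2
    rw [h1, Pi.smul_apply, h2, freeHamS_apply, freeHam_packet, smul_eq_mul]
    field_simp
    ring_nf
    simp
  · intro s
    exact (Complex.continuous_exp.comp (continuous_packetExp ε a s p)).measurable
  · exact ((continuous_packetDot ε a t p).mul
      (Complex.continuous_exp.comp (continuous_packetExp ε a t p))).measurable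
  · intro s _ X
    have := (hasDerivAt_packetExp hε a s p X).cexp
    rwa [mul_comm] at this
  · intro s hs X
    have hs' : s ∈ Icc (-(|t| + 1)) (|t| + 1) := by
      rw [Metric.mem_ball, Real.dist_eq] at hs
      refine abs_le.1 ?_
      have h1 := abs_add_le (s - t) t
      rw [sub_add_cancel] at h1
      linarith
    rw [norm_mul, Complex.norm_exp, ← mul_assoc]
    have h1 := hK s X
    have h2 := hC s hs' X
    have h3 : 0 ≤ K * (1 + ‖X‖) ^ 2 := (norm_nonneg _).trans h1
    gcongr

end

/-! ### Fourier uniqueness, totality of packets and construction of the free group. -/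

section

open scoped LineDeriv

section Fourier

variable {E : Type*} [NormedAddCommGroup E] [NormedSpace ℝ E] [CompleteSpace E]
  [SecondCountableTopology E] [MeasurableSpace E] [BorelSpace E] {μ : Measure E}

/-- The positive and negative parts of `g` are densities of finite measures with the same
characteristic function, so the two measures, and then the two densities, agree. -/
theorem ae_eq_zero_of_fourier_real {g : E → ℝ} (hg : Integrable g μ)
    (h : ∀ L : StrongDual ℝ E, ∫ x, Complex.exp (L x * Complex.I) * (g x : ℂ) ∂μ = 0) :
    g =ᵐ[μ] 0 := by
  have key : ∀ (f : E → ℝ), Integrable f μ → (∀ x, 0 ≤ f x) → ∀ L : StrongDual ℝ E,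
      charFunDual (μ.withDensity fun x => ENNReal.ofReal (f x)) L =
        ∫ x, Complex.exp (L x * Complex.I) * (f x : ℂ) ∂μ := by
    intro f hf hf0 L
    rw [charFunDual_apply, integral_withDensity_eq_integral_toReal_smul₀
      hf.aestronglyMeasurable.aemeasurable.ennreal_ofReal (by simp)]
    refine integral_congr_ae (Eventually.of_forall fun x => ?_)
    simp only [ENNReal.toReal_ofReal (hf0 x), Complex.real_smul, mul_comm]
  have hp := hg.pos_part
  have hn := hg.neg_part
  have hfin : ∀ (f : E → ℝ), Integrable f μ →
      IsFiniteMeasure (μ.withDensity fun x => ENNReal.ofReal (f x)) := fun f hf =>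
    isFiniteMeasure_withDensity_ofReal hf.2
  have := hfin _ hp
  have := hfin _ hn
  have hint : ∀ (f : E → ℝ), Integrable f μ → ∀ L : StrongDual ℝ E,
      Integrable (fun x => Complex.exp (L x * Complex.I) * (f x : ℂ)) μ := fun f hf L => by
    refine hf.ofReal.bdd_mul (c := 1) ?_ (Eventually.of_forall fun x => ?_)
    · exact Continuous.aestronglyMeasurable (by fun_prop)
    · rw [Complex.norm_exp_ofReal_mul_I]
  have heq : (μ.withDensity fun x => ENNReal.ofReal (max (g x) 0)) =
      μ.withDensity fun x => ENNReal.ofReal (max (-g x) 0) := by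
    refine Measure.ext_of_charFunDual (funext fun L => ?_)
    rw [key _ hp (fun x => le_max_right _ _), key _ hn (fun x => le_max_right _ _), ← sub_eq_zero,
      ← integral_sub (hint _ hp L) (hint _ hn L), ← h L]
    refine integral_congr_ae (Eventually.of_forall fun x => ?_)
    simp only
    rw [← mul_sub, ← Complex.ofReal_sub]
    congr 2
    exact max_zero_sub_max_neg_zero_eq_self (g x)
  rw [withDensity_eq_iff hp.aestronglyMeasurable.aemeasurable.ennreal_ofReal
    hn.aestronglyMeasurable.aemeasurable.ennreal_ofReal hp.lintegral_lt_top.ne] at heq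
  filter_upwards [heq] with x hx
  have h1 := (ENNReal.ofReal_eq_ofReal_iff (le_max_right _ _) (le_max_right _ _)).1 hx
  have h2 := max_zero_sub_max_neg_zero_eq_self (g x)
  rw [Pi.zero_apply, ← h2, h1, sub_self]

/-- An integrable function whose Fourier transform vanishes is zero almost everywhere. -/
theorem ae_eq_zero_of_fourier {f : E → ℂ} (hf : Integrable f μ)
    (h : ∀ L : StrongDual ℝ E, ∫ x, Complex.exp (L x * Complex.I) * f x ∂μ = 0) : f =ᵐ[μ] 0 := by
  have hint : ∀ (f : E → ℂ), Integrable f μ → ∀ L : StrongDual ℝ E,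
      Integrable (fun x => Complex.exp (L x * Complex.I) * f x) μ := fun f hf L => by
    refine hf.bdd_mul (c := 1) ?_ (Eventually.of_forall fun x => ?_)
    · exact Continuous.aestronglyMeasurable (by fun_prop)
    · rw [Complex.norm_exp_ofReal_mul_I]
  have hconj : ∀ L : StrongDual ℝ E,
      ∫ x, Complex.exp (L x * Complex.I) * (starRingEnd ℂ) (f x) ∂μ = 0 := by
    intro L
    have h1 := h (-L)
    have h2 := congrArg (starRingEnd ℂ) h1
    rw [← integral_conj, map_zero] at h2
    rw [← h2]
    refine integral_congr_ae (Eventually.of_forall fun x => ?_)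
    simp [← Complex.exp_conj]
  have hcint : Integrable (fun x => (starRingEnd ℂ) (f x)) μ :=
    (Complex.conjCLE : ℂ →L[ℝ] ℂ).integrable_comp hf
  have hre : (fun x => (f x).re) =ᵐ[μ] 0 := by
    refine ae_eq_zero_of_fourier_real hf.re fun L => ?_
    have : ∀ x, Complex.exp (L x * Complex.I) * ((f x).re : ℂ) =
        (1 / 2 : ℂ) * (Complex.exp (L x * Complex.I) * f x +
          Complex.exp (L x * Complex.I) * (starRingEnd ℂ) (f x)) := fun x => by
      rw [Complex.re_eq_add_conj]; ring
    simp_rw [this]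
    rw [integral_const_mul, integral_add (hint _ hf L) (hint _ hcint L), h L, hconj L]
    simp
  have him : (fun x => (f x).im) =ᵐ[μ] 0 := by
    refine ae_eq_zero_of_fourier_real hf.im fun L => ?_
    have : ∀ x, Complex.exp (L x * Complex.I) * ((f x).im : ℂ) =
        (1 / (2 * Complex.I) : ℂ) * (Complex.exp (L x * Complex.I) * f x -
          Complex.exp (L x * Complex.I) * (starRingEnd ℂ) (f x)) := fun x => by
      rw [Complex.im_eq_sub_conj]; ring
    simp_rw [this]
    rw [integral_const_mul, integral_sub (hint _ hf L) (hint _ hcint L), h L, hconj L]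
    simp
  filter_upwards [hre, him] with x h1 h2
  exact Complex.ext h1 h2

end Fourier

section UnitaryGroup

variable {H : Type*} [NormedAddCommGroup H] [InnerProductSpace ℂ H]

theorem denseRange_linearCombination {ι : Type*} [CompleteSpace H] (v : ι → H)
    (h : ∀ x : H, (∀ i, inner ℂ (v i) x = 0) → x = 0) :
    DenseRange (Finsupp.linearCombination ℂ v) := by
  have h1 : (Submodule.span ℂ (Set.range v)).topologicalClosure = ⊤ := by
    rw [Submodule.topologicalClosure_eq_top_iff, Submodule.eq_bot_iff]
    intro x hx
    exact h x fun i => (Submodule.mem_orthogonal _ x).1 hx _ (Submodule.subset_span ⟨i, rfl⟩)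
  have h2 : Dense ((Submodule.span ℂ (Set.range v) : Submodule ℂ H) : Set H) :=
    Submodule.dense_iff_topologicalClosure_eq_top.2 h1
  rw [← Finsupp.range_linearCombination] at h2
  exact h2

/-- The squared norm is a quadratic form in the coefficients given by the Gram matrix. -/
theorem norm_linearCombination_eq {ι : Type*} {v w : ι → H}
    (h : ∀ i j, inner ℂ (v i) (v j) = inner ℂ (w i) (w j)) (c : ι →₀ ℂ) :
    ‖Finsupp.linearCombination ℂ v c‖ = ‖Finsupp.linearCombination ℂ w c‖ := by
  have : ∀ u : ι → H, ‖Finsupp.linearCombination ℂ u c‖ ^ 2 = RCLike.re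
      (∑ i ∈ c.support, ∑ j ∈ c.support, (starRingEnd ℂ) (c i) * (c j * inner ℂ (u i) (u j))) := by
    intro u
    rw [← inner_self_eq_norm_sq (𝕜 := ℂ), Finsupp.linearCombination_apply, Finsupp.sum, sum_inner]
    congr 1
    refine Finset.sum_congr rfl fun i _ => ?_
    rw [inner_sum]
    refine Finset.sum_congr rfl fun j _ => ?_
    rw [inner_smul_left, inner_smul_right]
  rw [← sq_eq_sq₀ (norm_nonneg _) (norm_nonneg _), this, this]
  simp_rw [h]

/-- Translation of the time label acts on formal finite combinations of the vectors. Invariance of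
the Gram matrix makes it isometric, so it passes to the dense span and extends to a unitary. The
group law and strong continuity survive the limit because all the maps are isometries. -/
theorem exists_unitary_group [CompleteSpace H] {P : Type*} (v : ℝ × P → H)
    (hdense : ∀ x : H, (∀ i, inner ℂ (v i) x = 0) → x = 0)
    (hgram : ∀ (t : ℝ) (i j : ℝ × P),
      inner ℂ (v (i.1 + t, i.2)) (v (j.1 + t, j.2)) = inner ℂ (v i) (v j))
    (hcont : ∀ p, Continuous fun t => v (t, p)) :
    ∃ U : ℝ → (H ≃ₗᵢ[ℂ] H), (∀ t i, U t (v i) = v (i.1 + t, i.2)) ∧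
      (∀ s t x, U (s + t) x = U s (U t x)) ∧ ∀ x, Continuous fun t => U t x := by
  have hd := denseRange_linearCombination v hdense
  let shift : ℝ → ((ℝ × P →₀ ℂ) ≃ₗ[ℂ] (ℝ × P →₀ ℂ)) := fun t =>
    Finsupp.domLCongr ((Equiv.addRight t).prodCongr (Equiv.refl P))
  have hshift : ∀ t c, Finsupp.linearCombination ℂ v (shift t c) =
      Finsupp.linearCombination ℂ (fun i : ℝ × P => v (i.1 + t, i.2)) c := by
    intro t c
    simp only [shift, Finsupp.domLCongr_apply, Finsupp.domCongr_apply,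
      Finsupp.linearCombination_equivMapDomain]
    rfl
  have hn : ∀ t c, ‖Finsupp.linearCombination ℂ v (shift t c)‖ =
      ‖Finsupp.linearCombination ℂ v c‖ := by
    intro t c
    rw [hshift]
    exact norm_linearCombination_eq (hgram t) c
  let U : ℝ → (H ≃ₗᵢ[ℂ] H) := fun t =>
    LinearEquiv.extendOfIsometry (shift t) (Finsupp.linearCombination ℂ v)
      (Finsupp.linearCombination ℂ v) hd hd (hn t)
  have hU : ∀ t c, U t (Finsupp.linearCombination ℂ v c) =
      Finsupp.linearCombination ℂ (fun i : ℝ × P => v (i.1 + t, i.2)) c := by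
    intro t c
    rw [← hshift]
    exact LinearEquiv.extendOfIsometry_eq _ _ _ hd hd (hn t) c
  have hUv : ∀ t i, U t (v i) = v (i.1 + t, i.2) := by
    intro t i
    have := hU t (Finsupp.single i 1)
    simpa using this
  refine ⟨U, hUv, ?_, ?_⟩
  · intro s t x
    refine hd.induction (P := fun x => U (s + t) x = U s (U t x)) ?_ ?_ x
    · rintro _ ⟨c, rfl⟩
      induction c using Finsupp.induction_linear with
      | zero => simp
      | add f g hf hg => simp only [map_add, hf, hg]
      | single i c =>
        simp only [Finsupp.linearCombination_single, map_smul, hUv]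
        rw [add_assoc, add_comm t s]
    · exact isClosed_eq (U (s + t)).continuous ((U s).continuous.comp (U t).continuous)
  · intro x
    refine continuous_of_uniform_approx_of_continuous fun u hu => ?_
    obtain ⟨δ, hδ, hu⟩ := Metric.mem_uniformity_dist.1 hu
    obtain ⟨y, hy, ⟨c, rfl⟩⟩ := Metric.dense_iff.1 hd x δ hδ
    refine ⟨fun t => U t (Finsupp.linearCombination ℂ v c), ?_, fun t => hu ?_⟩
    · simp_rw [hU, Finsupp.linearCombination_apply, Finsupp.sum]
      refine continuous_finsetSum _ fun i _ => Continuous.const_smul ?_ _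
      exact (hcont i.2).comp (continuous_const.add continuous_id)
    · rw [(U t).dist_map, dist_comm]
      exact hy

end UnitaryGroup

variable {N : ℕ}

theorem inner_lineDeriv_symm (v : Config N) (φ ψ : 𝓢(Config N, ℂ)) :
    inner ℂ ((∂_{v} (∂_{v} φ)).toLp 2 (volume : Measure (Config N))) (ψ.toLp 2 volume) =
      inner ℂ (φ.toLp 2 volume) ((∂_{v} (∂_{v} ψ)).toLp 2 (volume : Measure (Config N))) := by
  set L : ℂ →L[ℝ] ℂ →L[ℝ] ℂ :=
    (ContinuousLinearMap.mul ℝ ℂ).comp (Complex.conjCLE : ℂ →L[ℝ] ℂ) with hL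
  have h : ∀ φ ψ : 𝓢(Config N, ℂ), inner ℂ (φ.toLp 2 (volume : Measure (Config N)))
      (ψ.toLp 2 volume) = ∫ x, L (φ x) (ψ x) := by
    intro φ ψ
    rw [SchwartzMap.inner_toL2_toL2_eq φ ψ volume]
    refine integral_congr_ae (Eventually.of_forall fun x => ?_)
    simp [hL, mul_comm]
  rw [h, h, SchwartzMap.integral_bilinear_lineDerivOp_right_eq_neg_left,
    SchwartzMap.integral_bilinear_lineDerivOp_right_eq_neg_left, neg_neg]

theorem inner_smulLeft_symm {g : Config N → ℝ} (hg : g.HasTemperateGrowth)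
    (φ ψ : 𝓢(Config N, ℂ)) :
    inner ℂ ((SchwartzMap.smulLeftCLM ℂ g φ).toLp 2 (volume : Measure (Config N)))
      (ψ.toLp 2 volume) = inner ℂ (φ.toLp 2 volume)
      ((SchwartzMap.smulLeftCLM ℂ g ψ).toLp 2 (volume : Measure (Config N))) := by
  rw [SchwartzMap.inner_toL2_toL2_eq _ _ volume, SchwartzMap.inner_toL2_toL2_eq _ _ volume]
  refine integral_congr_ae (Eventually.of_forall fun x => ?_)
  simp only [SchwartzMap.smulLeftCLM_apply_apply hg, Complex.real_smul]
  simp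
  ring

/-- The free Hamiltonian is symmetric on Schwartz functions. -/
theorem freeHamS_symm (ε : ℝ) (a : Fin N → E3) (φ ψ : 𝓢(Config N, ℂ)) :
    inner ℂ ((freeHamS ε a φ).toLp 2 (volume : Measure (Config N))) (ψ.toLp 2 volume) =
      inner ℂ (φ.toLp 2 volume) ((freeHamS ε a ψ).toLp 2 (volume : Measure (Config N))) := by
  have e : ∀ φ : 𝓢(Config N, ℂ), φ.toLp 2 (volume : Measure (Config N)) =
      SchwartzMap.toLpCLM ℂ ℂ 2 volume φ := fun φ => rfl
  have h1 := fun v : Config N => inner_lineDeriv_symm v φ ψ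
  have h2 := fun j => inner_smulLeft_symm (hasTemperateGrowth_potential a j) φ ψ
  have hs : ∀ (c : ℝ) (φ : 𝓢(Config N, ℂ)), c • φ = (c : ℂ) • φ := fun c φ => by
    ext x; simp
  simp only [e] at h1 h2 ⊢
  simp only [freeHamS, hs, map_add, map_sum, map_smul, inner_add_left, inner_add_right, sum_inner,
    inner_sum, inner_smul_left, inner_smul_right, h1, h2, Complex.conj_ofReal, Finset.mul_sum]

theorem packetExp_zero (ε : ℝ) (a : Fin N → E3) (p : Params N) (X : Config N) :
    packetExp ε a 0 p X = -((ε : ℂ) ^ 2)⁻¹ / 2 * ((‖X.1‖ ^ 2 : ℝ) : ℂ) + cdot p.1 X.1 +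
      ∑ j, (-((ε : ℂ) ^ 2)⁻¹ / 2 * ((‖X.2 j - a j‖ ^ 2 : ℝ) : ℂ) + cdot (p.2 j) (X.2 j - a j)) := by
  simp [packetExp, freeExp, oscExp, quadExp, neg_div]

/-- Packets at time `0` with imaginary parameters are one fixed Gaussian times all plane waves.
Orthogonality to them says that the Fourier transform of Gaussian times `x` vanishes, and the
Gaussian has no zeros. -/
theorem packetL2_total {ε : ℝ} (hε : 0 < ε) (a : Fin N → E3) (x : L2 N)
    (h : ∀ p, inner ℂ (packetL2 hε a 0 p) x = 0) : x = 0 := by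
  set G : Config N → ℂ := fun X =>
    Complex.exp (packetExp ε a 0 (0 : Params N) X) with hG
  have hGr : ∀ X, (starRingEnd ℂ) (G X) = G X := by
    intro X
    rw [hG]
    simp only
    rw [← Complex.exp_conj]
    congr 1
    simp [packetExp_zero, cdot, map_ofNat]
  have hGcoe := packetL2_coe hε a 0 (0 : Params N)
  have hint : Integrable (fun X => G X * (x : Config N → ℂ) X) := by
    have h1 := L2.integrable_inner (𝕜 := ℂ) (packetL2 hε a 0 (0 : Params N)) x
    refine h1.congr ?_
    filter_upwards [hGcoe] with X hX
    rw [hX, RCLike.inner_apply', hGr]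
  have hzero : (fun X => G X * (x : Config N → ℂ) X) =ᵐ[volume] 0 := by
    refine ae_eq_zero_of_fourier hint fun L => ?_
    -- With these momenta the conjugate packet is `exp (i L X) G X` up to a constant phase; the
    -- phase `c` arises because oscillator positions are measured from `a j`.
    set p : Params N := (fun k => -(Complex.I * (L (EuclideanSpace.single k 1, 0) : ℝ)),
      fun j k => -(Complex.I * (L (0, Pi.single j (EuclideanSpace.single k 1)) : ℝ))) with hp
    set c : ℝ := ∑ j, ∑ k, L (0, Pi.single j (EuclideanSpace.single k 1)) * a j k
    have hL : ∀ X : Config N, L X = ∑ k, L (EuclideanSpace.single k 1, 0) * X.1 k +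
        ∑ j, ∑ k, L (0, Pi.single j (EuclideanSpace.single k 1)) * X.2 j k := by
      intro X
      have hX1 : ∀ r : E3, r = ∑ k, r k • (EuclideanSpace.single k 1 : E3) := fun r => by
        ext i; simp [Pi.single_apply]
      have hX : X = ∑ k, X.1 k • ((EuclideanSpace.single k 1, 0) : Config N) +
          ∑ j, ∑ k, X.2 j k • ((0, Pi.single j (EuclideanSpace.single k 1)) : Config N) := by
        refine Prod.ext ?_ ?_
        · simp only [Prod.fst_add, Prod.fst_sum, Prod.smul_fst]
          simpa using hX1 X.1
        · funext i
          simp only [Prod.snd_add, Prod.snd_sum, Prod.smul_snd, Pi.add_apply, Finset.sum_apply,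
            Pi.smul_apply]
          rw [Finset.sum_eq_single i]
          · simpa using hX1 (X.2 i)
          · intro j _ hj; simp [Ne.symm hj]
          · simp
      conv_lhs => rw [hX]
      simp only [map_add, map_sum, map_smul, smul_eq_mul, mul_comm]
    have h1 := h p
    rw [L2.inner_def] at h1
    have h2 : ∀ X, (starRingEnd ℂ) (Complex.exp (packetExp ε a 0 p X)) =
        Complex.exp (-(c * Complex.I)) * (Complex.exp (L X * Complex.I) * G X) := by
      intro X
      rw [hG]
      simp only
      rw [← Complex.exp_add, ← Complex.exp_add, ← Complex.exp_conj, hL]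
      congr 1
      have e1 : ∀ (l : Fin 3 → ℝ) (x : E3), (starRingEnd ℂ)
          (cdot (fun k => -(Complex.I * (l k : ℂ))) x) =
          ((∑ k, l k * x k : ℝ) : ℂ) * Complex.I := fun l x => by
        simp [cdot, Finset.sum_mul]
        exact Finset.sum_congr rfl fun k _ => by ring
      have e2 : ∀ x : E3, cdot 0 x = 0 := fun x => by simp [cdot]
      have e3 : ∑ j, ∑ k, L (0, Pi.single j (EuclideanSpace.single k 1)) * (X.2 j - a j) k =
          ∑ j, ∑ k, L (0, Pi.single j (EuclideanSpace.single k 1)) * X.2 j k - c := by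
        simp only [c, ← Finset.sum_sub_distrib, ← mul_sub]
        rfl
      simp only [packetExp_zero, map_add, map_sum, map_mul, map_div₀, map_neg, map_inv₀, map_pow,
        Complex.conj_ofReal, map_ofNat, hp, e1, Finset.sum_add_distrib, ← Finset.sum_mul,
        ← Complex.ofReal_sum, e3]
      simp only [Prod.fst_zero, Prod.snd_zero, Pi.zero_apply, e2, Finset.sum_const_zero]
      push_cast
      ring
    have h3 : (0 : ℂ) = Complex.exp (-(c * Complex.I)) *
        ∫ X, Complex.exp (L X * Complex.I) * (G X * (x : Config N → ℂ) X) := by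
      rw [← h1, ← integral_const_mul]
      refine integral_congr_ae ?_
      filter_upwards [packetL2_coe hε a 0 p] with X hX
      rw [hX, RCLike.inner_apply', h2]
      ring
    exact (mul_eq_zero.1 h3.symm).resolve_left (Complex.exp_ne_zero _)
  rw [Lp.eq_zero_iff_ae_eq_zero]
  filter_upwards [hzero] with X hX
  exact (mul_eq_zero.1 hX).resolve_left (Complex.exp_ne_zero _)

/-- Both packets solve the Schrödinger equation, so symmetry of the Hamiltonian makes the time
derivative of the inner product vanish. -/
theorem inner_packetL2_add {ε : ℝ} (hε : 0 < ε) (a : Fin N → E3) (t s s' : ℝ) (p p' : Params N) :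
    inner ℂ (packetL2 hε a (s + t) p) (packetL2 hε a (s' + t) p') =
      inner ℂ (packetL2 hε a s p) (packetL2 hε a s' p') := by
  have hd : ∀ t : ℝ, HasDerivAt (fun t => inner ℂ (packetL2 hε a (s + t) p)
      (packetL2 hε a (s' + t) p')) 0 t := by
    intro t
    have h1 := (hasDerivAt_packetL2 hε a (s + t) p).comp_const_add s t
    have h2 := (hasDerivAt_packetL2 hε a (s' + t) p').comp_const_add s' t
    refine (h1.inner ℂ h2).congr_deriv ?_
    have h3 := freeHamS_symm ε a (packet hε a (s + t) p) (packet hε a (s' + t) p')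
    simp only [packetL2, inner_smul_left, inner_smul_right, h3]
    simp
  have := is_const_of_deriv_eq_zero (𝕜 := ℝ) (fun t => (hd t).differentiableAt)
    (fun t => (hd t).deriv) t 0
  simpa using this

theorem exists_freeGroup {ε : ℝ} (hε : 0 < ε) (a : Fin N → E3) :
    ∃ W : ℝ → (L2 N ≃ₗᵢ[ℂ] L2 N),
      (∀ t s p, W t (packetL2 hε a s p) = packetL2 hε a (s + t) p) ∧
      (∀ s t x, W (s + t) x = W s (W t x)) ∧ ∀ x, Continuous fun t => W t x := by
  obtain ⟨W, h1, h2, h3⟩ := exists_unitary_group (fun i : ℝ × Params N => packetL2 hε a i.1 i.2)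
    (fun x hx => packetL2_total hε a x fun p => hx (0, p))
    (fun t i j => inner_packetL2_add hε a t i.1 j.1 i.2 j.2)
    (fun p => continuous_iff_continuousAt.2 fun t => (hasDerivAt_packetL2 hε a t p).continuousAt)
  exact ⟨W, fun t s p => h1 t (s, p), h2, h3⟩

end

/-! ### Calculus along curves of isometries; multiplication by the interaction. -/

section

section Abstract

variable {H : Type*} [NormedAddCommGroup H] [InnerProductSpace ℂ H]

theorem continuous_isometry_apply {U : ℝ → (H ≃ₗᵢ[ℂ] H)} (hU : ∀ x, Continuous fun t => U t x)
    {f : ℝ → H} (hf : Continuous f) : Continuous fun t => U t (f t) := by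
  rw [continuous_iff_continuousAt]
  intro t
  have h1 : Tendsto (fun s => ‖f s - f t‖ + ‖U s (f t) - U t (f t)‖) (𝓝 t) (𝓝 0) := by
    have h2 := (hf.tendsto t).sub_const (f t)
    have h3 := ((hU (f t)).tendsto t).sub_const (U t (f t))
    simpa using h2.norm.add h3.norm
  rw [ContinuousAt, tendsto_iff_norm_sub_tendsto_zero]
  refine squeeze_zero (fun _ => norm_nonneg _) (fun s => ?_) h1
  have h4 : U s (f s) - U t (f t) = U s (f s - f t) + (U s (f t) - U t (f t)) := by
    rw [map_sub]; abel
  rw [h4]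
  refine (norm_add_le _ _).trans (le_of_eq ?_)
  rw [(U s).norm_map]

/-- A product rule for a group with unbounded generator. Only the orbit of the fixed vector `f t`
has to be differentiable; the variation of `f` is carried along by isometry and strong continuity.
-/
theorem hasDerivAt_isometry_apply {U : ℝ → (H ≃ₗᵢ[ℂ] H)} (hU : ∀ x, Continuous fun t => U t x)
    {f : ℝ → H} {f' g : H} {t : ℝ} (hf : HasDerivAt f f' t)
    (hg : HasDerivAt (fun s => U s (f t)) g t) :
    HasDerivAt (fun s => U s (f s)) (U t f' + g) t := by
  have h1 : HasDerivAt (fun s => U s (f s - f t)) (U t f') t := by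
    rw [hasDerivAt_iff_tendsto_slope_zero] at hf ⊢
    have h2 : Tendsto (fun h => U (t + h) (h⁻¹ • (f (t + h) - f t))) (𝓝[≠] 0) (𝓝 (U t f')) := by
      have hc : Tendsto (fun h : ℝ => U (t + h) f') (𝓝[≠] 0) (𝓝 (U t f')) := by
        have h5 : Tendsto (fun h : ℝ => t + h) (𝓝[≠] 0) (𝓝 t) := by
          have : Continuous fun h : ℝ => t + h := by fun_prop
          simpa using (this.tendsto 0).mono_left nhdsWithin_le_nhds
        exact ((hU f').tendsto t).comp h5
      rw [tendsto_iff_norm_sub_tendsto_zero] at hf hc ⊢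
      refine squeeze_zero (fun _ => norm_nonneg _) (fun s => ?_) (by simpa using hf.add hc)
      have h4 : U (t + s) (s⁻¹ • (f (t + s) - f t)) - U t f' =
          U (t + s) (s⁻¹ • (f (t + s) - f t) - f') + (U (t + s) f' - U t f') := by
        rw [map_sub]; abel
      rw [h4]
      refine (norm_add_le _ _).trans (le_of_eq ?_)
      rw [(U (t + s)).norm_map]
    refine h2.congr fun h => ?_
    simp only [sub_self, map_zero, sub_zero]
    exact (U (t + h)).toContinuousLinearEquiv.toContinuousLinearMap.map_smul_of_tower _ _
  have h3 := h1.add hg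
  refine h3.congr_of_eventuallyEq (Eventually.of_forall fun s => ?_)
  simp [map_sub]

theorem unitary_zero {U : ℝ → (H ≃ₗᵢ[ℂ] H)} (hg : ∀ s t x, U (s + t) x = U s (U t x)) (x : H) :
    U 0 x = x := by
  have := hg 0 0 x
  rw [add_zero] at this
  exact ((U 0).injective this).symm

theorem unitary_apply_neg {U : ℝ → (H ≃ₗᵢ[ℂ] H)} (hg : ∀ s t x, U (s + t) x = U s (U t x))
    (t : ℝ) (x : H) : U t (U (-t) x) = x := by
  rw [← hg, add_neg_cancel, unitary_zero hg]

/-- A strongly continuous curve of isometries, differentiable on a dense set with a bounded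
strongly continuous derivative, is differentiable everywhere. -/
theorem hasDerivAt_of_denseRange [CompleteSpace H] {E : Type*} [AddCommGroup E] [Module ℂ E]
    {e : E →ₗ[ℂ] H}
    (hd : DenseRange e) {B : ℝ → H →L[ℂ] H} {A : ℝ → H →L[ℂ] H} {K : ℝ}
    (hK : ∀ t x, ‖A t x‖ ≤ K * ‖x‖)
    (hA : ∀ x, Continuous fun t => A t x)
    (h : ∀ c t, HasDerivAt (fun s => B s (e c)) (A t (e c)) t) (x : H) (t : ℝ) :
    HasDerivAt (fun s => B s x) (A t x) t := by
  -- In integrated form the claim is an identity between bounded operators, so it extends from the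
  -- dense range to every `x` and can then be differentiated.
  have key : ∀ s x, B s x = B 0 x + ∫ r in (0 : ℝ)..s, A r x := by
    intro s x
    let T : H →L[ℂ] H := LinearMap.mkContinuous
      { toFun := fun x => ∫ r in (0 : ℝ)..s, A r x
        map_add' := fun x y => by
          simp only [map_add]
          exact intervalIntegral.integral_add ((hA x).intervalIntegrable _ _)
            ((hA y).intervalIntegrable _ _)
        map_smul' := fun c x => by
          simp only [map_smul, RingHom.id_apply]
          exact intervalIntegral.integral_smul c _ } (K * |s|) (fun x => by
            have := intervalIntegral.norm_integral_le_of_norm_le_const (a := 0) (b := s)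
              (f := fun r => A r x) (C := K * ‖x‖) (fun r _ => hK r x)
            simp only [LinearMap.coe_mk, AddHom.coe_mk]
            rw [sub_zero] at this
            linarith)
    refine hd.induction (P := fun x => B s x = B 0 x + T x) ?_ ?_ x
    · rintro _ ⟨c, rfl⟩
      have := intervalIntegral.integral_eq_sub_of_hasDerivAt (a := 0) (b := s)
        (fun r _ => h c r) ((hA (e c)).intervalIntegrable _ _)
      change B s (e c) = B 0 (e c) + ∫ r in (0 : ℝ)..s, A r (e c)
      rw [this]; abel
    · exact isClosed_eq (B s).continuous ((B 0).continuous.add T.continuous)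
  have h1 := ((hA x).integral_hasStrictDerivAt 0 t).hasDerivAt.const_add (B 0 x)
  exact h1.congr_of_eventuallyEq (Eventually.of_forall fun s => key s x)

end Abstract

section Multiplication

variable {N : ℕ}

theorem toL2_coe {g : Config N → ℂ} (h : MemLp g 2 volume) : (toL2 g : Config N → ℂ) =ᵐ[volume] g := by
  rw [toL2, dif_pos h]
  exact h.coeFn_toLp

theorem toL2_congr {g : Config N → ℂ} {Ψ : L2 N} (h : (Ψ : Config N → ℂ) =ᵐ[volume] g) :
    toL2 g = Ψ := by
  have hm : MemLp g 2 volume := (memLp_congr_ae h).1 (Lp.memLp Ψ)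
  exact Lp.ext ((toL2_coe hm).trans h.symm)

theorem memLp_mul {g : Config N → ℂ} {M : ℝ} (hg : AEStronglyMeasurable g volume)
    (hM : ∀ᵐ X, ‖g X‖ ≤ M) (Ψ : L2 N) : MemLp (fun X => g X * (Ψ : Config N → ℂ) X) 2 volume := by
  refine (Lp.memLp Ψ).of_le_mul (c := M) (hg.mul (Lp.aestronglyMeasurable Ψ)) ?_
  filter_upwards [hM] with X hX
  rw [norm_mul]
  gcongr

/-- Multiplication by an essentially bounded function. -/
def mulCLM (g : Config N → ℂ) (M : ℝ) (hg : AEStronglyMeasurable g volume)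
    (hM : ∀ᵐ X, ‖g X‖ ≤ M) : L2 N →L[ℂ] L2 N :=
  LinearMap.mkContinuous
    { toFun := fun Ψ => toL2 fun X => g X * (Ψ : Config N → ℂ) X
      map_add' := fun Ψ Φ => by
        refine toL2_congr ?_
        filter_upwards [Lp.coeFn_add (toL2 fun X => g X * (Ψ : Config N → ℂ) X)
          (toL2 fun X => g X * (Φ : Config N → ℂ) X), Lp.coeFn_add Ψ Φ,
          toL2_coe (memLp_mul hg hM Ψ), toL2_coe (memLp_mul hg hM Φ)] with X h1 h2 h3 h4
        rw [h1, h2, Pi.add_apply, Pi.add_apply, h3, h4, mul_add]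
      map_smul' := fun c Ψ => by
        refine toL2_congr ?_
        filter_upwards [Lp.coeFn_smul c (toL2 fun X => g X * (Ψ : Config N → ℂ) X),
          Lp.coeFn_smul c Ψ, toL2_coe (memLp_mul hg hM Ψ)] with X h1 h2 h3
        rw [RingHom.id_apply, h1, h2, Pi.smul_apply, Pi.smul_apply, h3, smul_eq_mul, smul_eq_mul]
        ring } M (fun Ψ => by
      refine Lp.norm_le_mul_norm_of_ae_le_mul ?_
      filter_upwards [toL2_coe (memLp_mul hg hM Ψ), hM] with X h1 h2
      simp only [LinearMap.coe_mk, AddHom.coe_mk]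
      rw [h1, norm_mul]
      gcongr)

theorem mulCLM_coe (g : Config N → ℂ) (M : ℝ) (hg : AEStronglyMeasurable g volume)
    (hM : ∀ᵐ X, ‖g X‖ ≤ M) (Ψ : L2 N) :
    (mulCLM g M hg hM Ψ : Config N → ℂ) =ᵐ[volume] fun X => g X * (Ψ : Config N → ℂ) X :=
  toL2_coe (memLp_mul hg hM Ψ)

theorem norm_mulCLM_le (g : Config N → ℂ) (M : ℝ) (hg : AEStronglyMeasurable g volume)
    (hM : ∀ᵐ X, ‖g X‖ ≤ M) (Ψ : L2 N) : ‖mulCLM g M hg hM Ψ‖ ≤ M * ‖Ψ‖ := by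
  refine Lp.norm_le_mul_norm_of_ae_le_mul ?_
  filter_upwards [mulCLM_coe g M hg hM Ψ, hM] with X h1 h2
  rw [h1, norm_mul]
  gcongr

/-- The scaled distance vector between the test particle and the `j`-th oscillator. -/
def relPos (ε : ℝ) (j : Fin N) (X : Config N) : E3 := ε⁻¹ • (X.1 - X.2 j)

/-- The relative position is a surjective linear map, and preimages of null sets under such maps are
null. `V` is only known almost everywhere, so this is needed to compose with it. -/
theorem ae_relPos {ε : ℝ} (hε : 0 < ε) (j : Fin N) {p : E3 → Prop}
    (h : ∀ᵐ x, p x) : ∀ᵐ X : Config N, p (relPos ε j X) := by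
  let L : Config N →ₗ[ℝ] E3 := ε⁻¹ • (LinearMap.fst ℝ E3 (Fin N → E3) -
    (LinearMap.proj j).comp (LinearMap.snd ℝ E3 (Fin N → E3)))
  have hL : Function.Surjective L := fun y => ⟨(ε • y, 0), by
    simp [L, smul_smul, inv_mul_cancel₀ hε.ne']⟩
  obtain ⟨s, hs, hsm, hs0⟩ := exists_measurable_superset_of_null (ae_iff.1 h)
  have h1 : ∀ᵐ y : E3, y ∈ sᶜ := by
    rw [ae_iff]; simpa using hs0
  have h2 := (ae_comp_linearMap_mem_iff L (volume : Measure (Config N)) (volume : Measure E3) hL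
    hsm.compl).2 h1
  filter_upwards [h2] with X hX
  by_contra hp
  exact hX (hs hp)

theorem aestronglyMeasurable_relPos {ε : ℝ} (hε : 0 < ε) (j : Fin N) {V : E3 → ℝ}
    (hV : AEStronglyMeasurable V volume) :
    AEStronglyMeasurable (fun X : Config N => ((V (relPos ε j X) : ℝ) : ℂ)) volume := by
  have h1 : Measurable (relPos ε j : Config N → E3) := by
    unfold relPos
    exact Continuous.measurable (by fun_prop)
  have h2 := ae_relPos hε j (N := N) hV.ae_eq_mk
  refine ⟨fun X => ((hV.mk V (relPos ε j X) : ℝ) : ℂ), ?_, ?_⟩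
  · exact Complex.continuous_ofReal.comp_stronglyMeasurable
      (hV.stronglyMeasurable_mk.comp_measurable h1)
  · filter_upwards [h2] with X hX
    rw [hX]

theorem interaction_eq (ε : ℝ) (V : E3 → ℝ) (X : Config N) :
    ((interaction ε V X : ℝ) : ℂ) = ∑ j, ((V (relPos ε j X) : ℝ) : ℂ) := by
  simp [interaction, relPos]

variable {ε M : ℝ} {V : E3 → ℝ}

/-- Multiplication by the interaction with the `j`-th oscillator. -/
def pairCLM (hε : 0 < ε) (hV : AEStronglyMeasurable V volume) (hM : ∀ᵐ x, ‖V x‖ ≤ M) (j : Fin N) :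
    L2 N →L[ℂ] L2 N :=
  mulCLM (fun X => ((V (relPos ε j X) : ℝ) : ℂ)) M (aestronglyMeasurable_relPos hε j hV)
    (by simpa using ae_relPos hε j hM)

theorem pairCLM_coe (hε : 0 < ε) (hV : AEStronglyMeasurable V volume) (hM : ∀ᵐ x, ‖V x‖ ≤ M)
    (j : Fin N) (Ψ : L2 N) : (pairCLM hε hV hM j Ψ : Config N → ℂ) =ᵐ[volume]
      fun X => ((V (relPos ε j X) : ℝ) : ℂ) * (Ψ : Config N → ℂ) X :=
  mulCLM_coe _ _ _ _ Ψ

theorem norm_pairCLM_le (hε : 0 < ε) (hV : AEStronglyMeasurable V volume) (hM : ∀ᵐ x, ‖V x‖ ≤ M)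
    (j : Fin N) (Ψ : L2 N) : ‖pairCLM hε hV hM j Ψ‖ ≤ M * ‖Ψ‖ :=
  norm_mulCLM_le _ _ _ _ Ψ

theorem mulV_eq_sum (hε : 0 < ε) (hV : AEStronglyMeasurable V volume) (hM : ∀ᵐ x, ‖V x‖ ≤ M)
    (Ψ : L2 N) : mulV ε V Ψ = (∑ j, pairCLM hε hV hM j) Ψ := by
  refine toL2_congr ?_
  rw [sum_apply]
  have h1 := Lp.coeFn_finsetSum Finset.univ (fun j => pairCLM hε hV hM j Ψ)
  have h2 : ∀ᵐ X, ∀ j, (pairCLM hε hV hM j Ψ : Config N → ℂ) X =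
    ((V (relPos ε j X) : ℝ) : ℂ) * (Ψ : Config N → ℂ) X :=
    ae_all_iff.2 fun j => pairCLM_coe hε hV hM j Ψ
  filter_upwards [h1, h2] with X h1 h2
  rw [h1, Finset.sum_apply, interaction_eq, Finset.sum_mul]
  exact Finset.sum_congr rfl fun j _ => h2 j

theorem norm_sum_pairCLM_le (hε : 0 < ε) (hV : AEStronglyMeasurable V volume)
    (hM : ∀ᵐ x, ‖V x‖ ≤ M) (Ψ : L2 N) : ‖(∑ j, pairCLM hε hV hM j) Ψ‖ ≤ N * M * ‖Ψ‖ := by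
  rw [sum_apply]
  refine (norm_sum_le _ _).trans ((Finset.sum_le_sum fun j _ =>
    norm_pairCLM_le hε hV hM j Ψ).trans (le_of_eq ?_))
  simp [mul_assoc]

end Multiplication

end

/-! ### The generator of the free group and Duhamel's formula. -/

section

variable {N : ℕ} {ε : ℝ}

theorem real_smul_eq_complex_smul (r : ℝ) (x : L2 N) : r • x = (r : ℂ) • x :=
  RCLike.real_smul_eq_coe_smul (K := ℂ) r x

/-- The defining properties of the free evolution in terms of wave packets. -/
structure IsFreeGroup (hε : 0 < ε) (a : Fin N → E3) (W : ℝ → (L2 N ≃ₗᵢ[ℂ] L2 N)) : Prop where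
  map_packet : ∀ t s p, W t (packetL2 hε a s p) = packetL2 hε a (s + t) p
  add : ∀ s t x, W (s + t) x = W s (W t x)
  cont : ∀ x, Continuous fun t => W t x

/-- The generator is known on packets only. Paired with a packet, the evolution of a Schwartz
function moves to the packet, which is evolved backwards explicitly, and symmetry returns the
Hamiltonian to the Schwartz function. Totality turns this into an integral equation in `L²`. -/
theorem IsFreeGroup.hasDerivAt_zero {hε : 0 < ε} {a : Fin N → E3} {W : ℝ → (L2 N ≃ₗᵢ[ℂ] L2 N)}
    (hW : IsFreeGroup hε a W) (φ : 𝓢(Config N, ℂ)) :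
    HasDerivAt (fun t => W t (φ.toLp 2 volume))
      ((-Complex.I * ((ε : ℂ) ^ 2)⁻¹) • (freeHamS ε a φ).toLp 2 volume) 0 := by
  set x : L2 N := φ.toLp 2 volume with hx
  set y : L2 N := (freeHamS ε a φ).toLp 2 volume with hy
  set c : ℂ := -Complex.I * ((ε : ℂ) ^ 2)⁻¹ with hc
  have hcy : Continuous fun r => c • W r y := (hW.cont y).const_smul c
  have hI : ∀ t, HasDerivAt (fun s => ∫ r in (0 : ℝ)..s, c • W r y) (c • W t y) t := fun t =>
    (hcy.integral_hasStrictDerivAt 0 t).hasDerivAt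
  have hinner : ∀ (z : L2 N) (p : Params N) (t : ℝ), inner ℂ (packetL2 hε a 0 p) (W t z) =
      inner ℂ (packetL2 hε a (-t) p) z := by
    intro z p t
    have h1 := hW.map_packet t (-t) p
    rw [neg_add_cancel] at h1
    rw [← h1, (W t).inner_map_map]
  have key : ∀ t, W t x = x + ∫ r in (0 : ℝ)..t, c • W r y := by
    intro t
    rw [← sub_eq_zero]
    refine packetL2_total hε a _ fun p => ?_
    have hd : ∀ s, HasDerivAt (fun s => inner ℂ (packetL2 hε a 0 p)
        (W s x - (x + ∫ r in (0 : ℝ)..s, c • W r y))) 0 s := by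
      intro s
      have h1 : HasDerivAt (fun s => packetL2 hε a (-s) p)
          (-(c • (freeHamS ε a (packet hε a (-s) p)).toLp 2 volume)) s :=
        by
        have h0 := HasDerivAt.scomp s (h := fun s : ℝ => -s) (g₁ := fun s => packetL2 hε a s p)
          (hasDerivAt_packetL2 hε a (-s) p) (hasDerivAt_neg s)
        rw [neg_one_smul] at h0
        exact h0
      have h2 := h1.inner ℂ (hasDerivAt_const s x)
      have h3 := (hasDerivAt_const s (packetL2 hε a 0 p)).inner ℂ ((hI s).const_add x)
      have h4 := h2.sub h3
      simp only [inner_zero_right, inner_zero_left, zero_add, add_zero] at h4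
      have h5 := h4.congr_of_eventuallyEq (f₁ := fun s => inner ℂ (packetL2 hε a 0 p)
        (W s x - (x + ∫ r in (0 : ℝ)..s, c • W r y)))
        (Eventually.of_forall fun s => by simp [inner_sub_right, hinner])
      refine h5.congr_deriv ?_
      rw [inner_neg_left, inner_smul_left, inner_smul_right, hinner, hx, hy, freeHamS_symm]
      simp [hc, packetL2]
    have h1 := is_const_of_deriv_eq_zero (𝕜 := ℝ) (fun s => (hd s).differentiableAt)
      (fun s => (hd s).deriv) t 0
    rw [h1]
    simp [unitary_zero hW.add]
  have h1 := (hI 0).const_add x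
  rw [unitary_zero hW.add] at h1
  exact h1.congr_of_eventuallyEq (Eventually.of_forall key)

theorem IsFreeGroup.isUnitaryGroupOf {hε : 0 < ε} {a : Fin N → E3} {W : ℝ → (L2 N ≃ₗᵢ[ℂ] L2 N)}
    (hW : IsFreeGroup hε a W) : IsUnitaryGroupOf (freeHam ε a) (fun τ => W (ε ^ 2 * τ)) := by
  have he : (ε : ℂ) ≠ 0 := by exact_mod_cast hε.ne'
  refine ⟨fun s t x => ?_, fun x => ?_, fun φ => ?_⟩
  · simp only [mul_add, hW.add]
  · exact (hW.cont x).comp (by fun_prop : Continuous fun τ : ℝ => ε ^ 2 * τ)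
  · refine ⟨φ.toLp 2 volume, (freeHamS ε a φ).toLp 2 volume, φ.coeFn_toLp 2 volume, ?_, ?_⟩
    · refine ((freeHamS ε a φ).coeFn_toLp 2 volume).trans (Eventually.of_forall fun X => ?_)
      exact freeHamS_apply ε a φ X
    · have h1 := hW.hasDerivAt_zero φ
      have h2 : HasDerivAt (fun τ : ℝ => ε ^ 2 * τ) (ε ^ 2) 0 := by
        simpa using (hasDerivAt_id (0 : ℝ)).const_mul (ε ^ 2)
      have h3 := HasDerivAt.scomp (0 : ℝ) (h := fun τ : ℝ => ε ^ 2 * τ)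
        (g₁ := fun t => W t (φ.toLp 2 volume)) (by simp only [mul_zero]; exact h1) h2
      refine h3.congr_deriv ?_
      rw [real_smul_eq_complex_smul, smul_smul]
      congr 1
      push_cast
      field_simp

theorem freeHam_eq_fullHam (a : Fin N → E3) : freeHam ε a = fullHam ε a 0 := by
  funext φ X
  simp [fullHam, interaction]

variable {M : ℝ} {V : E3 → ℝ}

/-- The Duhamel formula in differential form. -/
theorem IsFreeGroup.hasDerivAt_duhamel {hε : 0 < ε} {a : Fin N → E3}
    {W U : ℝ → (L2 N ≃ₗᵢ[ℂ] L2 N)}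
    (hW : IsFreeGroup hε a W) (hV : AEStronglyMeasurable V volume) (hM : ∀ᵐ x, ‖V x‖ ≤ M)
    (hU : IsUnitaryGroupOf (fullHam ε a V) U) (Ψ : L2 N) (t : ℝ) :
    HasDerivAt (fun s => U (-s / ε ^ 2) (W s Ψ))
      (Complex.I • U (-t / ε ^ 2) ((∑ j, pairCLM hε hV hM j) (W t Ψ))) t := by
  have he : (ε : ℂ) ≠ 0 := by exact_mod_cast hε.ne'
  obtain ⟨hUadd, hUcont, hUd⟩ := hU
  set mV := ∑ j, pairCLM hε hV hM j with hmV
  have hB : ∀ x, Continuous fun s : ℝ => U (-s / ε ^ 2) x := fun x =>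
    (hUcont x).comp (by fun_prop : Continuous fun s : ℝ => -s / ε ^ 2)
  -- On packets both factors are differentiable: the free group shifts their time label, and the
  -- generator of `U` is prescribed because packets are Schwartz functions.
  have hpk : ∀ p r t, HasDerivAt (fun s' => U (-s' / ε ^ 2) (packetL2 hε a (r + s') p))
      (Complex.I • U (-t / ε ^ 2) (mV (packetL2 hε a (r + t) p))) t := by
    intro p r t
    set s := r + t with hs
    obtain ⟨x, y, hx, hy, hd⟩ := hUd (packet hε a s p)
    have hx' : x = packetL2 hε a s p :=
      Lp.ext (hx.trans ((packet hε a s p).coeFn_toLp 2 volume).symm)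
    have hy' : y = (freeHamS ε a (packet hε a s p)).toLp 2 volume +
        ((ε : ℂ) ^ 2) • mV (packetL2 hε a s p) := by
      refine Lp.ext ?_
      have hm : (mV (packetL2 hε a s p) : Config N → ℂ) =ᵐ[volume] fun X =>
          ((interaction ε V X : ℝ) : ℂ) * (packetL2 hε a s p : Config N → ℂ) X := by
        rw [hmV, ← mulV_eq_sum]
        refine toL2_coe ?_
        have h1 := memLp_finsetSum Finset.univ (fun j _ =>
          memLp_mul (aestronglyMeasurable_relPos hε j hV)
            (by simpa using ae_relPos hε j hM) (packetL2 hε a s p))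
        refine (memLp_congr_ae (Eventually.of_forall fun X => ?_)).1 h1
        simp only [interaction_eq, Finset.sum_mul]
      filter_upwards [hy, Lp.coeFn_add ((freeHamS ε a (packet hε a s p)).toLp 2 volume)
        (((ε : ℂ) ^ 2) • mV (packetL2 hε a s p)),
        Lp.coeFn_smul ((ε : ℂ) ^ 2) (mV (packetL2 hε a s p)),
        (freeHamS ε a (packet hε a s p)).coeFn_toLp 2 volume, hm, packetL2_coe hε a s p]
        with X h1 h2 h3 h4 h5 h6
      rw [h1, h2, Pi.add_apply, h3, Pi.smul_apply, h4, h5, h6, freeHamS_apply, fullHam,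
        packet_apply, smul_eq_mul]
      push_cast
      ring
    have hshift : HasDerivAt (fun s' : ℝ => U (-s' / ε ^ 2) x)
        ((Complex.I * ((ε : ℂ) ^ 2)⁻¹) • U (-t / ε ^ 2) y) t := by
      have h1 : HasDerivAt (fun h : ℝ => U (-t / ε ^ 2) (U h x))
          (U (-t / ε ^ 2) (-Complex.I • y)) 0 :=
        (U (-t / ε ^ 2)).toContinuousLinearEquiv.toContinuousLinearMap.restrictScalars ℝ
          |>.hasFDerivAt.comp_hasDerivAt (0 : ℝ) hd
      have h2 : HasDerivAt (fun s' : ℝ => -s' / ε ^ 2 - -t / ε ^ 2) (-1 / ε ^ 2) t :=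
        (((hasDerivAt_id t).neg).div_const (ε ^ 2)).sub_const _
      have h3 := HasDerivAt.scomp t (h := fun s' : ℝ => -s' / ε ^ 2 - -t / ε ^ 2)
        (g₁ := fun h : ℝ => U (-t / ε ^ 2) (U h x)) (by simp only [sub_self]; exact h1) h2
      refine (h3.congr_of_eventuallyEq (Eventually.of_forall fun s' => ?_)).congr_deriv ?_
      · simp only [Function.comp_apply, ← hUadd]
        congr 2; ring
      · rw [real_smul_eq_complex_smul, map_smul, smul_smul]
        congr 1
        push_cast
        field_simp
    have h1 := hasDerivAt_isometry_apply (U := fun s' : ℝ => U (-s' / ε ^ 2)) hB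
      (HasDerivAt.comp_const_add r t (hasDerivAt_packetL2 hε a (r + t) p)) (by rw [← hs, ← hx']; exact hshift)
    refine h1.congr_deriv ?_
    rw [hy', map_add, map_smul, map_smul, smul_add, smul_smul]
    -- The two free Hamiltonian terms cancel. In the remaining term the coupling `ε²` is compensated
    -- by the time scale `ε⁻²`.
    have e1 : Complex.I * ((ε : ℂ) ^ 2)⁻¹ * (ε : ℂ) ^ 2 = Complex.I := by field_simp
    rw [e1, ← add_assoc, ← add_smul]
    simp
  have hd := denseRange_linearCombination (fun i : ℝ × Params N => packetL2 hε a i.1 i.2)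
    (fun x hx => packetL2_total hε a x fun p => hx (0, p))
  refine hasDerivAt_of_denseRange hd
    (B := fun s => ((U (-s / ε ^ 2)).toContinuousLinearEquiv.toContinuousLinearMap).comp
      (W s).toContinuousLinearEquiv.toContinuousLinearMap)
    (A := fun s => Complex.I • ((U (-s / ε ^ 2)).toContinuousLinearEquiv.toContinuousLinearMap).comp
      (mV.comp (W s).toContinuousLinearEquiv.toContinuousLinearMap))
    (K := N * M) (fun s x => ?_) (fun x => ?_) (fun c s => ?_) Ψ t
  · change ‖Complex.I • U (-s / ε ^ 2) (mV (W s x))‖ ≤ _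
    rw [norm_smul, Complex.norm_I, one_mul, LinearIsometryEquiv.norm_map]
    refine (norm_sum_pairCLM_le hε hV hM _).trans (le_of_eq ?_)
    rw [LinearIsometryEquiv.norm_map]
  · change Continuous fun s => Complex.I • U (-s / ε ^ 2) (mV (W s x))
    exact Continuous.const_smul (continuous_isometry_apply hB (mV.continuous.comp (hW.cont x))) Complex.I
  · change HasDerivAt (fun s => U (-s / ε ^ 2) (W s _))
      (Complex.I • U (-s / ε ^ 2) (mV (W s _))) s
    induction c using Finsupp.induction_linear with
    | zero => simpa using hasDerivAt_const s (0 : L2 N)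
    | add f g hf hg => simp only [map_add, smul_add]; exact HasDerivAt.fun_add hf hg
    | single i c =>
      simp only [Finsupp.linearCombination_single, map_smul, hW.map_packet]
      have h1 := (hpk i.2 i.1 s).const_smul c
      rw [smul_comm] at h1
      exact h1

end

/-! ### Identification of the propagators and the second-order Duhamel expansion. -/

section

variable {N : ℕ} {ε : ℝ}

theorem exists_isFreeGroup (hε : 0 < ε) (a : Fin N → E3) : ∃ W, IsFreeGroup hε a W := by
  obtain ⟨W, h1, h2, h3⟩ := exists_freeGroup hε a
  exact ⟨W, h1, h2, h3⟩

theorem isUnitaryGroupOf_unitaryGroup {H : (Config N → ℂ) → Config N → ℂ}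
    (h : ∃ U, IsUnitaryGroupOf H U) : IsUnitaryGroupOf H (unitaryGroup H) := by
  rw [unitaryGroup, dif_pos h]
  exact h.choose_spec

/-- `unitaryGroup` is an arbitrary choice among groups with the right generator. The Duhamel
derivative with zero potential vanishes, so every choice coincides with the group built from
packets. -/
theorem isFreeGroup_freeProp (hε : 0 < ε) (a : Fin N → E3) :
    IsFreeGroup hε a (freeProp ε a) := by
  obtain ⟨W, hW⟩ := exists_isFreeGroup hε a
  have hU : IsUnitaryGroupOf (fullHam ε a 0) (unitaryGroup (freeHam ε a)) := by
    rw [← freeHam_eq_fullHam]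
    exact isUnitaryGroupOf_unitaryGroup ⟨_, hW.isUnitaryGroupOf⟩
  have hV : AEStronglyMeasurable (0 : E3 → ℝ) volume := aestronglyMeasurable_zero
  have hM : ∀ᵐ x : E3, ‖(0 : E3 → ℝ) x‖ ≤ 0 := Eventually.of_forall fun x => by simp
  have heq : freeProp ε a = W := by
    funext t
    refine LinearIsometryEquiv.ext fun Ψ => ?_
    have hd : ∀ s, HasDerivAt (fun s => unitaryGroup (freeHam ε a) (-s / ε ^ 2) (W s Ψ)) 0 s := by
      intro s
      refine (hW.hasDerivAt_duhamel hV hM hU Ψ s).congr_deriv ?_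
      have h1 := norm_sum_pairCLM_le hε hV hM (W s Ψ)
      rw [mul_zero, zero_mul] at h1
      rw [norm_le_zero_iff.1 h1, map_zero, smul_zero]
    have h1 := is_const_of_deriv_eq_zero (𝕜 := ℝ) (fun s => (hd s).differentiableAt)
      (fun s => (hd s).deriv) t 0
    rw [neg_zero, zero_div, unitary_zero hW.add, unitary_zero hU.1] at h1
    rw [neg_div] at h1
    have h2 := unitary_apply_neg hU.1 (t / ε ^ 2) (W t Ψ)
    rw [h1] at h2
    exact h2
  rw [heq]
  exact hW

theorem fullProp_cases (a : Fin N → E3) (V : E3 → ℝ) :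
    IsUnitaryGroupOf (fullHam ε a V) (unitaryGroup (fullHam ε a V)) ∨
      ∀ t Ψ, fullProp ε a V t Ψ = Ψ := by
  by_cases h : ∃ U, IsUnitaryGroupOf (fullHam ε a V) U
  · exact Or.inl (isUnitaryGroupOf_unitaryGroup h)
  · refine Or.inr fun t Ψ => ?_
    rw [fullProp, unitaryGroup, dif_neg h]
    rfl

section Potential

variable {M : ℝ} {V : E3 → ℝ} (hε : 0 < ε) (a : Fin N → E3)
  (hV : AEStronglyMeasurable V volume) (hM : ∀ᵐ x, ‖V x‖ ≤ M)

theorem norm_mulV_le (hε : 0 < ε) (hV : AEStronglyMeasurable V volume) (hM : ∀ᵐ x, ‖V x‖ ≤ M)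
    (Ψ : L2 N) : ‖mulV ε V Ψ‖ ≤ N * M * ‖Ψ‖ := by
  rw [mulV_eq_sum hε hV hM]
  exact norm_sum_pairCLM_le hε hV hM Ψ

/-- The interaction picture operator as a bounded linear map. -/
def intCLM (s : ℝ) : L2 N →L[ℂ] L2 N :=
  (freeProp ε a (-s)).toContinuousLinearEquiv.toContinuousLinearMap.comp
    ((∑ j, pairCLM hε hV hM j).comp
      (freeProp ε a s).toContinuousLinearEquiv.toContinuousLinearMap)

theorem intCLM_apply (s : ℝ) (Ψ : L2 N) : intCLM hε a hV hM s Ψ = intPic ε a V s Ψ := by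
  rw [intPic, mulV_eq_sum hε hV hM]
  rfl

theorem norm_intCLM_le (s : ℝ) (Ψ : L2 N) : ‖intCLM hε a hV hM s Ψ‖ ≤ N * M * ‖Ψ‖ := by
  rw [intCLM_apply, intPic, LinearIsometryEquiv.norm_map]
  refine (norm_mulV_le hε hV hM _).trans (le_of_eq ?_)
  rw [LinearIsometryEquiv.norm_map]

theorem continuous_intCLM_apply {f : ℝ → L2 N} (hf : Continuous f) :
    Continuous fun s => intCLM hε a hV hM s (f s) := by
  have hW := isFreeGroup_freeProp hε a
  change Continuous fun s => freeProp ε a (-s) ((∑ j, pairCLM hε hV hM j) (freeProp ε a s (f s)))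
  refine continuous_isometry_apply (U := fun s => freeProp ε a (-s))
    (fun x => (hW.cont x).comp continuous_neg) ?_
  exact (∑ j, pairCLM hε hV hM j).continuous.comp (continuous_isometry_apply hW.cont hf)

theorem J_eq (t : ℝ) (Ψ : L2 N) : J ε a V t Ψ =
    -∫ s in (0 : ℝ)..t, intCLM hε a hV hM s (∫ σ in (0 : ℝ)..s, intCLM hε a hV hM σ Ψ) := by
  rw [J]
  congr 1
  refine intervalIntegral.integral_congr fun s _ => ?_
  simp only [← intCLM_apply hε a hV hM]
  exact ContinuousLinearMap.intervalIntegral_comp_comm _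
    ((continuous_intCLM_apply hε a hV hM continuous_const).intervalIntegrable _ _)

theorem hasDerivAt_J (t : ℝ) (Ψ : L2 N) : HasDerivAt (fun t => J ε a V t Ψ)
    (-intCLM hε a hV hM t (∫ σ in (0 : ℝ)..t, intCLM hε a hV hM σ Ψ)) t := by
  have h0 : Continuous fun s => ∫ σ in (0 : ℝ)..s, intCLM hε a hV hM σ Ψ :=
    intervalIntegral.continuous_primitive (fun _ _ =>
      (continuous_intCLM_apply hε a hV hM continuous_const).intervalIntegrable _ _) 0
  have h1 := ((continuous_intCLM_apply hε a hV hM h0).integral_hasStrictDerivAt 0 t).hasDerivAt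
  refine HasDerivAt.congr_of_eventuallyEq (HasDerivAt.fun_neg h1) (Eventually.of_forall fun s => ?_)
  exact J_eq hε a hV hM s Ψ

include hε hV hM in
theorem continuous_J (Ψ : L2 N) : Continuous fun t => J ε a V t Ψ :=
  continuous_iff_continuousAt.2 fun t => (hasDerivAt_J hε a hV hM t Ψ).continuousAt

/-- Apply the inverse full evolution to the free evolution of `Ψ - iKΨ + JΨ`, with `K` the
first-order integral, and differentiate in time. Differentiating `K` and `J` cancels the interaction
acting on the two lower orders, and only the term with `V J` survives. Integration and the full
evolution then give the expansion. -/
theorem fullProp_eq (hU : IsUnitaryGroupOf (fullHam ε a V) (unitaryGroup (fullHam ε a V)))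
    (v₀ t : ℝ) :
    fullProp ε a V t (initialState ε v₀ a) = freeProp ε a t (initialState ε v₀ a) -
      Complex.I • freeProp ε a t (∫ s in (0 : ℝ)..t, intCLM hε a hV hM s (initialState ε v₀ a)) +
      remainder ε v₀ a V t := by
  set Ψ := initialState ε v₀ a with hΨ
  set W := freeProp ε a with hW'
  have hW : IsFreeGroup hε a W := isFreeGroup_freeProp hε a
  set U := unitaryGroup (fullHam ε a V) with hU'
  set mV : L2 N →L[ℂ] L2 N := ∑ j, pairCLM hε hV hM j with hmV
  set K : ℝ → L2 N := fun t => ∫ s in (0 : ℝ)..t, intCLM hε a hV hM s Ψ with hK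
  have hKd : ∀ s, HasDerivAt K (intCLM hε a hV hM s Ψ) s := fun s =>
    ((continuous_intCLM_apply hε a hV hM continuous_const).integral_hasStrictDerivAt 0 s).hasDerivAt
  have hB : ∀ x, Continuous fun s : ℝ => U (-s / ε ^ 2) x := fun x =>
    (hU.2.1 x).comp (by fun_prop : Continuous fun s : ℝ => -s / ε ^ 2)
  have hBW : ∀ x, Continuous fun s : ℝ => (W s).trans (U (-s / ε ^ 2)) x := fun x =>
    continuous_isometry_apply hB (hW.cont x)
  have hd : ∀ s, HasDerivAt (fun s => U (-s / ε ^ 2) (W s (Ψ - Complex.I • K s + J ε a V s Ψ)))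
      (Complex.I • U (-s / ε ^ 2) (mV (W s (J ε a V s Ψ)))) s := by
    intro s
    have h1 : HasDerivAt (fun s => Ψ - Complex.I • K s + J ε a V s Ψ)
        (-(Complex.I • intCLM hε a hV hM s Ψ) - intCLM hε a hV hM s (K s)) s := by
      have h2 := (HasDerivAt.const_sub Ψ ((hKd s).const_smul Complex.I))
      refine (HasDerivAt.fun_add h2 (hasDerivAt_J hε a hV hM s Ψ)).congr_deriv ?_
      rw [sub_eq_add_neg]
    have h3 := hasDerivAt_isometry_apply (U := fun s => (W s).trans (U (-s / ε ^ 2))) hBW h1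
      (hW.hasDerivAt_duhamel hV hM hU _ s)
    refine h3.congr_deriv ?_
    have hWI : ∀ x, W s (intCLM hε a hV hM s x) = mV (W s x) := fun x => by
      change W s (W (-s) (mV (W s x))) = _
      rw [unitary_apply_neg hW.add]
    simp only [LinearIsometryEquiv.trans_apply]
    have h5 : -(Complex.I • intCLM hε a hV hM s Ψ) - intCLM hε a hV hM s (K s) =
        -(Complex.I • intCLM hε a hV hM s (Ψ - Complex.I • K s)) := by
      rw [map_sub, map_smul, smul_sub, smul_smul, Complex.I_mul_I, neg_one_smul]
      abel
    rw [h5]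
    simp only [map_neg, map_smul, hWI, map_add, smul_add]
    abel
  have hJc := continuous_J hε a hV hM Ψ
  have hc : Continuous fun s => Complex.I • U (-s / ε ^ 2) (mV (W s (J ε a V s Ψ))) :=
    Continuous.const_smul (continuous_isometry_apply hB
      (mV.continuous.comp (continuous_isometry_apply hW.cont hJc))) Complex.I
  have h1 := intervalIntegral.integral_eq_sub_of_hasDerivAt (a := 0) (b := t)
    (fun r _ => hd r) (hc.intervalIntegrable _ _)
  have hJ0 : J ε a V 0 Ψ = 0 := by simp [J]
  have hK0 : K 0 = 0 := by simp [hK]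
  rw [hJ0, hK0, smul_zero, sub_zero, add_zero, neg_zero, zero_div, unitary_zero hU.1,
    unitary_zero hW.add, neg_div] at h1
  have h2 := congrArg (U (t / ε ^ 2)) h1
  rw [map_sub, unitary_apply_neg hU.1] at h2
  have h4 : U (t / ε ^ 2) (∫ s in (0 : ℝ)..t, Complex.I • U (-s / ε ^ 2) (mV (W s (J ε a V s Ψ)))) =
      Complex.I • ∫ s in (0 : ℝ)..t, fullProp ε a V (t - s) (mulV ε V (W s (J ε a V s Ψ))) := by
    rw [← intervalIntegral.integral_smul]
    have h5 := (ContinuousLinearMap.intervalIntegral_comp_comm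
      (U (t / ε ^ 2)).toContinuousLinearEquiv.toContinuousLinearMap
      (hc.intervalIntegrable (μ := volume) 0 t)).symm
    refine h5.trans (intervalIntegral.integral_congr fun s _ => ?_)
    change U (t / ε ^ 2) (Complex.I • U (-s / ε ^ 2) (mV (W s (J ε a V s Ψ)))) = _
    rw [map_smul, ← hU.1, fullProp, mulV_eq_sum hε hV hM]
    congr 3
    ring
  rw [h4] at h2
  have h6 : fullProp ε a V t Ψ = U (t / ε ^ 2) Ψ := rfl
  rw [remainder, h6]
  have h7 : U (t / ε ^ 2) Ψ = W t (Ψ - Complex.I • K t + J ε a V t Ψ) - Complex.I •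
      ∫ s in (0 : ℝ)..t, fullProp ε a V (t - s) (mulV ε V (W s (J ε a V s Ψ))) := by
    rw [h2]; abel
  rw [h7, map_add, map_sub, map_smul]
  abel

include hε hV hM in
theorem bddAbove_norm_J (Ψ : L2 N) (t : ℝ) :
    BddAbove ((fun s => ‖J ε a V s Ψ‖) '' Icc 0 t) :=
  (isCompact_Icc.image (continuous_J hε a hV hM Ψ).norm).bddAbove

include hε hV hM in
-- Of `fullProp` only isometry is used, so it does not matter whether a group generated by the full
-- Hamiltonian exists.
theorem norm_remainder_le (v₀ : ℝ) {t : ℝ} (ht : 0 ≤ t) :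
    ‖remainder ε v₀ a V t‖ ≤ (1 + t * (N * M)) *
      sSup ((fun s => ‖J ε a V s (initialState ε v₀ a)‖) '' Icc 0 t) := by
  set S := sSup ((fun s => ‖J ε a V s (initialState ε v₀ a)‖) '' Icc 0 t) with hS
  have hle : ∀ s ∈ Icc 0 t, ‖J ε a V s (initialState ε v₀ a)‖ ≤ S := fun s hs =>
    le_csSup (bddAbove_norm_J hε a hV hM _ t) ⟨s, hs, rfl⟩
  obtain ⟨x, hx⟩ := hM.exists
  have hM0 : 0 ≤ M := (norm_nonneg _).trans hx
  have h1 := intervalIntegral.norm_integral_le_of_norm_le_const (a := 0) (b := t)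
    (f := fun s => fullProp ε a V (t - s)
        (mulV ε V (freeProp ε a s (J ε a V s (initialState ε v₀ a))))) (C := N * M * S)
    (fun s hs => by
      rw [uIoc_of_le ht] at hs
      rw [LinearIsometryEquiv.norm_map]
      refine (norm_mulV_le hε hV hM _).trans ?_
      rw [LinearIsometryEquiv.norm_map]
      gcongr
      exact hle s ⟨hs.1.le, hs.2⟩)
  rw [sub_zero, abs_of_nonneg ht] at h1
  rw [remainder]
  refine (norm_sub_le _ _).trans ?_
  rw [LinearIsometryEquiv.norm_map, norm_smul, Complex.norm_I, one_mul]
  have h2 := hle t ⟨ht, le_rfl⟩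
  linarith

end Potential

end

/-! ### Weak derivatives, Fourier integrals and inversion. -/

section

open scoped FourierTransform

section WeakDerivatives

theorem partialD_mul {φ ψ : E3 → ℝ} (hφ : ContDiff ℝ ∞ φ) (hψ : ContDiff ℝ ∞ ψ) (k : Fin 3)
    (x : E3) : partialD k (fun y => φ y * ψ y) x = partialD k φ x * ψ x + φ x * partialD k ψ x := by
  rw [partialD, fderiv_fun_mul (hφ.differentiable (by simp) x) (hψ.differentiable (by simp) x)]
  simp [partialD]
  ring

theorem partialD_comp_smul (φ : E3 → ℝ) (c : ℝ) (k : Fin 3)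
    (x : E3) : partialD k (fun y => φ (c • y)) x = c * partialD k φ (c • x) := by
  rw [partialD, fderiv_comp_smul]
  simp [partialD]

theorem continuous_partialD {φ : E3 → ℝ} (hφ : ContDiff ℝ ∞ φ) (k : Fin 3) :
    Continuous (partialD k φ) :=
  (hφ.continuous_fderiv (by simp)).clm_apply continuous_const

/-- Test functions in the definition of a weak derivative of an integrable function need not have
compact support. -/
theorem integral_mul_partialD {k : Fin 3} {f g : E3 → ℂ} (hf : Integrable f) (hg : Integrable g)
    (h : ∀ φ : E3 → ℝ, ContDiff ℝ ∞ φ → HasCompactSupport φ →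
      ∫ x, f x * ((partialD k φ x : ℝ) : ℂ) = -∫ x, g x * ((φ x : ℝ) : ℂ))
    {ψ : E3 → ℝ} (hψ : ContDiff ℝ ∞ ψ) {B : ℝ} (hb : ∀ x, |ψ x| ≤ B)
    (hb' : ∀ x, |partialD k ψ x| ≤ B) :
    ∫ x, f x * ((partialD k ψ x : ℝ) : ℂ) = -∫ x, g x * ((ψ x : ℝ) : ℂ) := by
  let χ : ContDiffBump (0 : E3) := ⟨1, 2, one_pos, one_lt_two⟩
  have hχ : ContDiff ℝ ∞ (χ : E3 → ℝ) := χ.contDiff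
  have hχ1 : ∀ x, |χ x| ≤ 1 := fun x => by rw [abs_of_nonneg χ.nonneg]; exact χ.le_one
  have hχ' : ∃ C, ∀ x, |partialD k χ x| ≤ C := by
    have h1 : HasCompactSupport (partialD k (χ : E3 → ℝ)) := by
      have := χ.hasCompactSupport.fderiv (𝕜 := ℝ)
      exact this.comp_left (g := fun L : E3 →L[ℝ] ℝ => L (EuclideanSpace.single k 1)) (by simp)
    exact h1.exists_bound_of_continuous (continuous_partialD hχ k)
  obtain ⟨C, hC⟩ := hχ'
  have hB0 : 0 ≤ B := (abs_nonneg _).trans (hb 0)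
  -- The test function is cut off by the dilated bumps `χ (c n • x)`, whose derivative carries a
  -- factor `c n → 0`.
  let c : ℕ → ℝ := fun n => ((n : ℝ) + 1)⁻¹
  have hc0 : ∀ n, 0 < c n := fun n => by positivity
  have hc1 : ∀ n, c n ≤ 1 := fun n => inv_le_one_of_one_le₀ (by linarith [(n.cast_nonneg : (0 : ℝ) ≤ n)])
  have hct : Tendsto c atTop (𝓝 0) := by
    have := tendsto_one_div_add_atTop_nhds_zero_nat (𝕜 := ℝ)
    simpa [c, one_div] using this
  let χn : ℕ → E3 → ℝ := fun n x => χ (c n • x)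
  have hχn : ∀ n, ContDiff ℝ ∞ (χn n) := fun n => hχ.comp (contDiff_const_smul _)
  have hχt : ∀ x, Tendsto (fun n => χn n x) atTop (𝓝 1) := fun x => by
    have h1 : Tendsto (fun n => c n • x) atTop (𝓝 0) := by simpa using hct.smul_const x
    have h2 := (χ.continuous.tendsto 0).comp h1
    rw [χ.one_of_mem_closedBall (by simp [χ.rIn_pos.le])] at h2
    exact h2
  have hχs : ∀ n, HasCompactSupport (χn n) := fun n =>
    χ.hasCompactSupport.comp_smul (hc0 n).ne'
  have key : ∀ n, ∫ x, f x * ((partialD k (fun y => χn n y * ψ y) x : ℝ) : ℂ) =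
      -∫ x, g x * ((χn n x * ψ x : ℝ) : ℂ) := fun n =>
    h _ ((hχn n).mul hψ) ((hχs n).mul_right)
  have hpd : ∀ n x, partialD k (fun y => χn n y * ψ y) x =
      c n * partialD k χ (c n • x) * ψ x + χn n x * partialD k ψ x := fun n x => by
    rw [partialD_mul (hχn n) hψ, partialD_comp_smul]
  have h1 : Tendsto (fun n => ∫ x, f x * ((partialD k (fun y => χn n y * ψ y) x : ℝ) : ℂ)) atTop
      (𝓝 (∫ x, f x * ((partialD k ψ x : ℝ) : ℂ))) := by
    refine tendsto_integral_of_dominated_convergence (fun x => ‖f x‖ * (C * B + B)) (fun n => ?_)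
      (hf.norm.mul_const _) (fun n => ?_) ?_
    · refine hf.aestronglyMeasurable.mul (Continuous.aestronglyMeasurable ?_)
      exact Complex.continuous_ofReal.comp (continuous_partialD ((hχn n).mul hψ) k)
    · refine Eventually.of_forall fun x => ?_
      rw [norm_mul, Complex.norm_real, Real.norm_eq_abs, hpd]
      gcongr
      refine (abs_add_le _ _).trans ?_
      rw [abs_mul, abs_mul, abs_mul, abs_of_pos (hc0 n)]
      have h2 : c n * |partialD k χ (c n • x)| ≤ 1 * C :=
        mul_le_mul (hc1 n) (hC _) (abs_nonneg _) zero_le_one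
      have h3 : |χn n x| * |partialD k ψ x| ≤ 1 * B :=
        mul_le_mul (hχ1 _) (hb' _) (abs_nonneg _) zero_le_one
      have h4 : c n * |partialD k χ (c n • x)| * |ψ x| ≤ 1 * C * B :=
        mul_le_mul h2 (hb _) (abs_nonneg _) (by linarith [(abs_nonneg _).trans (hC 0)])
      linarith
    · refine Eventually.of_forall fun x => ?_
      simp only [hpd]
      have h2 : Tendsto (fun n => c n * partialD k χ (c n • x) * ψ x + χn n x * partialD k ψ x) atTop
          (𝓝 (0 * ψ x + 1 * partialD k ψ x)) := by
        refine Tendsto.add (Tendsto.mul_const _ ?_) ((hχt x).mul_const _)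
        refine squeeze_zero_norm (a := fun n => c n * C) (fun n => ?_) (by simpa using hct.mul_const C)
        rw [norm_mul, Real.norm_eq_abs, abs_of_pos (hc0 n)]
        exact mul_le_mul_of_nonneg_left (hC _) (hc0 n).le
      rw [zero_mul, zero_add, one_mul] at h2
      exact ((Complex.continuous_ofReal.tendsto _).comp h2).const_mul _
  have h2 : Tendsto (fun n => -∫ x, g x * ((χn n x * ψ x : ℝ) : ℂ)) atTop
      (𝓝 (-∫ x, g x * ((ψ x : ℝ) : ℂ))) := by
    refine Tendsto.neg ?_
    refine tendsto_integral_of_dominated_convergence (fun x => ‖g x‖ * B) (fun n => ?_)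
      (hg.norm.mul_const _) (fun n => ?_) ?_
    · refine hg.aestronglyMeasurable.mul (Continuous.aestronglyMeasurable ?_)
      exact Complex.continuous_ofReal.comp ((hχn n).continuous.mul hψ.continuous)
    · refine Eventually.of_forall fun x => ?_
      rw [norm_mul, Complex.norm_real, Real.norm_eq_abs, abs_mul]
      have h3 : |χn n x| * |ψ x| ≤ 1 * B := mul_le_mul (hχ1 _) (hb _) (abs_nonneg _) zero_le_one
      rw [one_mul] at h3
      gcongr
    · refine Eventually.of_forall fun x => ?_
      have h2 := (hχt x).mul_const (ψ x)
      rw [one_mul] at h2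
      exact ((Complex.continuous_ofReal.tendsto _).comp h2).const_mul _
  exact tendsto_nhds_unique (h1.congr key) h2

/-- The (unnormalized) inverse Fourier transform. -/
def charIntegral (f : E3 → ℂ) (q : E3) : ℂ :=
  ∫ η : E3, Complex.exp (Complex.I * ((inner ℝ η q : ℝ) : ℂ)) * f η

theorem norm_cexp_I_mul (x : ℝ) : ‖Complex.exp (Complex.I * (x : ℂ))‖ = 1 := by
  rw [mul_comm, Complex.norm_exp_ofReal_mul_I]

theorem norm_charIntegral_le (f : E3 → ℂ) (q : E3) : ‖charIntegral f q‖ ≤ ∫ η, ‖f η‖ := by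
  refine (norm_integral_le_integral_norm _).trans (le_of_eq ?_)
  simp

/-- Integration by parts against a plane wave. Since test functions are real, its cosine and sine
are inserted separately; both are bounded together with their derivatives. -/
theorem charIntegral_deriv {k : Fin 3} {f g : E3 → ℂ} (hf : Integrable f) (hg : Integrable g)
    (h : ∀ φ : E3 → ℝ, ContDiff ℝ ∞ φ → HasCompactSupport φ →
      ∫ x, f x * ((partialD k φ x : ℝ) : ℂ) = -∫ x, g x * ((φ x : ℝ) : ℂ)) (q : E3) :
    charIntegral g q = -Complex.I * q k * charIntegral f q := by
  have hi : ∀ η : E3, HasFDerivAt (fun η : E3 => inner ℝ η q) (innerSL ℝ q) η := fun η => by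
    have h1 := (innerSL ℝ q).hasFDerivAt (x := η)
    refine h1.congr_of_eventuallyEq (Eventually.of_forall fun y => ?_)
    simp [real_inner_comm]
  have hk : innerSL ℝ q (EuclideanSpace.single k 1) = q k := by
    rw [innerSL_apply_apply, EuclideanSpace.inner_single_right]
    simp
  have hqk : |q k| ≤ 1 + ‖q‖ := by
    have := PiLp.norm_apply_le q k
    rw [Real.norm_eq_abs] at this
    linarith
  have hcos : ∀ η : E3, partialD k (fun η => Real.cos (inner ℝ η q)) η =
      -(Real.sin (inner ℝ η q) * q k) := fun η => by
    rw [partialD, (hi η).cos.fderiv, smul_apply, hk,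
      smul_eq_mul]
    ring
  have hsin : ∀ η : E3, partialD k (fun η => Real.sin (inner ℝ η q)) η =
      Real.cos (inner ℝ η q) * q k := fun η => by
    rw [partialD, (hi η).sin.fderiv, smul_apply, hk,
      smul_eq_mul]
  have hb : (1 : ℝ) ≤ 1 + ‖q‖ := by linarith [norm_nonneg q]
  have e1 := integral_mul_partialD hf hg h (ψ := fun η => Real.cos (inner ℝ η q)) (B := 1 + ‖q‖)
    (Real.contDiff_cos.comp (contDiff_id.inner ℝ contDiff_const))
    (fun x => (Real.abs_cos_le_one _).trans hb) (fun x => by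
      rw [hcos, abs_neg, abs_mul]
      exact (mul_le_mul (Real.abs_sin_le_one _) hqk (abs_nonneg _) zero_le_one).trans_eq (one_mul _))
  have e2 := integral_mul_partialD hf hg h (ψ := fun η => Real.sin (inner ℝ η q)) (B := 1 + ‖q‖)
    (Real.contDiff_sin.comp (contDiff_id.inner ℝ contDiff_const))
    (fun x => (Real.abs_sin_le_one _).trans hb) (fun x => by
      rw [hsin, abs_mul]
      exact (mul_le_mul (Real.abs_cos_le_one _) hqk (abs_nonneg _) zero_le_one).trans_eq (one_mul _))
  have hsplit : ∀ {f : E3 → ℂ}, Integrable f → charIntegral f q =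
      (∫ η, f η * ((Real.cos (inner ℝ η q) : ℝ) : ℂ)) +
        Complex.I * ∫ η, f η * ((Real.sin (inner ℝ η q) : ℝ) : ℂ) := by
    intro f hf
    have i1 : Integrable (fun η => f η * ((Real.cos (inner ℝ η q) : ℝ) : ℂ)) := by
      refine hf.mul_bdd (c := 1) (Continuous.aestronglyMeasurable (by fun_prop))
        (Eventually.of_forall fun x => ?_)
      rw [Complex.norm_real]; exact Real.abs_cos_le_one _
    have i2 : Integrable (fun η => f η * ((Real.sin (inner ℝ η q) : ℝ) : ℂ)) := by
      refine hf.mul_bdd (c := 1) (Continuous.aestronglyMeasurable (by fun_prop))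
        (Eventually.of_forall fun x => ?_)
      rw [Complex.norm_real]; exact Real.abs_sin_le_one _
    rw [charIntegral, ← integral_const_mul, ← integral_add i1 (i2.const_mul _)]
    refine integral_congr_ae (Eventually.of_forall fun η => ?_)
    simp only
    rw [mul_comm Complex.I, Complex.exp_mul_I, Complex.ofReal_cos, Complex.ofReal_sin]
    ring
  simp only [hcos, hsin, Complex.ofReal_neg, Complex.ofReal_mul, mul_neg, integral_neg, neg_inj,
    ← mul_assoc, integral_mul_const] at e1 e2
  rw [hsplit hf, hsplit hg, ← e1, ← neg_eq_iff_eq_neg.2 e2]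
  linear_combination ((∫ η, f η * ((Real.sin (inner ℝ η q) : ℝ) : ℂ)) * q k) * Complex.I_sq

end WeakDerivatives

section Inversion

theorem continuous_charIntegral {f : E3 → ℂ} (hf : Integrable f) : Continuous (charIntegral f) := by
  refine continuous_of_dominated (bound := fun η => ‖f η‖) (fun q => ?_) (fun q => ?_) hf.norm ?_
  · exact (Continuous.aestronglyMeasurable (by fun_prop)).mul hf.aestronglyMeasurable
  · refine Eventually.of_forall fun η => ?_
    rw [norm_mul, norm_cexp_I_mul, one_mul]
  · exact Eventually.of_forall fun η => by fun_prop

/-- Fourier inversion almost everywhere. -/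
theorem fourierInv_fourier_ae {f : E3 → ℂ} (hf : Integrable f) (h1 : Integrable (𝓕 f))
    (h2 : Integrable (𝓕⁻ (𝓕 f))) : 𝓕⁻ (𝓕 f) =ᵐ[volume] f := by
  have hc : Continuous (𝓕 f) := VectorFourier.fourierIntegral_continuous Real.continuous_fourierChar
    (by simp only [innerₗ_apply_apply]; fun_prop) hf
  -- Pointwise inversion requires continuity, which `𝓕 f` has although `f` need not; uniqueness of
  -- the transform then recovers `f` almost everywhere.
  have h3 : 𝓕 (𝓕⁻ (𝓕 f)) = 𝓕 f := by
    refine hc.fourier_fourierInv_eq h1 ?_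
    have : 𝓕 (𝓕 f) = fun x => 𝓕⁻ (𝓕 f) (-x) := by
      funext x
      rw [Real.fourierInv_eq_fourier_neg, neg_neg]
    rw [this]
    exact h2.comp_neg
  have h4 : (fun x => 𝓕⁻ (𝓕 f) x - f x) =ᵐ[volume] 0 := by
    refine ae_eq_zero_of_fourier (h2.sub hf) fun L => ?_
    obtain ⟨w, rfl⟩ := (InnerProductSpace.toDual ℝ E3).surjective L
    have hint : ∀ {g : E3 → ℂ}, Integrable g →
        Integrable fun x => Complex.exp (((InnerProductSpace.toDual ℝ E3 w) x : ℝ) * Complex.I) * g x :=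
      fun hg => hg.bdd_mul (c := 1) (Continuous.aestronglyMeasurable (by fun_prop))
        (Eventually.of_forall fun x => by rw [Complex.norm_exp_ofReal_mul_I])
    have hF : ∀ g : E3 → ℂ,
        ∫ x, Complex.exp (((InnerProductSpace.toDual ℝ E3 w) x : ℝ) * Complex.I) * g x =
        𝓕 g (-(2 * Real.pi)⁻¹ • w) := by
      intro g
      rw [Real.fourier_eq']
      refine integral_congr_ae (Eventually.of_forall fun x => ?_)
      simp only [smul_eq_mul]
      congr 3
      rw [InnerProductSpace.toDual_apply_apply, inner_smul_right, real_inner_comm]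
      have := Real.pi_ne_zero
      push_cast
      field_simp
    simp only [mul_sub]
    rw [integral_sub (hint h2) (hint hf), hF, hF, h3, sub_self]
  filter_upwards [h4] with x hx
  exact sub_eq_zero.1 hx

theorem fourier_ofReal_eq (V : E3 → ℝ) (x : E3) :
    (((2 * Real.pi) ^ (-(3 / 2) : ℝ) : ℝ) : ℂ) * 𝓕 (fun y => ((V y : ℝ) : ℂ)) x =
      fourierT V ((2 * Real.pi) • x) := by
  rw [Real.fourier_eq', fourierT]
  congr 1
  refine integral_congr_ae (Eventually.of_forall fun y => ?_)
  simp only [smul_eq_mul]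
  congr 2
  rw [real_inner_smul_left, real_inner_comm]
  push_cast
  ring

theorem charIntegral_fourierT_ae {V : E3 → ℝ} (hV : Integrable V) (h1 : Integrable (fourierT V))
    (h2 : Integrable (charIntegral (fourierT V))) :
    ∀ᵐ q, ((V q : ℝ) : ℂ) =
      (((2 * Real.pi) ^ (-(3 / 2) : ℝ) : ℝ) : ℂ) * charIntegral (fourierT V) q := by
  set κ : ℝ := (2 * Real.pi) ^ (-(3 / 2) : ℝ) with hκ
  have h2p : (0 : ℝ) < 2 * Real.pi := by positivity
  have hκ0 : 0 < κ := by positivity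
  have hκC : (κ : ℂ) ≠ 0 := by exact_mod_cast hκ0.ne'
  -- The two normalizing constants together are the Jacobian of the substitution by `2π` between the
  -- two Fourier conventions.
  have hκ2 : κ * κ = ((2 * Real.pi) ^ 3)⁻¹ := by
    rw [hκ, ← Real.rpow_add h2p, ← Real.rpow_natCast, ← Real.rpow_neg h2p.le]
    norm_num
  have hF : 𝓕 (fun y => ((V y : ℝ) : ℂ)) = fun x => (κ : ℂ)⁻¹ * fourierT V ((2 * Real.pi) • x) := by
    funext x
    rw [← fourier_ofReal_eq, ← mul_assoc, inv_mul_cancel₀ hκC, one_mul]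
  have hinv : 𝓕⁻ (𝓕 (fun y => ((V y : ℝ) : ℂ))) = fun q => (κ : ℂ) * charIntegral (fourierT V) q := by
    funext q
    rw [hF, Real.fourierInv_eq', charIntegral]
    have e := Measure.integral_comp_smul_of_nonneg (volume : Measure E3)
      (fun η : E3 => Complex.exp (Complex.I * ((inner ℝ η q : ℝ) : ℂ)) * fourierT V η)
      (2 * Real.pi) (hR := h2p.le)
    have e2 : ∫ v : E3, Complex.exp (((2 * Real.pi * inner ℝ v q : ℝ) : ℂ) * Complex.I) •
        ((κ : ℂ)⁻¹ * fourierT V ((2 * Real.pi) • v)) = (κ : ℂ)⁻¹ *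
        ∫ x : E3, Complex.exp (Complex.I * ((inner ℝ ((2 * Real.pi) • x) q : ℝ) : ℂ)) *
          fourierT V ((2 * Real.pi) • x) := by
      rw [← integral_const_mul]
      refine integral_congr_ae (Eventually.of_forall fun v => ?_)
      simp only [smul_eq_mul]
      rw [real_inner_smul_left, mul_comm Complex.I]
      ring
    rw [e2, e, finrank_euclideanSpace_fin, Complex.real_smul, ← mul_assoc, ← hκ2]
    congr 1
    push_cast
    field_simp
  have hi : Integrable (𝓕 (fun y => ((V y : ℝ) : ℂ))) := by
    rw [hF]
    exact (h1.comp_smul h2p.ne').const_mul _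
  have hVc : Integrable (fun y => ((V y : ℝ) : ℂ)) := hV.ofReal
  have h3 := fourierInv_fourier_ae hVc hi (by rw [hinv]; exact h2.const_mul _)
  filter_upwards [h3] with q hq
  rw [← hq, hinv]

end Inversion

end

/-! ### Decay of the potential from the weighted Sobolev norm of its transform. -/

section

section SobolevDecay

theorem weight_four (x : E3) : weight 4 x = (1 + ‖x‖ ^ 2) ^ 2 := by
  rw [weight, ← Real.rpow_natCast]
  norm_num

theorem single_mem_multiIndices {n m : ℕ} (hm : m ≤ n) (k : Fin 3) :
    Pi.single k m ∈ multiIndices n := by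
  rw [multiIndices, Finset.mem_filter, Fintype.mem_piFinset]
  refine ⟨fun i => ?_, ?_⟩
  · rw [Finset.mem_range, Pi.single_apply]
    split_ifs <;> omega
  · rw [Finset.sum_pi_single']
    simpa using hm

theorem multiD_single (k : Fin 3) (m : ℕ) (φ : E3 → ℝ) :
    multiD (Pi.single k m) φ = (partialD k)^[m] φ := by
  fin_cases k <;> simp [multiD]

theorem hasWeakDeriv_weakDeriv {α : Fin 3 → ℕ} {f : E3 → ℂ} (h : ∃ g, HasWeakDeriv α f g) :
    HasWeakDeriv α f (weakDeriv α f) := by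
  rw [weakDeriv, dif_pos h]
  exact h.choose_spec

theorem weightedSobolevNorm_nonneg (n : ℕ) (s : ℝ) (f : E3 → ℂ) :
    0 ≤ weightedSobolevNorm n s f := by
  refine Finset.sum_nonneg fun α _ => integral_nonneg fun x => ?_
  have : 0 ≤ weight s x := by unfold weight; positivity
  positivity

theorem contDiff_partialD {φ : E3 → ℝ} (hφ : ContDiff ℝ ∞ φ) (k : Fin 3) :
    ContDiff ℝ ∞ (partialD k φ) :=
  (hφ.fderiv_right (m := ∞) (by simp)).clm_apply contDiff_const

theorem hasCompactSupport_partialD {φ : E3 → ℝ} (hφ : HasCompactSupport φ) (k : Fin 3) :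
    HasCompactSupport (partialD k φ) :=
  (hφ.fderiv (𝕜 := ℝ)).comp_left (g := fun L : E3 →L[ℝ] ℝ => L (EuclideanSpace.single k 1)) (by simp)

variable {f : E3 → ℂ}

/-- The weak derivative `∂ₖᵐ f`. -/
def pureDeriv (f : E3 → ℂ) (k : Fin 3) (m : ℕ) : E3 → ℂ := weakDeriv (Pi.single k m) f

theorem aestronglyMeasurable_pureDeriv (hf : MemWeightedSobolev 4 4 f) (k : Fin 3) {m : ℕ}
    (hm : m ≤ 4) : AEStronglyMeasurable (pureDeriv f k m) volume :=
  (hasWeakDeriv_weakDeriv (hf _ (single_mem_multiIndices hm k)).1).2.1.aestronglyMeasurable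

theorem integrable_weight_pureDeriv (hf : MemWeightedSobolev 4 4 f) (k : Fin 3) {m : ℕ}
    (hm : m ≤ 4) : Integrable (fun x => (1 + ‖x‖ ^ 2) ^ 2 * ‖pureDeriv f k m x‖) := by
  have := (hf _ (single_mem_multiIndices hm k)).2
  simpa only [weight_four, pureDeriv] using this

theorem integral_weight_pureDeriv_le (f : E3 → ℂ) (k : Fin 3) {m : ℕ} (hm : m ≤ 4) :
    ∫ x, (1 + ‖x‖ ^ 2) ^ 2 * ‖pureDeriv f k m x‖ ≤ weightedSobolevNorm 4 4 f := by
  have h1 := Finset.single_le_sum (f := fun α => ∫ x, weight 4 x * ‖weakDeriv α f x‖)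
    (fun α _ => integral_nonneg fun x => by
      have : 0 ≤ weight 4 x := by unfold weight; positivity
      positivity) (single_mem_multiIndices hm k)
  simpa only [weight_four, pureDeriv, weightedSobolevNorm] using h1

theorem one_le_weight (x : E3) : 1 ≤ (1 + ‖x‖ ^ 2) ^ 2 :=
  one_le_pow₀ (by linarith [sq_nonneg ‖x‖])

theorem integrable_pureDeriv (hf : MemWeightedSobolev 4 4 f) (k : Fin 3) {m : ℕ}
    (hm : m ≤ 4) : Integrable (pureDeriv f k m) := by
  refine (integrable_weight_pureDeriv hf k hm).mono' (aestronglyMeasurable_pureDeriv hf k hm)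
    (Eventually.of_forall fun x => ?_)
  exact le_mul_of_one_le_left (norm_nonneg _) (one_le_weight x)

theorem integral_norm_pureDeriv_le (hf : MemWeightedSobolev 4 4 f) (k : Fin 3) {m : ℕ}
    (hm : m ≤ 4) : ∫ x, ‖pureDeriv f k m x‖ ≤ weightedSobolevNorm 4 4 f := by
  refine le_trans ?_ (integral_weight_pureDeriv_le f k hm)
  exact integral_mono (integrable_pureDeriv hf k hm).norm (integrable_weight_pureDeriv hf k hm)
    fun x => le_mul_of_one_le_left (norm_nonneg _) (one_le_weight x)

/-- Even the derivative of order zero is chosen arbitrarily; testing determines it up to null sets.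
-/
theorem pureDeriv_zero_ae (hf : MemWeightedSobolev 4 4 f) (k : Fin 3) :
    pureDeriv f k 0 =ᵐ[volume] f := by
  obtain ⟨h1, h2, h3⟩ := hasWeakDeriv_weakDeriv (hf _ (single_mem_multiIndices (Nat.zero_le 4) k)).1
  refine ae_eq_of_integral_contDiff_smul_eq h2 h1 fun φ hφ hs => ?_
  have h4 := h3 φ hφ hs
  rw [multiD_single] at h4
  simp only [Pi.single_zero, Pi.zero_apply, Finset.sum_const_zero, pow_zero, one_mul,
    Function.iterate_zero, id] at h4
  simp only [Complex.real_smul, mul_comm, pureDeriv, Pi.single_zero] at h4 ⊢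
  exact h4.symm

/-- Each weak derivative refers to `f` itself. Testing the `m`-th one with `∂ₖ φ` and the next one
with `φ` involves the same derivative of `φ`, so the chosen representatives are derivatives of one
another. -/
theorem integral_pureDeriv_mul_partialD (hf : MemWeightedSobolev 4 4 f) (k : Fin 3) {m : ℕ}
    (hm : m + 1 ≤ 4) {φ : E3 → ℝ} (hφ : ContDiff ℝ ∞ φ) (hs : HasCompactSupport φ) :
    ∫ x, pureDeriv f k m x * ((partialD k φ x : ℝ) : ℂ) =
      -∫ x, pureDeriv f k (m + 1) x * ((φ x : ℝ) : ℂ) := by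
  obtain ⟨-, -, h3⟩ := hasWeakDeriv_weakDeriv
    (hf _ (single_mem_multiIndices ((Nat.le_succ m).trans hm) k)).1
  obtain ⟨-, -, h4⟩ := hasWeakDeriv_weakDeriv (hf _ (single_mem_multiIndices hm k)).1
  have e3 := h3 _ (contDiff_partialD hφ k) (hasCompactSupport_partialD hs k)
  have e4 := h4 _ hφ hs
  rw [multiD_single, Finset.sum_pi_single'] at e3 e4
  rw [Function.iterate_succ_apply] at e4
  rw [e4] at e3
  simp only [Finset.mem_univ, if_true, pow_succ, mul_neg, mul_one, neg_mul] at e3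
  have h5 : ((-1 : ℂ) ^ m) ≠ 0 := by simp
  rw [← mul_neg] at e3
  exact (mul_left_cancel₀ h5 e3).symm

theorem charIntegral_pureDeriv (hf : MemWeightedSobolev 4 4 f) (k : Fin 3) {m : ℕ} (hm : m ≤ 4)
    (q : E3) : charIntegral (pureDeriv f k m) q = (-Complex.I * q k) ^ m * charIntegral f q := by
  induction m with
  | zero =>
    rw [pow_zero, one_mul]
    refine integral_congr_ae ?_
    filter_upwards [pureDeriv_zero_ae hf k] with x hx
    rw [hx]
  | succ m ih =>
    rw [charIntegral_deriv (integrable_pureDeriv hf k ((Nat.le_succ m).trans hm))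
      (integrable_pureDeriv hf k hm)
      (fun φ hφ hs => integral_pureDeriv_mul_partialD hf k hm hφ hs),
      ih ((Nat.le_succ m).trans hm), pow_succ]
    ring

/-- Four pure derivatives give `|q k|⁴`. By Cauchy-Schwarz `(1 + |q|²)²` is at most four times the
sum of `1` and the three fourth powers, and each of these four terms costs one Sobolev norm, hence
`16`. -/
theorem norm_charIntegral_sobolev_le (hf : MemWeightedSobolev 4 4 f) (q : E3) :
    (1 + ‖q‖ ^ 2) ^ 2 * ‖charIntegral f q‖ ≤ 16 * weightedSobolevNorm 4 4 f := by
  have h1 : ∀ (k : Fin 3) (m : ℕ), m ≤ 4 → |q k| ^ m * ‖charIntegral f q‖ ≤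
      weightedSobolevNorm 4 4 f := by
    intro k m hm
    have := (norm_charIntegral_le (pureDeriv f k m) q).trans (integral_norm_pureDeriv_le hf k hm)
    rw [charIntegral_pureDeriv hf k hm, norm_mul, norm_pow, norm_mul, norm_neg, Complex.norm_I,
      one_mul, Complex.norm_real] at this
    exact this
  have h0 := h1 0 0 (by norm_num)
  have ha := h1 0 4 le_rfl
  have hb := h1 1 4 le_rfl
  have hc := h1 2 4 le_rfl
  have e : ∀ x : ℝ, |x| ^ 4 = (x ^ 2) ^ 2 := fun x => by
    rw [← sq_abs x]; ring
  rw [e] at ha hb hc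
  rw [pow_zero, one_mul] at h0
  have hq : ‖q‖ ^ 2 = q 0 ^ 2 + q 1 ^ 2 + q 2 ^ 2 := by
    rw [EuclideanSpace.norm_sq_eq, Fin.sum_univ_three]
    simp
  have h2 : (1 + ‖q‖ ^ 2) ^ 2 ≤ 4 * (1 + (q 0 ^ 2) ^ 2 + (q 1 ^ 2) ^ 2 + (q 2 ^ 2) ^ 2) := by
    rw [hq]
    nlinarith [sq_nonneg (1 - q 0 ^ 2), sq_nonneg (1 - q 1 ^ 2), sq_nonneg (1 - q 2 ^ 2),
      sq_nonneg (q 0 ^ 2 - q 1 ^ 2), sq_nonneg (q 0 ^ 2 - q 2 ^ 2), sq_nonneg (q 1 ^ 2 - q 2 ^ 2)]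
  have h3 := mul_le_mul_of_nonneg_right h2 (norm_nonneg (charIntegral f q))
  linarith

theorem integrable_charIntegral (hf : MemWeightedSobolev 4 4 f) (hfi : Integrable f) :
    Integrable (charIntegral f) := by
  have h1 : Integrable (fun x : E3 => ((1 : ℝ) + ‖x‖ ^ 2) ^ (-4 / 2 : ℝ)) volume :=
    integrable_rpow_neg_one_add_norm_sq (by rw [finrank_euclideanSpace_fin]; norm_num)
  refine (h1.const_mul (16 * weightedSobolevNorm 4 4 f)).mono'
    (continuous_charIntegral hfi).aestronglyMeasurable (Eventually.of_forall fun q => ?_)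
  have h2 := norm_charIntegral_sobolev_le hf q
  have h3 : ((1 : ℝ) + ‖q‖ ^ 2) ^ (-4 / 2 : ℝ) = ((1 + ‖q‖ ^ 2) ^ 2)⁻¹ := by
    rw [← Real.rpow_natCast (1 + ‖q‖ ^ 2) 2, ← Real.rpow_neg (by positivity)]
    norm_num
  rw [h3, ← div_eq_mul_inv, le_div_iff₀ (by positivity), mul_comm]
  exact h2

variable {V : E3 → ℝ}

theorem integrable_fourierT (hS : MemWeightedSobolev 4 4 (fourierT V)) :
    Integrable (fourierT V) :=
  (integrable_pureDeriv hS 0 (Nat.zero_le 4)).congr (pureDeriv_zero_ae hS 0)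

/-- The constant `(2π)^{-3/2}`. -/
def fourierConst : ℝ := (2 * Real.pi) ^ (-(3 / 2) : ℝ)

theorem fourierConst_nonneg : 0 ≤ fourierConst := by unfold fourierConst; positivity

theorem fourierConst_le_one : fourierConst ≤ 1 := by
  refine Real.rpow_le_one_of_one_le_of_nonpos ?_ (by norm_num)
  linarith [Real.pi_gt_three]

theorem potential_eq_charIntegral (hV : Integrable V) (hS : MemWeightedSobolev 4 4 (fourierT V)) :
    ∀ᵐ q, ((V q : ℝ) : ℂ) = fourierConst * charIntegral (fourierT V) q :=
  charIntegral_fourierT_ae hV (integrable_fourierT hS)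
    (integrable_charIntegral hS (integrable_fourierT hS))

/-- Multiplication of the potential by powers of a coordinate. -/
theorem pow_mul_potential_eq (hV : Integrable V) (hS : MemWeightedSobolev 4 4 (fourierT V)) :
    ∀ᵐ q : E3, ∀ k : Fin 3, ∀ m ≤ 4, (((q k) ^ m : ℝ) : ℂ) * ((V q : ℝ) : ℂ) =
      fourierConst * (Complex.I ^ m * charIntegral (pureDeriv (fourierT V) k m) q) := by
  filter_upwards [potential_eq_charIntegral hV hS] with q hq k m hm
  have h1 : Complex.I * (-Complex.I * (q k : ℂ)) = q k := by
    linear_combination (-(q k : ℂ)) * Complex.I_sq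
  rw [hq, charIntegral_pureDeriv hS k hm, ← mul_assoc (Complex.I ^ m), ← mul_pow, h1]
  push_cast
  ring

theorem abs_potential_le (hV : Integrable V) (hS : MemWeightedSobolev 4 4 (fourierT V)) :
    ∀ᵐ q : E3, (1 + ‖q‖ ^ 2) ^ 2 * |V q| ≤ 16 * weightedSobolevNorm 4 4 (fourierT V) := by
  filter_upwards [potential_eq_charIntegral hV hS] with q hq
  have h1 := norm_charIntegral_sobolev_le hS q
  have h2 : |V q| ≤ ‖charIntegral (fourierT V) q‖ := by
    rw [← Real.norm_eq_abs, ← Complex.norm_real, hq, norm_mul, Complex.norm_real, Real.norm_eq_abs,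
      abs_of_nonneg fourierConst_nonneg]
    exact mul_le_of_le_one_left (norm_nonneg _) fourierConst_le_one
  refine le_trans ?_ h1
  gcongr

theorem supNorm_le (hV : Integrable V) (hS : MemWeightedSobolev 4 4 (fourierT V)) :
    supNorm V ≤ 16 * weightedSobolevNorm 4 4 (fourierT V) ∧ ∀ᵐ q, ‖V q‖ ≤ supNorm V := by
  have h1 : ∀ᵐ q : E3, ‖V q‖ ≤ 16 * weightedSobolevNorm 4 4 (fourierT V) := by
    filter_upwards [abs_potential_le hV hS] with q hq
    exact (le_mul_of_one_le_left (norm_nonneg _) (one_le_weight q)).trans hq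
  have h0 : 0 ≤ 16 * weightedSobolevNorm 4 4 (fourierT V) :=
    mul_nonneg (by norm_num) (weightedSobolevNorm_nonneg _ _ _)
  have h2 := eLpNorm_le_of_ae_bound (p := ⊤) h1
  simp only [ENNReal.toReal_top, inv_zero, ENNReal.rpow_zero, one_mul] at h2
  have h3 : eLpNorm V ⊤ volume ≠ ⊤ := ne_top_of_le_ne_top ENNReal.ofReal_ne_top h2
  refine ⟨ENNReal.toReal_le_of_le_ofReal h0 h2, ?_⟩
  filter_upwards [enorm_ae_le_eLpNormEssSup V volume] with q hq
  rw [← eLpNorm_exponent_top] at hq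
  rw [supNorm, ← ofReal_norm] at *
  exact (ENNReal.ofReal_le_iff_le_toReal h3).1 hq

end SobolevDecay

end

/-! ### Bounded operators on superpositions of states. -/

section

section Superposition

variable {N : ℕ}

theorem norm_sq_eq_integral (Ψ : L2 N) : ‖Ψ‖ ^ 2 = ∫ X, ‖(Ψ : Config N → ℂ) X‖ ^ 2 := by
  rw [← inner_self_eq_norm_sq (𝕜 := ℂ), MeasureTheory.L2.inner_def, ← integral_re]
  · refine integral_congr_ae (Eventually.of_forall fun X => ?_)
    exact inner_self_eq_norm_sq (𝕜 := ℂ) _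
  · exact MeasureTheory.L2.integrable_inner Ψ Ψ

theorem integral_norm_mul_norm_le (Ψ Φ : L2 N) :
    ∫ X, ‖(Ψ : Config N → ℂ) X‖ * ‖(Φ : Config N → ℂ) X‖ ≤ ‖Ψ‖ * ‖Φ‖ := by
  have h1 := integral_mul_norm_le_Lp_mul_Lq (μ := (volume : Measure (Config N)))
    (f := (Ψ : Config N → ℂ)) (g := (Φ : Config N → ℂ)) (p := 2) (q := 2)
    Real.HolderConjugate.two_two (by simpa using Lp.memLp Ψ) (by simpa using Lp.memLp Φ)
  have h2 : ∀ Ψ : L2 N, (∫ X, ‖(Ψ : Config N → ℂ) X‖ ^ (2 : ℝ)) ^ (1 / 2 : ℝ) = ‖Ψ‖ := fun Ψ => by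
    simp only [Real.rpow_two, ← norm_sq_eq_integral]
    rw [← Real.sqrt_eq_rpow, Real.sqrt_sq (norm_nonneg _)]
  rwa [h2, h2] at h1

/-- A bounded operator applied to a superposition. -/
theorem norm_apply_le_integral {Y : Type*} [MeasurableSpace Y] {ν : Measure Y} [SFinite ν]
    (T : L2 N →L[ℂ] L2 N) {F : Y → Config N → ℂ} {Φ : Y → L2 N} {Ψ : L2 N}
    (hF : AEStronglyMeasurable (fun z : Y × Config N => F z.1 z.2) (ν.prod volume))
    (hΦ : ∀ y, (Φ y : Config N → ℂ) =ᵐ[volume] F y)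
    (hΨ : (Ψ : Config N → ℂ) =ᵐ[volume] fun X => ∫ y, F y X ∂ν)
    {B : Y → ℝ} (hB : Integrable B ν) (hΦB : ∀ y, ‖Φ y‖ ≤ B y)
    {g : Y → ℝ} (hg : Integrable g ν) (hT : ∀ y, ‖T (Φ y)‖ ≤ g y) : ‖T Ψ‖ ≤ ∫ y, g y ∂ν := by
  have hg0 : 0 ≤ ∫ y, g y ∂ν := integral_nonneg fun y => (norm_nonneg _).trans (hT y)
  have key : ∀ h : L2 N, inner ℂ h (T Ψ) = ∫ y, inner ℂ h (T (Φ y)) ∂ν := by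
    intro h
    -- The superposition is an integral of representatives, not a Bochner integral in `L²`. Moving
    -- `T` to the test vector reduces the claim to Fubini's theorem for a scalar double integral.
    set k := T.adjoint h with hk
    have e1 : ∀ x, inner ℂ h (T x) = inner ℂ k x := fun x => by
      rw [hk, ContinuousLinearMap.adjoint_inner_left]
    simp only [e1, MeasureTheory.L2.inner_def, RCLike.inner_apply]
    have hkm : AEStronglyMeasurable (fun z : Y × Config N =>
        (starRingEnd ℂ) ((k : Config N → ℂ) z.2)) (ν.prod volume) :=
      (RCLike.continuous_conj.comp_aestronglyMeasurable (Lp.aestronglyMeasurable k)).comp_snd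
    have hmeas : AEStronglyMeasurable (fun z : Y × Config N =>
        F z.1 z.2 * (starRingEnd ℂ) ((k : Config N → ℂ) z.2)) (ν.prod volume) := hF.mul hkm
    have hi : ∀ y, Integrable (fun X => F y X * (starRingEnd ℂ) ((k : Config N → ℂ) X)) := by
      intro y
      have h1 := MeasureTheory.L2.integrable_inner (𝕜 := ℂ) k (Φ y)
      refine h1.congr ?_
      filter_upwards [hΦ y] with X hX
      rw [RCLike.inner_apply, hX]
    have hint : Integrable (fun z : Y × Config N =>
        F z.1 z.2 * (starRingEnd ℂ) ((k : Config N → ℂ) z.2)) (ν.prod volume) := by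
      rw [integrable_prod_iff hmeas]
      refine ⟨Eventually.of_forall hi, ?_⟩
      refine (hB.mul_const ‖k‖).mono' hmeas.norm.integral_prod_right' (Eventually.of_forall fun y => ?_)
      rw [Real.norm_of_nonneg (integral_nonneg fun X => norm_nonneg _)]
      have h1 := integral_norm_mul_norm_le (Φ y) k
      have h2 : ∫ X, ‖F y X * (starRingEnd ℂ) ((k : Config N → ℂ) X)‖ =
          ∫ X, ‖(Φ y : Config N → ℂ) X‖ * ‖(k : Config N → ℂ) X‖ := by
        refine integral_congr_ae ?_
        filter_upwards [hΦ y] with X hX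
        rw [norm_mul, RCLike.norm_conj, hX]
      rw [h2]
      exact h1.trans (mul_le_mul_of_nonneg_right (hΦB y) (norm_nonneg _))
    have e2 : ∫ X, (Ψ : Config N → ℂ) X * (starRingEnd ℂ) ((k : Config N → ℂ) X) =
        ∫ X, ∫ y, F y X * (starRingEnd ℂ) ((k : Config N → ℂ) X) ∂ν := by
      refine integral_congr_ae ?_
      filter_upwards [hΨ] with X hX
      rw [hX, integral_mul_const]
    have e3 : ∀ y, ∫ X, (Φ y : Config N → ℂ) X * (starRingEnd ℂ) ((k : Config N → ℂ) X) =
        ∫ X, F y X * (starRingEnd ℂ) ((k : Config N → ℂ) X) := fun y => by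
      refine integral_congr_ae ?_
      filter_upwards [hΦ y] with X hX
      rw [hX]
    rw [e2]
    simp only [e3]
    exact (integral_integral_swap hint).symm
  have h1 := key (T Ψ)
  have h2 : ‖T Ψ‖ * ‖T Ψ‖ ≤ ‖T Ψ‖ * ∫ y, g y ∂ν := by
    have h3 : ‖inner ℂ (T Ψ) (T Ψ)‖ = ‖T Ψ‖ * ‖T Ψ‖ := by
      rw [inner_self_eq_norm_sq_to_K]
      simp [sq]
    rw [← h3, h1, ← integral_const_mul]
    refine norm_integral_le_of_norm_le (hg.const_mul _) (Eventually.of_forall fun y => ?_)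
    exact (norm_inner_le_norm _ _).trans (mul_le_mul_of_nonneg_left (hT y) (norm_nonneg _))
  rcases (norm_nonneg (T Ψ)).eq_or_lt with h0 | h0
  · rw [← h0]; exact hg0
  · exact le_of_mul_le_mul_left h2 h0

end Superposition

end

/-! ### Cauchy's formula and momentum kicks of wave packets. -/

section

open scoped Real in
/-- Cauchy's formula for the Taylor coefficients of the exponential. -/
theorem pow_eq_integral (w : ℂ) (m : ℕ) : w ^ m = (m.factorial / (2 * π) : ℂ) *
    ∫ θ in (0 : ℝ)..2 * π, Complex.exp (-(Complex.I * m * θ)) *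
      Complex.exp (Complex.exp (Complex.I * θ) * w) := by
  have hd : Differentiable ℂ (fun z : ℂ => Complex.exp (w * z)) := by fun_prop
  -- Apply Cauchy's formula on the unit circle to `z ↦ exp (w z)`, whose `m`-th derivative at `0` is
  -- `w ^ m`.
  have h1 := (hd.hasFPowerSeriesOnBall 0 (R := 1) one_pos).factorial_smul 1 m
  rw [← iteratedDeriv_eq_iteratedFDeriv, iteratedDeriv_cexp_const_mul, cauchyPowerSeries_apply] at h1
  simp only [mul_zero, Complex.exp_zero, mul_one] at h1
  rw [← h1, circleIntegral_def_Icc, intervalIntegral.integral_of_le (by positivity),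
    ← integral_Icc_eq_integral_Ioc, nsmul_eq_mul, smul_eq_mul]
  have hp : (π : ℂ) ≠ 0 := by exact_mod_cast Real.pi_ne_zero
  have e : ∀ θ : ℝ, deriv (circleMap 0 ((1 : NNReal) : ℝ)) θ •
      ((1 / (circleMap 0 ((1 : NNReal) : ℝ) θ - 0)) ^ m •
        (circleMap 0 ((1 : NNReal) : ℝ) θ - 0)⁻¹ •
          Complex.exp (w * circleMap 0 ((1 : NNReal) : ℝ) θ)) =
      Complex.I * (Complex.exp (-(Complex.I * m * θ)) *
      Complex.exp (Complex.exp (Complex.I * θ) * w)) := by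
    intro θ
    have hc : circleMap 0 ((1 : NNReal) : ℝ) θ = Complex.exp (Complex.I * θ) := by
      simp [circleMap, mul_comm]
    have h0 : Complex.exp (Complex.I * θ) ≠ 0 := Complex.exp_ne_zero _
    have hm : Complex.exp (-(Complex.I * m * θ)) = (Complex.exp (Complex.I * θ))⁻¹ ^ m := by
      rw [← Complex.exp_neg, ← Complex.exp_nat_mul]
      congr 1; ring
    rw [deriv_circleMap, hc, hm]
    simp only [sub_zero, smul_eq_mul, one_div]
    rw [mul_comm w]
    field_simp
  simp only [e]
  rw [integral_const_mul, ← mul_assoc, ← mul_assoc]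
  congr 1
  field_simp

variable {N : ℕ}

section Kick

/-- The linear coefficient at time `t` is `b / (1 + it)`, so the initial parameter has to change by
`(1 + it) d`. Only a constant is left over. -/
theorem exists_freeExp_add (ε t : ℝ) (b d : Fin 3 → ℂ) : ∃ c : ℂ, ∀ R,
    freeExp ε t (fun k => b k + (1 + Complex.I * t) * d k) R + c =
      freeExp ε t b R + cdot d R := by
  refine ⟨Complex.I * ε ^ 2 / 2 * (∑ k, b k ^ 2) * (t / (1 + Complex.I * t)) -
    Complex.I * ε ^ 2 / 2 * (∑ k, (b k + (1 + Complex.I * t) * d k) ^ 2) * (t / (1 + Complex.I * t)),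
    fun R => ?_⟩
  have h0 := one_add_I_mul_ne_zero t
  have h1 : cdot (fun k => (b k + (1 + Complex.I * t) * d k) / (1 + Complex.I * t)) R =
      cdot (fun k => b k / (1 + Complex.I * t)) R + cdot d R := by
    simp only [cdot, ← Finset.sum_add_distrib]
    refine Finset.sum_congr rfl fun k _ => ?_
    field_simp
  rw [freeExp, freeExp, quadExp, quadExp, h1]
  ring

theorem exists_oscExp_add (ε t : ℝ) (z d : Fin 3 → ℂ) : ∃ c : ℂ, ∀ y,
    oscExp ε t (fun k => z k + Complex.exp (Complex.I * t / ε) * d k) y + c =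
      oscExp ε t z y + cdot d y := by
  refine ⟨ε ^ 2 / 4 * (∑ k, z k ^ 2) * (1 - Complex.exp (-(Complex.I * t / ε)) ^ 2) -
    ε ^ 2 / 4 * (∑ k, (z k + Complex.exp (Complex.I * t / ε) * d k) ^ 2) *
      (1 - Complex.exp (-(Complex.I * t / ε)) ^ 2), fun y => ?_⟩
  have h1 : cdot (fun k => Complex.exp (-(Complex.I * t / ε)) *
      (z k + Complex.exp (Complex.I * t / ε) * d k)) y =
      cdot (fun k => Complex.exp (-(Complex.I * t / ε)) * z k) y + cdot d y := by
    simp only [cdot, ← Finset.sum_add_distrib]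
    refine Finset.sum_congr rfl fun k _ => ?_
    rw [mul_add, ← mul_assoc, ← Complex.exp_add]
    simp [add_mul]
  rw [oscExp, oscExp, quadExp, quadExp, h1]
  ring

/-- The parameters of a wave packet after multiplication, at time `σ`, with `e^{i w·q}`, where `q`
is the scaled distance vector between the test particle and the `j`-th oscillator. -/
def kick (ε σ : ℝ) (j : Fin N) (w : Fin 3 → ℂ) (p : Params N) : Params N :=
  (fun k => p.1 k + (1 + Complex.I * σ) * (Complex.I * w k / ε),
    Function.update p.2 j
      (fun k => p.2 j k + Complex.exp (Complex.I * σ / ε) * (-(Complex.I * w k / ε))))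

theorem exists_packetExp_kick (ε σ : ℝ) (a : Fin N → E3) (j : Fin N) (w : Fin 3 → ℂ)
    (p : Params N) : ∃ c : ℂ, ∀ X, packetExp ε a σ (kick ε σ j w p) X + c =
      packetExp ε a σ p X + Complex.I * cdot w (relPos ε j X) := by
  obtain ⟨c₁, h1⟩ := exists_freeExp_add ε σ p.1 (fun k => Complex.I * w k / ε)
  obtain ⟨c₂, h2⟩ := exists_oscExp_add ε σ (p.2 j) (fun k => -(Complex.I * w k / ε))
  refine ⟨c₁ + c₂ - cdot (fun k => Complex.I * w k / ε) (a j), fun X => ?_⟩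
  have h3 : Complex.I * cdot w (relPos ε j X) = cdot (fun k => Complex.I * w k / ε) X.1 +
      cdot (fun k => -(Complex.I * w k / ε)) (X.2 j - a j) -
      cdot (fun k => Complex.I * w k / ε) (a j) := by
    simp only [cdot, Finset.mul_sum, ← Finset.sum_add_distrib, ← Finset.sum_sub_distrib]
    refine Finset.sum_congr rfl fun k _ => ?_
    simp only [relPos, PiLp.smul_apply, PiLp.sub_apply, smul_eq_mul]
    push_cast
    ring
  rw [h3, packetExp, packetExp, ← Finset.add_sum_erase _ _ (Finset.mem_univ j),
    ← Finset.add_sum_erase (a := j) Finset.univ (fun i => oscExp ε σ (p.2 i) (X.2 i - a i))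
      (Finset.mem_univ j)]
  have h4 : ∑ i ∈ Finset.univ.erase j, oscExp ε σ ((kick ε σ j w p).2 i) (X.2 i - a i) =
      ∑ i ∈ Finset.univ.erase j, oscExp ε σ (p.2 i) (X.2 i - a i) := by
    refine Finset.sum_congr rfl fun i hi => ?_
    simp only [kick]
    rw [Function.update_of_ne (Finset.ne_of_mem_erase hi)]
  rw [h4]
  have h5 := h1 X.1
  have h6 := h2 (X.2 j - a j)
  simp only [kick, Function.update_self] at h5 h6 ⊢
  linear_combination h5 + h6

/-- The wave packet with momentum `v₀ u / ε²`, with all oscillators in the ground state. -/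
def waveParams (ε v₀ : ℝ) (u : E3) : Params N :=
  (fun k => Complex.I * ((v₀ * u k / ε ^ 2 : ℝ) : ℂ), 0)

/-- The scaled distance at time `s` between a classical test particle and the point `x`. -/
def impact (ε v₀ : ℝ) (u x : E3) (s : ℝ) : E3 := ε⁻¹ • ((s * v₀) • u - x)

theorem waveParams_re (ε v₀ : ℝ) (u : E3) (k : Fin 3) :
    ((waveParams (N := N) ε v₀ u).1 k).re = 0 := by
  rw [waveParams, Complex.re_mul_ofReal, Complex.I_re, zero_mul]

theorem waveParams_im (ε v₀ : ℝ) (u : E3) (k : Fin 3) :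
    ((waveParams (N := N) ε v₀ u).1 k).im = v₀ * u k / ε ^ 2 := by
  rw [waveParams, Complex.im_mul_ofReal, Complex.I_im, one_mul]

theorem freeCenter_waveParams {ε : ℝ} (hε : 0 < ε) (v₀ s : ℝ) (u : E3) :
    freeCenter ε s (waveParams (N := N) ε v₀ u).1 = (s * v₀) • u := by
  ext k
  simp only [freeCenter, waveParams_re, waveParams_im, PiLp.smul_apply, smul_eq_mul]
  field_simp
  ring

theorem oscCenter_waveParams (ε v₀ s : ℝ) (u : E3) (j : Fin N) :
    oscCenter ε s ((waveParams ε v₀ u).2 j) = 0 := by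
  ext k
  simp [oscCenter, waveParams]

theorem packetMass_waveParams (ε v₀ : ℝ) (u : E3) : packetMass ε (waveParams (N := N) ε v₀ u) = 0 := by
  simp only [packetMass, waveParams_re]
  simp [waveParams]

/-- The complex momentum transfer `η - i e^{iθ} eₖ`. -/
def transfer (η : E3) (θ : ℝ) (k : Fin 3) : Fin 3 → ℂ :=
  fun l => (η l : ℂ) - if l = k then Complex.I * Complex.exp (Complex.I * θ) else 0

theorem I_mul_cdot_transfer (η : E3) (θ : ℝ) (k : Fin 3) (q : E3) :
    Complex.I * cdot (transfer η θ k) q =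
      Complex.I * ((inner ℝ η q : ℝ) : ℂ) + Complex.exp (Complex.I * θ) * q k := by
  have h1 : ((inner ℝ η q : ℝ) : ℂ) = ∑ l, (η l : ℂ) * q l := by
    rw [PiLp.inner_apply]
    push_cast
    refine Finset.sum_congr rfl fun l _ => ?_
    simp [mul_comm]
  rw [h1, cdot]
  simp only [transfer, sub_mul, Finset.sum_sub_distrib, ite_mul, zero_mul, Finset.sum_ite_eq',
    Finset.mem_univ, if_true]
  linear_combination (-(Complex.exp (Complex.I * θ) * q k)) * Complex.I_sq

/-- The wave packet after the momentum transfer. -/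
def kicked (ε v₀ : ℝ) (u : E3) (σ : ℝ) (j : Fin N) (η : E3) (θ : ℝ) (k : Fin 3) : Params N :=
  kick ε σ j (transfer η θ k) (waveParams ε v₀ u)

/-- Kicked states are multiples of packets, with a size bound uniform in `η`, `θ` and the direction
`u`. The height is independent of time apart from the spreading, so it may be computed at time `σ`,
where the modulus is that of the unkicked packet times `exp (cos θ · (q - A)ₖ)`. Young's inequality
absorbs this linear growth into the Gaussian; the kick in the real direction `η` does not change the
modulus. -/
theorem exists_kicked {ε : ℝ} (hε : 0 < ε) (v₀ : ℝ) (a : Fin N → E3) (u : E3) (σ : ℝ) (j : Fin N)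
    (η : E3) (θ : ℝ) (k : Fin 3) : ∃ c : ℂ,
    (∀ X, Complex.exp c * Complex.exp (packetExp ε a σ (kicked ε v₀ u σ j η θ k) X) =
      Complex.exp (Complex.I * ((inner ℝ η (relPos ε j X) : ℝ) : ℂ)) *
      Complex.exp (Complex.exp (Complex.I * θ) *
        ((relPos ε j X k - impact ε v₀ u (a j) σ k : ℝ) : ℂ)) *
        Complex.exp (packetExp ε a σ (waveParams ε v₀ u) X)) ∧
    ∀ s X, ‖Complex.exp c * Complex.exp (packetExp ε a s (kicked ε v₀ u σ j η θ k) X)‖ ≤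
      Real.exp ((2 + σ ^ 2) / 2) *
        Real.exp (-(‖X.1 - freeCenter ε s (kicked ε v₀ u σ j η θ k).1‖ ^ 2 /
          (2 * ε ^ 2 * (1 + s ^ 2))) -
          ∑ i, ‖X.2 i - (a i + oscCenter ε s ((kicked ε v₀ u σ j η θ k).2 i))‖ ^ 2 / (2 * ε ^ 2)) := by
  set p' : Params N := kicked ε v₀ u σ j η θ k with hp'
  obtain ⟨c₀, hc₀⟩ := exists_packetExp_kick ε σ a j (transfer η θ k) (waveParams ε v₀ u)
  rw [← kicked, ← hp'] at hc₀
  set A := impact ε v₀ u (a j) σ k with hA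
  set c : ℂ := c₀ - Complex.exp (Complex.I * θ) * A with hc
  have hX : ∀ X, packetExp ε a σ p' X + c = packetExp ε a σ (waveParams ε v₀ u) X +
      (Complex.I * ((inner ℝ η (relPos ε j X) : ℝ) : ℂ) + Complex.exp (Complex.I * θ) *
        ((relPos ε j X k - A : ℝ) : ℂ)) := fun X => by
    have := hc₀ X
    rw [I_mul_cdot_transfer] at this
    rw [hc]
    push_cast
    linear_combination this
  have hmass : packetMass ε p' + c.re ≤ (2 + σ ^ 2) / 2 := by
    -- At the centre of the kicked packet its own Gaussian terms vanish, which leaves the height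
    -- alone on the left-hand side.
    set X : Config N := (freeCenter ε σ p'.1, fun i => a i + oscCenter ε σ (p'.2 i)) with hXd
    have h1 := congrArg Complex.re (hX X)
    rw [Complex.add_re, re_packetExp hε, Complex.add_re, re_packetExp hε,
      freeCenter_waveParams hε, packetMass_waveParams] at h1
    simp only [oscCenter_waveParams, add_zero, hXd, sub_self, norm_zero, ne_eq, OfNat.ofNat_ne_zero,
      not_false_eq_true, zero_pow, zero_div, Finset.sum_const_zero, sub_zero] at h1
    rw [← hXd] at h1
    set r := relPos ε j X k - A with hr
    have h2 : (Complex.I * ((inner ℝ η (relPos ε j X) : ℝ) : ℂ) +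
        Complex.exp (Complex.I * θ) * (r : ℂ)).re = Real.cos θ * r := by
      rw [Complex.add_re, Complex.re_mul_ofReal, Complex.re_mul_ofReal, mul_comm Complex.I (θ : ℂ),
        Complex.exp_ofReal_mul_I_re, Complex.I_re, zero_mul, zero_add]
    rw [h2] at h1
    set x : ℝ := ε⁻¹ * (freeCenter ε σ p'.1 - (σ * v₀) • u) k with hx
    set y : ℝ := ε⁻¹ * (oscCenter ε σ (p'.2 j)) k with hy
    have hrxy : r = x - y := by
      rw [hr, hA, hx, hy, relPos, impact, hXd]
      simp only [PiLp.smul_apply, PiLp.sub_apply, PiLp.add_apply, smul_eq_mul]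
      ring
    have hsq : ∀ v : E3, (v k) ^ 2 ≤ ‖v‖ ^ 2 := fun v => by
      have := PiLp.norm_apply_le v k
      rw [Real.norm_eq_abs] at this
      rw [← sq_abs]
      gcongr
    have b1 : x ^ 2 / (2 * (1 + σ ^ 2)) ≤
        ‖freeCenter ε σ p'.1 - (σ * v₀) • u‖ ^ 2 / (2 * ε ^ 2 * (1 + σ ^ 2)) := by
      have e1 : x ^ 2 / (2 * (1 + σ ^ 2)) =
          ((freeCenter ε σ p'.1 - (σ * v₀) • u) k) ^ 2 / (2 * ε ^ 2 * (1 + σ ^ 2)) := by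
        rw [hx]; field_simp
      rw [e1]
      exact div_le_div_of_nonneg_right (hsq _) (by positivity)
    have b2 : y ^ 2 / 2 ≤ ∑ i, ‖a i + oscCenter ε σ (p'.2 i) - a i‖ ^ 2 / (2 * ε ^ 2) := by
      refine le_trans ?_ (Finset.single_le_sum (f := fun i =>
        ‖a i + oscCenter ε σ (p'.2 i) - a i‖ ^ 2 / (2 * ε ^ 2)) (fun i _ => by positivity)
        (Finset.mem_univ j))
      have e1 : y ^ 2 / 2 = ((oscCenter ε σ (p'.2 j)) k) ^ 2 / (2 * ε ^ 2) := by
        rw [hy]; field_simp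
      rw [e1]
      simp only [add_sub_cancel_left]
      exact div_le_div_of_nonneg_right (hsq _) (by positivity)
    have hcos : Real.cos θ ^ 2 ≤ 1 := Real.cos_sq_le_one θ
    have b3 : Real.cos θ * x ≤ x ^ 2 / (2 * (1 + σ ^ 2)) + (1 + σ ^ 2) / 2 := by
      have hp : 0 < 1 + σ ^ 2 := by positivity
      rw [div_add_div _ _ (by positivity) (by norm_num), le_div_iff₀ (by positivity)]
      nlinarith [sq_nonneg (x - (1 + σ ^ 2) * Real.cos θ), mul_le_mul_of_nonneg_left hcos
        (sq_nonneg (1 + σ ^ 2))]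
    have b4 : -(Real.cos θ * y) ≤ y ^ 2 / 2 + 1 / 2 := by
      nlinarith [sq_nonneg (y + Real.cos θ)]
    rw [hrxy, mul_sub] at h1
    linarith
  refine ⟨c, fun X => ?_, fun s X => ?_⟩
  · rw [← Complex.exp_add, add_comm c, hX, Complex.exp_add, Complex.exp_add]
    ring
  · rw [← Complex.exp_add, Complex.norm_exp, Complex.add_re, re_packetExp hε, ← Real.exp_add]
    refine Real.exp_le_exp.2 ?_
    have hlog : 0 ≤ Real.log (1 + s ^ 2) := Real.log_nonneg (by linarith [sq_nonneg s])
    linarith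

end Kick

end

/-! ### Gaussian localization and the centres of kicked packets. -/

section

variable {N : ℕ}

section Gaussian

/-- The `L²` norm of a Gaussian on configuration space. -/
def gaussNorm (N : ℕ) (κ : ℝ) : ℝ := Real.sqrt (∫ X : Config N, Real.exp (-(κ * ‖X‖ ^ 2)))

/-- The effect of scaling on the `L²` norm. -/
def scaleNorm (N : ℕ) (ε : ℝ) : ℝ := Real.sqrt (ε ^ (3 * N + 3))

theorem finrank_config (N : ℕ) : Module.finrank ℝ (Config N) = 3 * N + 3 := by
  simp [Module.finrank_prod, Module.finrank_pi_fintype]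
  ring

theorem integrable_exp_neg_sq {κ : ℝ} (hκ : 0 < κ) :
    Integrable (fun X : Config N => Real.exp (-(κ * ‖X‖ ^ 2))) := by
  have h1 := (memLp_pow_mul_exp (volume : Measure (Config N)) 0 0 (half_pos hκ)).integrable_sq
  refine h1.congr (Eventually.of_forall fun X => ?_)
  simp only [pow_zero, one_mul, zero_sub, ← Real.exp_nat_mul]
  congr 1
  push_cast
  ring

/-- A translation and a dilation by `ε` in dimension `3N + 3` turn the bound into a fixed Gaussian
integral. -/
theorem norm_le_of_gaussian_bound {ε κ D : ℝ} (hε : 0 < ε) (hκ : 0 < κ) (hD : 0 ≤ D)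
    (c : Config N) (Ψ : L2 N)
    (h : ∀ᵐ X, ‖(Ψ : Config N → ℂ) X‖ ≤ D * Real.exp (-(κ / 2 * ‖ε⁻¹ • (X - c)‖ ^ 2))) :
    ‖Ψ‖ ≤ D * (scaleNorm N ε * gaussNorm N κ) := by
  have hi := integrable_exp_neg_sq (N := N) hκ
  have hi2 : Integrable (fun X : Config N => Real.exp (-(κ * ‖ε⁻¹ • (X - c)‖ ^ 2))) :=
    (hi.comp_smul (inv_ne_zero hε.ne')).comp_sub_right c
  have h1 : ‖Ψ‖ ^ 2 ≤ (D * (scaleNorm N ε * gaussNorm N κ)) ^ 2 := by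
    have h2 : (D * (scaleNorm N ε * gaussNorm N κ)) ^ 2 =
        ∫ X : Config N, D ^ 2 * Real.exp (-(κ * ‖ε⁻¹ • (X - c)‖ ^ 2)) := by
      rw [integral_const_mul, integral_sub_right_eq_self
        (fun X : Config N => Real.exp (-(κ * ‖ε⁻¹ • X‖ ^ 2))) c,
        Measure.integral_comp_smul volume
          (fun X : Config N => Real.exp (-(κ * ‖X‖ ^ 2))), finrank_config, mul_pow, mul_pow,
        scaleNorm, gaussNorm, Real.sq_sqrt (by positivity), Real.sq_sqrt
          (integral_nonneg fun X => (Real.exp_pos _).le), smul_eq_mul, inv_pow, inv_inv,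
        abs_of_pos (by positivity)]
    rw [h2, norm_sq_eq_integral]
    refine integral_mono_ae (Lp.memLp Ψ).norm.integrable_sq (hi2.const_mul _) ?_
    filter_upwards [h] with X hX
    have h3 := pow_le_pow_left₀ (norm_nonneg _) hX 2
    refine h3.trans (le_of_eq ?_)
    rw [mul_pow, ← Real.exp_nat_mul]
    congr 2
    push_cast
    ring
  refine le_of_sq_le_sq h1 ?_
  unfold scaleNorm gaussNorm
  positivity

theorem peetre {E : Type*} [SeminormedAddCommGroup E] (x y : E) :
    1 + ‖x‖ ^ 2 ≤ 2 * (1 + ‖y‖ ^ 2) * (1 + ‖y - x‖ ^ 2) := by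
  have h1 : ‖x‖ ≤ ‖y‖ + ‖y - x‖ := by
    have := norm_sub_le y (y - x)
    rwa [sub_sub_cancel] at this
  have h2 : ‖x‖ ^ 2 ≤ (‖y‖ + ‖y - x‖) ^ 2 := pow_le_pow_left₀ (norm_nonneg _) h1 2
  nlinarith [sq_nonneg (‖y‖ - ‖y - x‖), mul_nonneg (sq_nonneg ‖y‖) (sq_nonneg ‖y - x‖)]

/-- The potential acting on a state with Gaussian localization. -/
theorem exists_pairCLM_gaussian (N : ℕ) {κ : ℝ} (hκ : 0 < κ) : ∃ C > 0,
    ∀ {V : E3 → ℝ} {M D₀ ε : ℝ} (hε : 0 < ε) (hV : AEStronglyMeasurable V volume)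
      (hM : ∀ᵐ x, ‖V x‖ ≤ M) (_ : ∀ᵐ q : E3, (1 + ‖q‖ ^ 2) ^ 2 * |V q| ≤ D₀) (i : Fin N)
      (c : Config N) {K : ℝ} (_ : 0 ≤ K) (Ψ : L2 N)
      (_ : ∀ᵐ X, ‖(Ψ : Config N → ℂ) X‖ ≤ K * Real.exp (-(κ * ‖ε⁻¹ • (X - c)‖ ^ 2))),
      ‖pairCLM hε hV hM i Ψ‖ ≤
        C * D₀ * K * ((1 + ‖ε⁻¹ • (c.1 - c.2 i)‖ ^ 2) ^ 2)⁻¹ * scaleNorm N ε := by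
  -- One half of the Gaussian absorbs the factor `(1 + ‖x‖)⁴` lost in moving the decay of `V` from
  -- `q` to the centre, and the other half is left for the `L²` norm.
  obtain ⟨M', hM', hexp⟩ := exists_pow_mul_exp_neg_sq_le 4 (half_pos hκ)
  refine ⟨64 * M' * gaussNorm N κ + 1, by unfold gaussNorm; positivity, ?_⟩
  intro V M D₀ ε hε hV hM hD i c K hK Ψ hΨ
  set B := ε⁻¹ • (c.1 - c.2 i) with hB
  have hD0 : 0 ≤ D₀ := by
    obtain ⟨q, hq⟩ := hD.exists
    exact le_trans (by positivity) hq
  have h1 := norm_le_of_gaussian_bound (D := 64 * M' * D₀ * K * ((1 + ‖B‖ ^ 2) ^ 2)⁻¹) hε hκ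
    (by positivity) c (pairCLM hε hV hM i Ψ) (by
      filter_upwards [pairCLM_coe hε hV hM i Ψ, hΨ, ae_relPos hε i hD] with X h2 h3 h4
      rw [h2, norm_mul, Complex.norm_real, Real.norm_eq_abs]
      set q := relPos ε i X with hq
      set x := ε⁻¹ • (X - c) with hx
      have h5 : ‖q - B‖ ≤ 2 * ‖x‖ := by
        have e : q - B = x.1 - x.2 i := by
          simp only [hq, hB, hx, relPos, Prod.smul_fst, Prod.smul_snd, Prod.fst_sub, Prod.snd_sub,
            Pi.smul_apply, Pi.sub_apply]
          module
        rw [e]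
        have e1 : ‖x.1‖ ≤ ‖x‖ := norm_fst_le x
        have e2 : ‖x.2 i‖ ≤ ‖x‖ := (norm_le_pi_norm x.2 i).trans (norm_snd_le x)
        linarith [norm_sub_le x.1 (x.2 i)]
      have h6 : (1 + ‖B‖ ^ 2) ^ 2 ≤ 64 * (1 + ‖q‖ ^ 2) ^ 2 * (1 + ‖x‖) ^ 4 := by
        have e1 := peetre B q
        have e2 : 1 + ‖q - B‖ ^ 2 ≤ 4 * (1 + ‖x‖) ^ 2 := by
          nlinarith [norm_nonneg x, norm_nonneg (q - B)]
        have e3 : 1 + ‖B‖ ^ 2 ≤ 8 * (1 + ‖q‖ ^ 2) * (1 + ‖x‖) ^ 2 := by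
          refine e1.trans ?_
          have := mul_le_mul_of_nonneg_left e2 (by positivity : 0 ≤ 2 * (1 + ‖q‖ ^ 2))
          linarith
        refine (pow_le_pow_left₀ (by positivity) e3 2).trans (le_of_eq ?_)
        ring
      have h7 : |V q| ≤ 64 * D₀ * (1 + ‖x‖) ^ 4 * ((1 + ‖B‖ ^ 2) ^ 2)⁻¹ := by
        rw [← div_eq_mul_inv, le_div_iff₀ (by positivity)]
        calc |V q| * (1 + ‖B‖ ^ 2) ^ 2 ≤ |V q| * (64 * (1 + ‖q‖ ^ 2) ^ 2 * (1 + ‖x‖) ^ 4) := by gcongr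
          _ = 64 * ((1 + ‖q‖ ^ 2) ^ 2 * |V q|) * (1 + ‖x‖) ^ 4 := by ring
          _ ≤ 64 * D₀ * (1 + ‖x‖) ^ 4 := by gcongr
      have h8 := hexp ‖x‖ (norm_nonneg _)
      have h9 : Real.exp (-(κ * ‖x‖ ^ 2)) =
          Real.exp (-(κ / 2 * ‖x‖ ^ 2)) * Real.exp (-(κ / 2 * ‖x‖ ^ 2)) := by
        rw [← Real.exp_add]; congr 1; ring
      calc |V q| * ‖(Ψ : Config N → ℂ) X‖ ≤
          (64 * D₀ * (1 + ‖x‖) ^ 4 * ((1 + ‖B‖ ^ 2) ^ 2)⁻¹) * (K * Real.exp (-(κ * ‖x‖ ^ 2))) := by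
            gcongr
        _ = 64 * D₀ * K * ((1 + ‖B‖ ^ 2) ^ 2)⁻¹ *
            ((1 + ‖x‖) ^ 4 * Real.exp (-(κ / 2 * ‖x‖ ^ 2))) * Real.exp (-(κ / 2 * ‖x‖ ^ 2)) := by
            rw [h9]; ring
        _ ≤ 64 * D₀ * K * ((1 + ‖B‖ ^ 2) ^ 2)⁻¹ * M' * Real.exp (-(κ / 2 * ‖x‖ ^ 2)) := by gcongr
        _ = _ := by ring)
  refine h1.trans ?_
  have h2 : 0 ≤ D₀ * K * ((1 + ‖B‖ ^ 2) ^ 2)⁻¹ * scaleNorm N ε := by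
    unfold scaleNorm; positivity
  calc _ = (64 * M' * gaussNorm N κ) * (D₀ * K * ((1 + ‖B‖ ^ 2) ^ 2)⁻¹ * scaleNorm N ε) := by ring
    _ ≤ (64 * M' * gaussNorm N κ + 1) * (D₀ * K * ((1 + ‖B‖ ^ 2) ^ 2)⁻¹ * scaleNorm N ε) := by
      gcongr; linarith
    _ = _ := by ring

end Gaussian

section Centers

theorem sum_norm_sq_transfer_le (η : E3) (θ : ℝ) (k : Fin 3) :
    ∑ l, ‖transfer η θ k l‖ ^ 2 ≤ 2 * (1 + ‖η‖ ^ 2) := by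
  have h1 : ∀ l, ‖transfer η θ k l‖ ^ 2 ≤ 2 * ‖η l‖ ^ 2 + if l = k then 2 else 0 := by
    intro l
    rw [transfer]
    split_ifs with h
    · have h2 := norm_sub_le (η l : ℂ) (Complex.I * Complex.exp (Complex.I * θ))
      rw [norm_mul, Complex.norm_I, one_mul, norm_cexp_I_mul, Complex.norm_real] at h2
      nlinarith [sq_nonneg (‖η l‖ - 1), norm_nonneg ((η l : ℂ) -
        Complex.I * Complex.exp (Complex.I * θ))]
    · rw [sub_zero, Complex.norm_real]
      nlinarith [sq_nonneg ‖η l‖]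
  refine (Finset.sum_le_sum fun l _ => h1 l).trans (le_of_eq ?_)
  rw [Finset.sum_add_distrib, ← Finset.mul_sum, ← EuclideanSpace.norm_sq_eq]
  simp
  ring

/-- A kick changes the parameter by `O(1/ε)` and the centre is `ε²` times the parameter, so the
displacement is `O(ε)`. The factors `1 + σ` and `1 + s` come from transporting the kick back to time
`0` and forward to time `s`. -/
theorem norm_freeCenter_kicked_le {ε : ℝ} (hε : 0 < ε) (v₀ : ℝ) (u : E3) {σ s : ℝ} (hσ : 0 ≤ σ)
    (hs : 0 ≤ s) (j : Fin N) (η : E3) (θ : ℝ) (k : Fin 3) :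
    ‖ε⁻¹ • (freeCenter ε s (kicked ε v₀ u σ j η θ k).1 - (s * v₀) • u)‖ ^ 2 ≤
      ((1 + s) * (1 + σ)) ^ 2 * (2 * (1 + ‖η‖ ^ 2)) := by
  refine le_trans ?_ (mul_le_mul_of_nonneg_left (sum_norm_sq_transfer_le η θ k) (sq_nonneg _))
  rw [EuclideanSpace.norm_sq_eq, Finset.mul_sum]
  refine Finset.sum_le_sum fun l _ => ?_
  rw [← mul_pow]
  refine pow_le_pow_left₀ (norm_nonneg _) ?_ 2
  set w := transfer η θ k l with hw
  set d : ℂ := (1 + Complex.I * σ) * (Complex.I * w / ε) with hd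
  have h1 : (ε⁻¹ • (freeCenter ε s (kicked ε v₀ u σ j η θ k).1 - (s * v₀) • u)) l =
      ε * (d.re + s * d.im) := by
    rw [← freeCenter_waveParams (N := N) hε]
    simp only [PiLp.smul_apply, PiLp.sub_apply, freeCenter, kicked, kick, smul_eq_mul,
      Complex.add_re, Complex.add_im, ← hw, ← hd]
    field_simp
    ring
  have h2 : ‖d‖ ≤ (1 + σ) * ‖w‖ / ε := by
    rw [hd, norm_mul, norm_div, norm_mul, Complex.norm_I, one_mul, Complex.norm_real,
      Real.norm_of_nonneg hε.le, mul_div_assoc]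
    gcongr
    refine (norm_add_le _ _).trans ?_
    rw [norm_one, norm_mul, Complex.norm_I, one_mul, Complex.norm_real, Real.norm_of_nonneg hσ]
  rw [h1, norm_mul, Real.norm_of_nonneg hε.le]
  have h3 : ‖d.re + s * d.im‖ ≤ (1 + s) * ‖d‖ := by
    refine (norm_add_le _ _).trans ?_
    rw [norm_mul, Real.norm_of_nonneg hs, Real.norm_eq_abs, Real.norm_eq_abs]
    have := Complex.abs_re_le_norm d
    have := mul_le_mul_of_nonneg_left (Complex.abs_im_le_norm d) hs
    linarith
  calc ε * ‖d.re + s * d.im‖ ≤ ε * ((1 + s) * ((1 + σ) * ‖w‖ / ε)) := by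
        gcongr
        exact h3.trans (by gcongr)
    _ = _ := by field_simp

/-- Here the transport in time only multiplies by phases, so no growth in time occurs; the
oscillators that are not hit stay at rest. -/
theorem norm_oscCenter_kicked_le {ε : ℝ} (hε : 0 < ε) (v₀ : ℝ) (u : E3) (σ s : ℝ)
    (i j : Fin N) (η : E3) (θ : ℝ) (k : Fin 3) :
    ‖ε⁻¹ • oscCenter ε s ((kicked ε v₀ u σ j η θ k).2 i)‖ ^ 2 ≤ 2 * (1 + ‖η‖ ^ 2) := by
  by_cases hij : i = j
  · subst hij
    refine le_trans ?_ (sum_norm_sq_transfer_le η θ k)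
    rw [EuclideanSpace.norm_sq_eq]
    refine Finset.sum_le_sum fun l _ => ?_
    refine pow_le_pow_left₀ (norm_nonneg _) ?_ 2
    simp only [PiLp.smul_apply, oscCenter, kicked, kick, Function.update_self, waveParams,
      Pi.zero_apply, zero_add, smul_eq_mul]
    set w := transfer η θ k l with hw
    rw [norm_mul, norm_mul, Real.norm_of_nonneg (by positivity), Real.norm_of_nonneg (by positivity),
      ← mul_assoc]
    have e1 : ∀ r : ℝ, ‖Complex.exp (Complex.I * r / ε)‖ = 1 := fun r => by
      rw [mul_div_assoc, ← Complex.ofReal_div, norm_cexp_I_mul]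
    have e2 : ‖Complex.exp (-(Complex.I * s / ε))‖ = 1 := by
      rw [Complex.exp_neg, norm_inv, e1, inv_one]
    have h1 := Complex.abs_re_le_norm (Complex.exp (-(Complex.I * s / ε)) *
      (Complex.exp (Complex.I * σ / ε) * -(Complex.I * w / ε)))
    rw [norm_mul, norm_mul, e1, e2, one_mul, one_mul, norm_neg, norm_div, norm_mul, Complex.norm_I,
      one_mul, Complex.norm_real, Real.norm_of_nonneg hε.le, ← Real.norm_eq_abs] at h1
    calc _ ≤ ε⁻¹ * ε ^ 2 * (‖w‖ / ε) := by gcongr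
      _ = ‖w‖ := by field_simp
  · have h1 : (kicked ε v₀ u σ j η θ k).2 i = (waveParams (N := N) ε v₀ u).2 i := by
      simp only [kicked, kick]
      rw [Function.update_of_ne hij]
    rw [h1, oscCenter_waveParams]
    simp
    positivity

theorem norm_center_sub_impact_le {ε : ℝ} (hε : 0 < ε) (v₀ : ℝ) (u : E3) (a : Fin N → E3)
    {σ s t : ℝ} (hσ : σ ∈ Icc 0 t) (hs : s ∈ Icc 0 t) (i j : Fin N) (η : E3) (θ : ℝ) (k : Fin 3) :
    1 + ‖ε⁻¹ • (freeCenter ε s (kicked ε v₀ u σ j η θ k).1 -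
      (a i + oscCenter ε s ((kicked ε v₀ u σ j η θ k).2 i))) - impact ε v₀ u (a i) s‖ ^ 2 ≤
      9 * (1 + t) ^ 4 * (1 + ‖η‖ ^ 2) := by
  have h1 := norm_freeCenter_kicked_le hε v₀ u hσ.1 hs.1 j η θ k
  have h2 := norm_oscCenter_kicked_le hε v₀ u σ s i j η θ k
  set x := ε⁻¹ • (freeCenter ε s (kicked ε v₀ u σ j η θ k).1 - (s * v₀) • u) with hx
  set y := ε⁻¹ • oscCenter ε s ((kicked ε v₀ u σ j η θ k).2 i) with hy
  have h3 : ε⁻¹ • (freeCenter ε s (kicked ε v₀ u σ j η θ k).1 -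
      (a i + oscCenter ε s ((kicked ε v₀ u σ j η θ k).2 i))) - impact ε v₀ u (a i) s = x - y := by
    rw [hx, hy, impact]; module
  rw [h3]
  have h4 : (1 + s) * (1 + σ) ≤ (1 + t) ^ 2 := by
    rw [sq]
    have := hσ.1; have := hσ.2; have := hs.1; have := hs.2
    have : 0 ≤ 1 + t := by linarith
    gcongr
  have h5 : ((1 + s) * (1 + σ)) ^ 2 ≤ (1 + t) ^ 4 := by
    have := hσ.1; have := hs.1
    calc ((1 + s) * (1 + σ)) ^ 2 ≤ ((1 + t) ^ 2) ^ 2 := by gcongr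
      _ = _ := by ring
  have h6 : 1 ≤ (1 + t) ^ 4 := one_le_pow₀ (by linarith [hs.1, hs.2])
  have h7 : 0 ≤ 1 + ‖η‖ ^ 2 := by positivity
  have h8 : ‖x - y‖ ^ 2 ≤ 2 * ‖x‖ ^ 2 + 2 * ‖y‖ ^ 2 := by
    have := norm_sub_le x y
    nlinarith [sq_nonneg (‖x‖ - ‖y‖), norm_nonneg (x - y)]
  have h9 := mul_le_mul_of_nonneg_right h5 (by positivity : 0 ≤ 2 * (1 + ‖η‖ ^ 2))
  have h10 := mul_le_mul_of_nonneg_right h6 h7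
  nlinarith [sq_nonneg ‖η‖]

end Centers

end

/-! ### The second interaction: decay in the impact parameter after a kick. -/

section

variable {N : ℕ}

/-- The ground state wave packet at time `σ` multiplied by `exp (i η·q + e^{iθ} (q - A)ₖ)`. -/
def kickFun (ε v₀ : ℝ) (a : Fin N → E3) (u : E3) (σ : ℝ) (j : Fin N) (η : E3) (θ : ℝ) (k : Fin 3)
    (X : Config N) : ℂ :=
  Complex.exp (Complex.I * ((inner ℝ η (relPos ε j X) : ℝ) : ℂ)) *
    Complex.exp (Complex.exp (Complex.I * θ) *
      ((relPos ε j X k - impact ε v₀ u (a j) σ k : ℝ) : ℂ)) *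
    Complex.exp (packetExp ε a σ (waveParams ε v₀ u) X)

/-- The class in `L²` of `kickFun`. -/
def kickState (ε v₀ : ℝ) (a : Fin N → E3) (u : E3) (σ : ℝ) (j : Fin N) (η : E3) (θ : ℝ)
    (k : Fin 3) : L2 N := toL2 (kickFun ε v₀ a u σ j η θ k)

theorem kickState_coe {ε : ℝ} (hε : 0 < ε) (v₀ : ℝ) (a : Fin N → E3) (u : E3) (σ : ℝ) (j : Fin N)
    (η : E3) (θ : ℝ) (k : Fin 3) :
    (kickState ε v₀ a u σ j η θ k : Config N → ℂ) =ᵐ[volume] kickFun ε v₀ a u σ j η θ k := by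
  obtain ⟨c, hc, -⟩ := exists_kicked hε v₀ a u σ j η θ k
  have h1 : (Complex.exp c • packetL2 hε a σ (kicked ε v₀ u σ j η θ k) : L2 N) =ᵐ[volume]
      kickFun ε v₀ a u σ j η θ k := by
    filter_upwards [Lp.coeFn_smul (Complex.exp c) (packetL2 hε a σ (kicked ε v₀ u σ j η θ k)),
      packetL2_coe hε a σ (kicked ε v₀ u σ j η θ k)] with X h1 h2
    rw [h1, Pi.smul_apply, h2, smul_eq_mul, hc, kickFun]
  rw [kickState, toL2_congr h1]
  exact h1

/-- The interaction acting on a freely evolved wave packet, after a momentum transfer. -/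
theorem exists_pairCLM_kicked (N : ℕ) {t : ℝ} (ht : 0 ≤ t) : ∃ C > 0,
    ∀ {V : E3 → ℝ} {M D₀ ε : ℝ} (hε : 0 < ε) (hV : AEStronglyMeasurable V volume)
      (hM : ∀ᵐ x, ‖V x‖ ≤ M) (_ : ∀ᵐ q : E3, (1 + ‖q‖ ^ 2) ^ 2 * |V q| ≤ D₀)
      (v₀ : ℝ) (a : Fin N → E3) (u : E3) (i j : Fin N) (η : E3) (θ : ℝ) (k : Fin 3),
      ∀ σ ∈ Icc 0 t, ∀ s ∈ Icc 0 t,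
      ‖kickState ε v₀ a u σ j η θ k‖ ≤ C * scaleNorm N ε ∧
      ‖pairCLM hε hV hM i (freeProp ε a (s - σ) (kickState ε v₀ a u σ j η θ k))‖ ≤
        C * D₀ * (1 + ‖η‖ ^ 2) ^ 2 * ((1 + ‖impact ε v₀ u (a i) s‖ ^ 2) ^ 2)⁻¹ * scaleNorm N ε := by
  -- This rate corresponds to the greatest width reached by the packets up to time `t`.
  set κ : ℝ := (2 * (1 + t ^ 2))⁻¹ with hκd
  have hκ : 0 < κ := by positivity
  obtain ⟨C, hC, hgauss⟩ := exists_pairCLM_gaussian N hκ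
  set K := Real.exp ((2 + t ^ 2) / 2) with hK
  have hK0 : 0 < K := Real.exp_pos _
  -- The square of the constant in Peetre's inequality times the bound for the deviation of the
  -- kicked centres from the classical path.
  set Q : ℝ := (2 * (9 * (1 + t) ^ 4)) ^ 2 with hQ
  have hQ0 : 0 < Q := by positivity
  refine ⟨K * gaussNorm N (2 * κ) + C * K * Q, by unfold gaussNorm; positivity, ?_⟩
  intro V M D₀ ε hε hV hM hD v₀ a u i j η θ k σ hσ s hs
  set Θ := kickState ε v₀ a u σ j η θ k with hΘd
  have hΘ := kickState_coe hε v₀ a u σ j η θ k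
  rw [← hΘd] at hΘ
  obtain ⟨c, hc1, hc2⟩ := exists_kicked hε v₀ a u σ j η θ k
  set p' : Params N := kicked ε v₀ u σ j η θ k with hp'
  have hD0 : 0 ≤ D₀ := by
    obtain ⟨q, hq⟩ := hD.exists
    exact le_trans (by positivity) hq
  have hg0 : 0 ≤ gaussNorm N (2 * κ) := Real.sqrt_nonneg _
  have hs0 : 0 ≤ scaleNorm N ε := Real.sqrt_nonneg _
  have hΘeq : Θ = Complex.exp c • packetL2 hε a σ p' := by
    refine Lp.ext (hΘ.trans ?_)
    filter_upwards [Lp.coeFn_smul (Complex.exp c) (packetL2 hε a σ p'), packetL2_coe hε a σ p']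
      with X h1 h2
    rw [h1, Pi.smul_apply, h2, smul_eq_mul, hc1, kickFun]
  have hW := isFreeGroup_freeProp hε a
  have hev : freeProp ε a (s - σ) Θ = Complex.exp c • packetL2 hε a s p' := by
    rw [hΘeq, map_smul, hW.map_packet]
    congr 2
    ring
  set ctr : ℝ → Config N := fun r => (freeCenter ε r p'.1, fun i => a i + oscCenter ε r (p'.2 i))
    with hctr
  have hbound : ∀ r ∈ Icc 0 t, ∀ᵐ X, ‖((Complex.exp c • packetL2 hε a r p' : L2 N) : Config N → ℂ) X‖ ≤
      K * Real.exp (-(κ * ‖ε⁻¹ • (X - ctr r)‖ ^ 2)) := by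
    intro r hr
    filter_upwards [Lp.coeFn_smul (Complex.exp c) (packetL2 hε a r p'), packetL2_coe hε a r p']
      with X h1 h2
    rw [h1, Pi.smul_apply, h2, smul_eq_mul]
    refine (hc2 r X).trans ?_
    have hσ2 : σ ^ 2 ≤ t ^ 2 := pow_le_pow_left₀ hσ.1 hσ.2 2
    have hr2 : r ^ 2 ≤ t ^ 2 := pow_le_pow_left₀ hr.1 hr.2 2
    have e0 := norm_sq_config_le (ε⁻¹ • (X - ctr r))
    have e1 : κ * ‖(ε⁻¹ • (X - ctr r)).1‖ ^ 2 ≤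
        ‖X.1 - freeCenter ε r p'.1‖ ^ 2 / (2 * ε ^ 2 * (1 + r ^ 2)) := by
      have : κ * ‖(ε⁻¹ • (X - ctr r)).1‖ ^ 2 =
          ‖X.1 - freeCenter ε r p'.1‖ ^ 2 / (2 * ε ^ 2 * (1 + t ^ 2)) := by
        rw [Prod.smul_fst, Prod.fst_sub, norm_smul, norm_inv, Real.norm_of_nonneg hε.le, hκd]
        field_simp
        rfl
      rw [this]
      gcongr
    have e2 : κ * ∑ i, ‖(ε⁻¹ • (X - ctr r)).2 i‖ ^ 2 ≤
        ∑ i, ‖X.2 i - (a i + oscCenter ε r (p'.2 i))‖ ^ 2 / (2 * ε ^ 2) := by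
      rw [Finset.mul_sum]
      refine Finset.sum_le_sum fun i _ => ?_
      have : κ * ‖(ε⁻¹ • (X - ctr r)).2 i‖ ^ 2 =
          ‖X.2 i - (a i + oscCenter ε r (p'.2 i))‖ ^ 2 / (2 * ε ^ 2 * (1 + t ^ 2)) := by
        rw [Prod.smul_snd, Prod.snd_sub, Pi.smul_apply, Pi.sub_apply, norm_smul, norm_inv,
          Real.norm_of_nonneg hε.le, hκd]
        field_simp
        rfl
      rw [this]
      refine div_le_div_of_nonneg_left (by positivity) (by positivity) ?_
      nlinarith [mul_nonneg (sq_nonneg ε) (sq_nonneg t)]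
    have e3 := mul_le_mul_of_nonneg_left e0 hκ.le
    rw [mul_add] at e3
    rw [hK]
    gcongr
    linarith
  have hB := norm_center_sub_impact_le hε v₀ u a hσ hs i j η θ k
  rw [← hp'] at hB
  set A := impact ε v₀ u (a i) s with hA
  set B := ε⁻¹ • (freeCenter ε s p'.1 - (a i + oscCenter ε s (p'.2 i))) with hBd
  constructor
  · rw [hΘeq]
    have h1 := norm_le_of_gaussian_bound hε (by positivity : 0 < 2 * κ) hK0.le (ctr σ)
      (Complex.exp c • packetL2 hε a σ p') (by
        filter_upwards [hbound σ hσ] with X hX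
        rwa [mul_div_cancel_left₀ κ (two_ne_zero)])
    calc _ ≤ K * (scaleNorm N ε * gaussNorm N (2 * κ)) := h1
      _ = K * gaussNorm N (2 * κ) * scaleNorm N ε := by ring
      _ ≤ _ := by
        gcongr
        exact le_add_of_nonneg_right (by positivity)
  · rw [hev]
    have h1 := hgauss hε hV hM hD i (ctr s) hK0.le (Complex.exp c • packetL2 hε a s p') (hbound s hs)
    refine h1.trans ?_
    have h2 : ((1 + ‖B‖ ^ 2) ^ 2)⁻¹ ≤ Q * (1 + ‖η‖ ^ 2) ^ 2 * ((1 + ‖A‖ ^ 2) ^ 2)⁻¹ := by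
      rw [← div_eq_mul_inv, le_div_iff₀ (by positivity), ← div_eq_inv_mul, div_le_iff₀ (by positivity)]
      have h3 : 1 + ‖A‖ ^ 2 ≤ 2 * (9 * (1 + t) ^ 4) * (1 + ‖η‖ ^ 2) * (1 + ‖B‖ ^ 2) := by
        have h4 := peetre A B
        have h5 := mul_le_mul_of_nonneg_left hB (by positivity : 0 ≤ 2 * (1 + ‖B‖ ^ 2))
        linarith
      refine (pow_le_pow_left₀ (by positivity) h3 2).trans (le_of_eq ?_)
      rw [hQ]; ring
    calc C * D₀ * K * ((1 + ‖B‖ ^ 2) ^ 2)⁻¹ * scaleNorm N ε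
        ≤ C * D₀ * K * (Q * (1 + ‖η‖ ^ 2) ^ 2 * ((1 + ‖A‖ ^ 2) ^ 2)⁻¹) * scaleNorm N ε := by gcongr
      _ = (C * K * Q) * D₀ * (1 + ‖η‖ ^ 2) ^ 2 * ((1 + ‖A‖ ^ 2) ^ 2)⁻¹ * scaleNorm N ε := by ring
      _ ≤ _ := by
        gcongr
        exact le_add_of_nonneg_left (by positivity)

end

/-! ### The first interaction: decay from moments and complex kicks. -/

section

variable {N : ℕ} {ε v₀ : ℝ} {a : Fin N → E3} {u : E3} {σ : ℝ} {j : Fin N}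

/-- The wave packet times `e^{i η·q} (q - A)ₖᵐ`. -/
def momentFun (ε v₀ : ℝ) (a : Fin N → E3) (u : E3) (σ : ℝ) (j : Fin N) (η : E3) (m : ℕ) (k : Fin 3)
    (X : Config N) : ℂ :=
  Complex.exp (Complex.I * ((inner ℝ η (relPos ε j X) : ℝ) : ℂ)) *
    ((relPos ε j X k - impact ε v₀ u (a j) σ k : ℝ) : ℂ) ^ m *
    Complex.exp (packetExp ε a σ (waveParams ε v₀ u) X)

/-- The class in `L²` of `momentFun`. -/
def momentState (ε v₀ : ℝ) (a : Fin N → E3) (u : E3) (σ : ℝ) (j : Fin N) (η : E3) (m : ℕ)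
    (k : Fin 3) : L2 N := toL2 (momentFun ε v₀ a u σ j η m k)

theorem continuous_relPos (ε : ℝ) (j : Fin N) : Continuous (relPos ε j : Config N → E3) := by
  unfold relPos
  fun_prop

theorem continuous_relPos_apply (ε : ℝ) (j : Fin N) (k : Fin 3) :
    Continuous fun X : Config N => relPos ε j X k :=
  (EuclideanSpace.proj (𝕜 := ℝ) k).continuous.comp (continuous_relPos ε j)

theorem continuous_momentFun (m : ℕ) (k : Fin 3) :
    Continuous fun z : E3 × Config N => momentFun ε v₀ a u σ j z.1 m k z.2 := by
  have h1 := (continuous_packetExp ε a σ (waveParams ε v₀ u)).comp (continuous_snd (X := E3))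
  have h2 := (continuous_relPos_apply ε j k).comp (continuous_snd (X := E3) (Y := Config N))
  have h3 := (continuous_fst (X := E3) (Y := Config N)).inner (𝕜 := ℝ)
    ((continuous_relPos ε j).comp (continuous_snd (X := E3) (Y := Config N)))
  unfold momentFun
  refine ((Complex.continuous_exp.comp (continuous_const.mul (Complex.continuous_ofReal.comp h3))).mul
    ((Complex.continuous_ofReal.comp (h2.sub continuous_const)).pow m)).mul
    (Complex.continuous_exp.comp h1)

theorem continuous_kickFun (η : E3) (k : Fin 3) :
    Continuous fun z : ℝ × Config N => kickFun ε v₀ a u σ j η z.1 k z.2 := by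
  have h1 := (continuous_packetExp ε a σ (waveParams ε v₀ u)).comp (continuous_snd (X := ℝ))
  have h2 := (continuous_relPos_apply ε j k).comp (continuous_snd (X := ℝ) (Y := Config N))
  have h3 := (continuous_const (y := η)).inner (𝕜 := ℝ)
    ((continuous_relPos ε j).comp (continuous_snd (X := ℝ) (Y := Config N)))
  have h4 : Continuous fun z : ℝ × Config N => Complex.exp (Complex.I * z.1) := by fun_prop
  unfold kickFun
  refine ((Complex.continuous_exp.comp (continuous_const.mul (Complex.continuous_ofReal.comp h3))).mul
    (Complex.continuous_exp.comp (h4.mul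
      (Complex.continuous_ofReal.comp (h2.sub continuous_const))))).mul
    (Complex.continuous_exp.comp h1)

/-- From `|w|^m ≤ m! exp |w| ≤ m! (exp w + exp (-w))`; the two exponentials are the kicks with `θ =
0` and `θ = π`. -/
theorem norm_momentFun_le (η : E3) (m : ℕ) (k : Fin 3) (X : Config N) :
    ‖momentFun ε v₀ a u σ j η m k X‖ ≤ m.factorial * (‖kickFun ε v₀ a u σ j 0 0 k X‖ +
      ‖kickFun ε v₀ a u σ j 0 Real.pi k X‖) := by
  set w : ℝ := relPos ε j X k - impact ε v₀ u (a j) σ k with hw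
  have hpi : Complex.exp (Complex.I * Real.pi) = -1 := by
    rw [mul_comm, Complex.exp_pi_mul_I]
  simp only [kickFun, momentFun, norm_mul, norm_cexp_I_mul, ← hw, one_mul, hpi, Complex.ofReal_zero,
    mul_zero, Complex.exp_zero, norm_pow, Complex.norm_real, neg_one_mul, ← add_mul, ← mul_assoc]
  gcongr
  rw [← Complex.ofReal_neg, ← Complex.ofReal_exp, ← Complex.ofReal_exp, Complex.norm_real,
    Complex.norm_real, Real.norm_of_nonneg (Real.exp_pos _).le,
    Real.norm_of_nonneg (Real.exp_pos _).le]
  have h1 := Real.pow_div_factorial_le_exp |w| (abs_nonneg w) m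
  rw [div_le_iff₀ (by positivity), mul_comm] at h1
  refine h1.trans ?_
  gcongr
  rcases abs_cases w with ⟨h, -⟩ | ⟨h, -⟩ <;> rw [h]
  · linarith [Real.exp_pos (-w)]
  · linarith [Real.exp_pos w]

theorem memLp_momentFun (hε : 0 < ε) (η : E3) (m : ℕ) (k : Fin 3) :
    MemLp (momentFun ε v₀ a u σ j η m k) 2 (volume : Measure (Config N)) := by
  have h1 : ∀ θ, MemLp (kickFun ε v₀ a u σ j 0 θ k) 2 (volume : Measure (Config N)) := fun θ =>
    (memLp_congr_ae (kickState_coe hε v₀ a u σ j 0 θ k)).1 (Lp.memLp _)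
  have h2 := ((h1 0).norm.add (h1 Real.pi).norm).const_mul (m.factorial : ℝ)
  refine h2.mono' ?_ (Eventually.of_forall fun X => norm_momentFun_le η m k X)
  exact ((continuous_momentFun m k).comp (Continuous.prodMk_right η)).aestronglyMeasurable

theorem momentState_coe (hε : 0 < ε) (η : E3) (m : ℕ) (k : Fin 3) :
    (momentState ε v₀ a u σ j η m k : Config N → ℂ) =ᵐ[volume] momentFun ε v₀ a u σ j η m k :=
  toL2_coe (memLp_momentFun hε η m k)

theorem norm_momentState_zero (hε : 0 < ε) (η : E3) (m : ℕ) (k : Fin 3) :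
    ‖momentState ε v₀ a u σ j η m k‖ ≤ ‖momentState ε v₀ a u σ j 0 m k‖ := by
  refine Lp.norm_le_norm_of_ae_le ?_
  filter_upwards [momentState_coe hε η m k, momentState_coe hε 0 m k] with X h1 h2
  rw [h1, h2]
  simp only [momentFun, norm_mul, norm_cexp_I_mul, le_refl]

/-- Cauchy's formula writes the moment as an average over `θ` of kicked states with coefficients of
modulus `m! / 2π`. -/
theorem norm_apply_momentState_le (hε : 0 < ε) (T : L2 N →L[ℂ] L2 N) {G K : ℝ} (η : E3) (m : ℕ)
    (k : Fin 3) (hK : ∀ θ, ‖kickState ε v₀ a u σ j η θ k‖ ≤ K)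
    (hT : ∀ θ, ‖T (kickState ε v₀ a u σ j η θ k)‖ ≤ G) :
    ‖T (momentState ε v₀ a u σ j η m k)‖ ≤ m.factorial * G := by
  have hp := Real.pi_pos
  set ν : Measure ℝ := volume.restrict (Ioc 0 (2 * Real.pi)) with hν
  have : IsFiniteMeasure ν := ⟨by rw [hν, Measure.restrict_apply_univ]; exact measure_Ioc_lt_top⟩
  set c : ℝ → ℂ := fun θ => (m.factorial / (2 * Real.pi) : ℂ) * Complex.exp (-(Complex.I * m * θ))
    with hc
  have hcn : ∀ θ, ‖c θ‖ = m.factorial / (2 * Real.pi) := fun θ => by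
    have : -(Complex.I * m * θ) = Complex.I * ((-(m * θ) : ℝ) : ℂ) := by push_cast; ring
    rw [hc]
    simp only
    rw [this, norm_mul, norm_cexp_I_mul, mul_one, norm_div, norm_mul, Complex.norm_real,
      Real.norm_of_nonneg hp.le]
    simp
  have hcc : Continuous c := by fun_prop
  have h1 := norm_apply_le_integral (ν := ν) T
    (F := fun θ X => c θ * kickFun ε v₀ a u σ j η θ k X)
    (Φ := fun θ => c θ • kickState ε v₀ a u σ j η θ k) (Ψ := momentState ε v₀ a u σ j η m k)
    (B := fun _ => m.factorial / (2 * Real.pi) * K) (g := fun _ => m.factorial / (2 * Real.pi) * G)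
    ((hcc.comp continuous_fst).mul (continuous_kickFun η k)).aestronglyMeasurable
    (fun θ => by
      filter_upwards [Lp.coeFn_smul (c θ) (kickState ε v₀ a u σ j η θ k),
        kickState_coe hε v₀ a u σ j η θ k] with X h1 h2
      rw [h1, Pi.smul_apply, h2, smul_eq_mul])
    (by
      filter_upwards [momentState_coe hε η m k] with X hX
      rw [hX, momentFun, pow_eq_integral, intervalIntegral.integral_of_le (by positivity), ← hν,
        ← integral_const_mul, ← integral_const_mul, ← integral_mul_const]
      refine integral_congr_ae (Eventually.of_forall fun θ => ?_)
      simp only [hc, kickFun]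
      ring)
    (integrable_const _) (fun θ => by
      rw [norm_smul, hcn]
      gcongr
      exact hK θ) (integrable_const _) (fun θ => by
      rw [map_smul, norm_smul, hcn]
      gcongr
      exact hT θ)
  refine h1.trans (le_of_eq ?_)
  rw [integral_const, smul_eq_mul, Measure.real, hν, Measure.restrict_apply_univ, Real.volume_Ioc,
    ENNReal.toReal_ofReal (by linarith), sub_zero]
  field_simp

variable {V : E3 → ℝ}

theorem memLp_pow_potential_moment (hε : 0 < ε) (hV : Integrable V)
    (hS : MemWeightedSobolev 4 4 (fourierT V)) (k : Fin 3) {l : ℕ} (hl : l ≤ 4) (m : ℕ) :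
    MemLp (fun X : Config N => (((relPos ε j X k) ^ l : ℝ) : ℂ) * ((V (relPos ε j X) : ℝ) : ℂ) *
      momentFun ε v₀ a u σ j 0 m k X) 2 volume := by
  have hm : AEStronglyMeasurable (fun X : Config N => (((relPos ε j X k) ^ l : ℝ) : ℂ) *
      ((V (relPos ε j X) : ℝ) : ℂ)) volume :=
    (Complex.continuous_ofReal.comp ((continuous_relPos_apply ε j k).pow l)).aestronglyMeasurable.mul
      (aestronglyMeasurable_relPos hε j hV.aestronglyMeasurable)
  have h1 := memLp_mul hm (M := weightedSobolevNorm 4 4 (fourierT V)) (by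
    filter_upwards [ae_relPos hε j (pow_mul_potential_eq hV hS)] with X hX
    rw [hX k l hl, norm_mul, norm_mul, norm_pow, Complex.norm_I, one_pow, one_mul,
      Complex.norm_real, Real.norm_of_nonneg fourierConst_nonneg]
    refine (mul_le_of_le_one_left (norm_nonneg _) fourierConst_le_one).trans ?_
    exact (norm_charIntegral_le _ _).trans (integral_norm_pureDeriv_le hS k hl))
    (momentState ε v₀ a u σ j 0 m k)
  refine (memLp_congr_ae ?_).1 h1
  filter_upwards [momentState_coe hε 0 m k] with X hX
  rw [hX]

/-- Multiplying `V` by `q_k^l` replaces its transform by an `l`-th derivative. The resulting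
superposition in `η` is controlled by the weighted norm, whose weight matches the growth allowed for
`T` on kicked states. -/
theorem norm_apply_pow_potential_moment_le (hε : 0 < ε) (T : L2 N →L[ℂ] L2 N) {G K : ℝ}
    (hK : ∀ η θ k, ‖kickState ε v₀ a u σ j η θ k‖ ≤ K)
    (hT : ∀ η θ k, ‖T (kickState ε v₀ a u σ j η θ k)‖ ≤ G * (1 + ‖η‖ ^ 2) ^ 2)
    (hV : Integrable V) (hS : MemWeightedSobolev 4 4 (fourierT V)) (k : Fin 3) {l : ℕ} (hl : l ≤ 4)
    (m : ℕ) :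
    ‖T (toL2 fun X : Config N => (((relPos ε j X k) ^ l : ℝ) : ℂ) * ((V (relPos ε j X) : ℝ) : ℂ) *
      momentFun ε v₀ a u σ j 0 m k X)‖ ≤
      m.factorial * G * weightedSobolevNorm 4 4 (fourierT V) := by
  set f := pureDeriv (fourierT V) k l with hf
  set c : E3 → ℂ := fun η => fourierConst * Complex.I ^ l * f η with hc
  have hcn : ∀ η, ‖c η‖ ≤ ‖f η‖ := fun η => by
    rw [hc]
    simp only
    rw [norm_mul, norm_mul, norm_pow, Complex.norm_I, one_pow, mul_one, Complex.norm_real,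
      Real.norm_of_nonneg fourierConst_nonneg]
    exact mul_le_of_le_one_left (norm_nonneg _) fourierConst_le_one
  have hG : 0 ≤ G := by
    have := (norm_nonneg _).trans (hT 0 0 k)
    simpa using this
  have hcm : AEStronglyMeasurable c volume :=
    (aestronglyMeasurable_pureDeriv hS k hl).const_mul _
  have h1 := norm_apply_le_integral (ν := (volume : Measure E3)) T
    (F := fun η X => c η * momentFun ε v₀ a u σ j η m k X)
    (Φ := fun η => c η • momentState ε v₀ a u σ j η m k)
    (Ψ := toL2 fun X : Config N => (((relPos ε j X k) ^ l : ℝ) : ℂ) *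
      ((V (relPos ε j X) : ℝ) : ℂ) * momentFun ε v₀ a u σ j 0 m k X)
    (B := fun η => ‖f η‖ * ‖momentState ε v₀ a u σ j 0 m k‖)
    (g := fun η => m.factorial * G * ((1 + ‖η‖ ^ 2) ^ 2 * ‖f η‖))
    (hcm.comp_fst.mul (continuous_momentFun m k).aestronglyMeasurable)
    (fun η => by
      filter_upwards [Lp.coeFn_smul (c η) (momentState ε v₀ a u σ j η m k),
        momentState_coe hε η m k] with X h1 h2
      rw [h1, Pi.smul_apply, h2, smul_eq_mul])
    (by
      filter_upwards [toL2_coe (memLp_pow_potential_moment hε hV hS k hl m),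
        ae_relPos hε j (pow_mul_potential_eq hV hS)] with X h1 h2
      rw [h1, h2 k l hl, charIntegral, ← mul_assoc, ← integral_const_mul, ← integral_mul_const]
      refine integral_congr_ae (Eventually.of_forall fun η => ?_)
      simp only [hc, momentFun, inner_zero_left, Complex.ofReal_zero, mul_zero, Complex.exp_zero]
      ring)
    ((integrable_pureDeriv hS k hl).norm.mul_const _)
    (fun η => by
      rw [norm_smul]
      exact mul_le_mul (hcn η) (norm_momentState_zero hε η m k) (norm_nonneg _) (norm_nonneg _))
    ((integrable_weight_pureDeriv hS k hl).const_mul _)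
    (fun η => by
      rw [map_smul, norm_smul]
      have h2 := norm_apply_momentState_le hε T η m k (fun θ => hK η θ k) (fun θ => hT η θ k)
      calc ‖c η‖ * ‖T (momentState ε v₀ a u σ j η m k)‖
          ≤ ‖f η‖ * (m.factorial * (G * (1 + ‖η‖ ^ 2) ^ 2)) := by
            gcongr
            exact hcn η
        _ = _ := by ring)
  refine h1.trans ?_
  rw [integral_const_mul]
  gcongr
  exact integral_weight_pureDeriv_le _ k hl

/-- The decay of the interaction with a wave packet in the impact parameter, for a bounded operator
which is controlled on all states arising by momentum transfer. -/
theorem norm_apply_pairCLM_le {M : ℝ} (hε : 0 < ε) (hV : Integrable V)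
    (hS : MemWeightedSobolev 4 4 (fourierT V)) (hM : ∀ᵐ x, ‖V x‖ ≤ M)
    (T : L2 N →L[ℂ] L2 N) {G K : ℝ}
    (hK : ∀ η θ k, ‖kickState ε v₀ a u σ j η θ k‖ ≤ K)
    (hT : ∀ η θ k, ‖T (kickState ε v₀ a u σ j η θ k)‖ ≤ G * (1 + ‖η‖ ^ 2) ^ 2) :
    (1 + ‖impact ε v₀ u (a j) σ‖ ^ 2) * ‖T (pairCLM hε hV.aestronglyMeasurable hM j
      (packetL2 hε a σ (waveParams ε v₀ u)))‖ ≤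
      16 * G * weightedSobolevNorm 4 4 (fourierT V) := by
  set S := weightedSobolevNorm 4 4 (fourierT V) with hSd
  set A := impact ε v₀ u (a j) σ with hA
  set Φ : L2 N := pairCLM hε hV.aestronglyMeasurable hM j (packetL2 hε a σ (waveParams ε v₀ u)) with hΦ
  let P : Fin 3 → ℕ → ℕ → L2 N := fun k l m => toL2 fun X : Config N =>
    (((relPos ε j X k) ^ l : ℝ) : ℂ) * ((V (relPos ε j X) : ℝ) : ℂ) *
      momentFun ε v₀ a u σ j 0 m k X
  have hP : ∀ k l m, l ≤ 4 → ‖T (P k l m)‖ ≤ m.factorial * G * S := fun k l m hl =>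
    norm_apply_pow_potential_moment_le hε T hK hT hV hS k hl m
  have hPc : ∀ k l m, l ≤ 4 → (P k l m : Config N → ℂ) =ᵐ[volume] fun X =>
      (((relPos ε j X k) ^ l : ℝ) : ℂ) * ((V (relPos ε j X) : ℝ) : ℂ) *
      momentFun ε v₀ a u σ j 0 m k X := fun k l m hl =>
    toL2_coe (memLp_pow_potential_moment hε hV hS k hl m)
  have hΦc := pairCLM_coe hε hV.aestronglyMeasurable hM j (packetL2 hε a σ (waveParams ε v₀ u))
  have hpk := packetL2_coe hε a σ (waveParams ε v₀ u)
  have e0 : Φ = P 0 0 0 := by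
    refine Lp.ext ?_
    filter_upwards [hΦc, hpk, hPc 0 0 0 (by norm_num)] with X h1 h2 h3
    rw [h1, h2, h3]
    simp [momentFun]
  -- Expand `A_k² = (q_k - (q_k - A_k))²`.
  have ek : ∀ k, ((A k ^ 2 : ℝ) : ℂ) • Φ = P k 2 0 - (2 : ℂ) • P k 1 1 + P k 0 2 := by
    intro k
    refine Lp.ext ?_
    filter_upwards [hΦc, hpk, hPc k 2 0 (by norm_num), hPc k 1 1 (by norm_num),
      hPc k 0 2 (by norm_num), Lp.coeFn_smul ((A k ^ 2 : ℝ) : ℂ) Φ,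
      Lp.coeFn_add (P k 2 0 - (2 : ℂ) • P k 1 1) (P k 0 2),
      Lp.coeFn_sub (P k 2 0) ((2 : ℂ) • P k 1 1), Lp.coeFn_smul (2 : ℂ) (P k 1 1)]
      with X h1 h2 h3 h4 h5 h6 h7 h8 h9
    rw [h6, Pi.smul_apply, h1, h2, h7, Pi.add_apply, h8, Pi.sub_apply, h9, Pi.smul_apply, h3, h4, h5]
    simp only [momentFun, inner_zero_left, Complex.ofReal_zero, mul_zero, Complex.exp_zero,
      smul_eq_mul, ← hA]
    push_cast
    ring
  have b0 : ‖T Φ‖ ≤ G * S := by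
    rw [e0]
    simpa using hP 0 0 0 (by norm_num)
  -- The three terms cost `1`, `2` and `2! = 2`. Three coordinates together with the undecorated
  -- term give the final factor `16`.
  have bk : ∀ k, A k ^ 2 * ‖T Φ‖ ≤ 5 * (G * S) := by
    intro k
    have h1 : A k ^ 2 * ‖T Φ‖ = ‖T (((A k ^ 2 : ℝ) : ℂ) • Φ)‖ := by
      rw [map_smul, norm_smul, Complex.norm_real, Real.norm_of_nonneg (sq_nonneg _)]
    rw [h1, ek, map_add, map_sub, map_smul]
    refine (norm_add_le _ _).trans ?_
    have h2 := norm_sub_le (T (P k 2 0)) ((2 : ℂ) • T (P k 1 1))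
    rw [norm_smul, Complex.norm_two] at h2
    have p0 := hP k 2 0 (by norm_num)
    have p1 := hP k 1 1 (by norm_num)
    have p2 := hP k 0 2 (by norm_num)
    simp only [Nat.factorial, Nat.cast_one, one_mul] at p0 p1 p2
    norm_num at p0 p1 p2
    linarith
  have hA2 : ‖A‖ ^ 2 = A 0 ^ 2 + A 1 ^ 2 + A 2 ^ 2 := by
    rw [EuclideanSpace.norm_sq_eq, Fin.sum_univ_three]
    simp
  rw [hA2]
  linarith [bk 0, bk 1, bk 2]

end

/-! ### Time integrals of two interactions. -/

section

section IntegralCLM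

variable {H : Type*} [NormedAddCommGroup H] [InnerProductSpace ℂ H]

theorem exists_integralCLM {A : ℝ → H →L[ℂ] H} (hA : ∀ x, Continuous fun r => A r x) {s K : ℝ}
    (hK : ∀ r ∈ uIoc 0 s, ∀ x, ‖A r x‖ ≤ K * ‖x‖) :
    ∃ T : H →L[ℂ] H, ∀ x, T x = ∫ r in (0 : ℝ)..s, A r x := by
  refine ⟨LinearMap.mkContinuous
      { toFun := fun x => ∫ r in (0 : ℝ)..s, A r x
        map_add' := fun x y => by
          simp only [map_add]
          exact intervalIntegral.integral_add ((hA x).intervalIntegrable _ _)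
            ((hA y).intervalIntegrable _ _)
        map_smul' := fun c x => by
          simp only [map_smul, RingHom.id_apply]
          exact intervalIntegral.integral_smul c _ } (K * |s|) (fun x => ?_), fun x => rfl⟩
  have := intervalIntegral.norm_integral_le_of_norm_le_const (a := 0) (b := s)
    (f := fun r => A r x) (C := K * ‖x‖) (fun r hr => hK r hr x)
  simp only [LinearMap.coe_mk, AddHom.coe_mk]
  rw [sub_zero] at this
  linarith

end IntegralCLM

variable {N : ℕ} {ε : ℝ}

section

variable {M : ℝ} {V : E3 → ℝ} (hε : 0 < ε) (a : Fin N → E3)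
  (hV : AEStronglyMeasurable V volume) (hM : ∀ᵐ x, ‖V x‖ ≤ M)

include hε hV hM in
-- Boundedness and linearity are what the superposition lemma asks for, so that `J` can be estimated
-- packet by packet.
theorem exists_JCLM (r : ℝ) : ∃ T : L2 N →L[ℂ] L2 N, ∀ Ψ, T Ψ = J ε a V r Ψ := by
  have hM0 : 0 ≤ M := by
    obtain ⟨x, hx⟩ := hM.exists
    exact (norm_nonneg _).trans hx
  have h1 : ∀ s, ∃ T : L2 N →L[ℂ] L2 N, ∀ x, T x = ∫ r in (0 : ℝ)..s, intCLM hε a hV hM r x :=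
    fun s => exists_integralCLM (fun x => continuous_intCLM_apply hε a hV hM continuous_const)
      (fun r _ x => norm_intCLM_le hε a hV hM r x)
  choose I hI using h1
  have hIc : ∀ x, Continuous fun s => I s x := fun x => by
    simp only [hI]
    exact intervalIntegral.continuous_primitive (fun _ _ =>
      (continuous_intCLM_apply hε a hV hM continuous_const).intervalIntegrable _ _) 0
  obtain ⟨T, hT⟩ := exists_integralCLM (A := fun s => (intCLM hε a hV hM s).comp (I s)) (s := r)
    (K := N * M * (N * M * |r|)) (fun x => continuous_intCLM_apply hε a hV hM (hIc x))
    (fun s hs x => by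
      refine (norm_intCLM_le hε a hV hM s _).trans ?_
      have h2 := intervalIntegral.norm_integral_le_of_norm_le_const (a := 0) (b := s)
        (f := fun r => intCLM hε a hV hM r x) (C := N * M * ‖x‖)
        (fun r _ => norm_intCLM_le hε a hV hM r x)
      rw [sub_zero, ← hI] at h2
      have h3 : |s| ≤ |r| := by
        rcases le_total 0 r with h | h
        · rw [uIoc_of_le h] at hs
          rw [abs_of_pos hs.1, abs_of_nonneg h]; exact hs.2
        · rw [uIoc_of_ge h] at hs
          rw [abs_of_nonpos hs.2, abs_of_nonpos h]; linarith [hs.1]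
      calc _ ≤ N * M * (N * M * ‖x‖ * |s|) := by
            gcongr
            exact h2
        _ ≤ N * M * (N * M * ‖x‖ * |r|) := by gcongr
        _ = _ := by ring)
  refine ⟨-T, fun Ψ => ?_⟩
  rw [neg_apply, hT, J_eq hε a hV hM]
  simp only [ContinuousLinearMap.comp_apply, hI]
  rfl

include hε hV hM in
theorem norm_J_le_sq (Ψ : L2 N) {r : ℝ} (hr : 0 ≤ r) :
    ‖J ε a V r Ψ‖ ≤ (r * (N * M)) ^ 2 * ‖Ψ‖ := by
  have hM0 : 0 ≤ M := by
    obtain ⟨x, hx⟩ := hM.exists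
    exact (norm_nonneg _).trans hx
  rw [J_eq hε a hV hM, norm_neg]
  have h1 := intervalIntegral.norm_integral_le_of_norm_le_const (a := 0) (b := r)
    (f := fun s => intCLM hε a hV hM s (∫ σ in (0 : ℝ)..s, intCLM hε a hV hM σ Ψ))
    (C := N * M * (N * M * ‖Ψ‖ * r)) (fun s hs => by
      rw [uIoc_of_le hr] at hs
      refine (norm_intCLM_le hε a hV hM s _).trans ?_
      have h2 := intervalIntegral.norm_integral_le_of_norm_le_const (a := 0) (b := s)
        (f := fun r => intCLM hε a hV hM r Ψ) (C := N * M * ‖Ψ‖)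
        (fun r _ => norm_intCLM_le hε a hV hM r Ψ)
      rw [sub_zero, abs_of_pos hs.1] at h2
      gcongr
      exact h2.trans (by have := hs.2; gcongr))
  rw [sub_zero, abs_of_nonneg hr] at h1
  refine h1.trans (le_of_eq ?_)
  ring

end

section Impact

theorem continuous_impact (ε v₀ : ℝ) (u x : E3) : Continuous (impact ε v₀ u x) := by
  unfold impact
  fun_prop

theorem continuous_inv_one_add_impact (ε v₀ : ℝ) (u x : E3) :
    Continuous fun s => (1 + ‖impact ε v₀ u x s‖ ^ 2)⁻¹ :=
  (continuous_const.add ((continuous_impact ε v₀ u x).norm.pow 2)).inv₀ fun s =>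
    (by positivity : 1 + ‖impact ε v₀ u x s‖ ^ 2 ≠ 0)

theorem continuous_inv_sq_impact (ε v₀ : ℝ) (u x : E3) :
    Continuous fun s => ((1 + ‖impact ε v₀ u x s‖ ^ 2) ^ 2)⁻¹ :=
  ((continuous_const.add ((continuous_impact ε v₀ u x).norm.pow 2)).pow 2).inv₀ fun s =>
    (by positivity : (1 + ‖impact ε v₀ u x s‖ ^ 2) ^ 2 ≠ 0)

/-- Keep only the component of the impact vector along `u`. It moves with speed `v₀ / ε`, and the
integral of `1 / (1 + y²)` over the line is `π`. -/
theorem integral_inv_one_add_impact_le {v₀ : ℝ} (hε : 0 < ε) (hv₀ : 0 < v₀) {u : E3}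
    (hu : ‖u‖ = 1) (x : E3) {s : ℝ} (hs : 0 ≤ s) :
    ∫ σ in (0 : ℝ)..s, (1 + ‖impact ε v₀ u x σ‖ ^ 2)⁻¹ ≤ Real.pi * ε / v₀ := by
  set d : ℝ := inner ℝ u x / ε with hd
  have h1 : ∀ σ, (1 + ‖impact ε v₀ u x σ‖ ^ 2)⁻¹ ≤ (1 + (v₀ / ε * σ - d) ^ 2)⁻¹ := by
    intro σ
    have h2 : v₀ / ε * σ - d = inner ℝ u (impact ε v₀ u x σ) := by
      rw [impact, inner_smul_right, inner_sub_right, inner_smul_right, real_inner_self_eq_norm_sq,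
        hu, hd]
      field_simp
    have h3 := abs_real_inner_le_norm u (impact ε v₀ u x σ)
    rw [hu, one_mul] at h3
    rw [h2, ← sq_abs (inner ℝ u (impact ε v₀ u x σ))]
    gcongr
  have hc1 := continuous_inv_one_add_impact ε v₀ u x
  have hc2 : Continuous fun σ => (1 + (v₀ / ε * σ - d) ^ 2)⁻¹ :=
    Continuous.inv₀ (f := fun σ : ℝ => 1 + (v₀ / ε * σ - d) ^ 2) (by fun_prop) fun σ =>
      (by positivity : 1 + (v₀ / ε * σ - d) ^ 2 ≠ 0)
  refine (intervalIntegral.integral_mono_on hs (hc1.intervalIntegrable _ _)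
    (hc2.intervalIntegrable _ _) fun σ _ => h1 σ).trans ?_
  have hne : v₀ / ε ≠ 0 := by positivity
  rw [intervalIntegral.integral_comp_mul_sub (fun y : ℝ => (1 + y ^ 2)⁻¹) hne d,
    integral_inv_one_add_sq, smul_eq_mul, inv_div]
  have h4 := Real.arctan_lt_pi_div_two (v₀ / ε * s - d)
  have h5 := Real.neg_pi_div_two_lt_arctan (v₀ / ε * 0 - d)
  calc ε / v₀ * (Real.arctan (v₀ / ε * s - d) - Real.arctan (v₀ / ε * 0 - d))
      ≤ ε / v₀ * Real.pi := by gcongr; linarith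
    _ = _ := by ring

end Impact

/-- Two interactions with a freely evolving wave packet. -/
theorem exists_norm_two_interactions_le (N : ℕ) {t : ℝ} (ht : 0 ≤ t) : ∃ C > 0,
    ∀ {V : E3 → ℝ} {M ε : ℝ} (hε : 0 < ε) (hV : Integrable V)
      (hVm : AEStronglyMeasurable V volume)
      (_ : MemWeightedSobolev 4 4 (fourierT V)) (hM : ∀ᵐ x, ‖V x‖ ≤ M)
      (v₀ : ℝ) (a : Fin N → E3) (u : E3) (i j : Fin N), ∀ σ ∈ Icc 0 t, ∀ s ∈ Icc 0 t,
      ‖pairCLM hε hVm hM i (freeProp ε a (s - σ)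
        (pairCLM hε hVm hM j (packetL2 hε a σ (waveParams ε v₀ u))))‖ ≤
      C * weightedSobolevNorm 4 4 (fourierT V) ^ 2 * scaleNorm N ε *
        ((1 + ‖impact ε v₀ u (a i) s‖ ^ 2) ^ 2)⁻¹ * (1 + ‖impact ε v₀ u (a j) σ‖ ^ 2)⁻¹ := by
  obtain ⟨C, hC, h⟩ := exists_pairCLM_kicked N ht
  -- One factor `16` bounds the decaying potential in the second interaction, the other comes from
  -- the expansion in the first.
  refine ⟨256 * C, by positivity, ?_⟩
  intro V M ε hε hV hVm hS hM v₀ a u i j σ hσ s hs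
  have hD := abs_potential_le hV hS
  set S := weightedSobolevNorm 4 4 (fourierT V) with hSd
  obtain ⟨T, hT⟩ : ∃ T : L2 N →L[ℂ] L2 N, ∀ x, T x =
      pairCLM hε hVm hM i (freeProp ε a (s - σ) x) :=
    ⟨(pairCLM hε hVm hM i).comp
      (freeProp ε a (s - σ)).toContinuousLinearEquiv.toContinuousLinearMap, fun _ => rfl⟩
  have h2 := fun η θ k => h hε hVm hM hD v₀ a u i j η θ k σ hσ s hs
  have h1 := norm_apply_pairCLM_le (v₀ := v₀) (a := a) (u := u) (σ := σ) (j := j) hε hV hS hM T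
    (G := C * (16 * S) * ((1 + ‖impact ε v₀ u (a i) s‖ ^ 2) ^ 2)⁻¹ * scaleNorm N ε)
    (K := C * scaleNorm N ε) (fun η θ k => (h2 η θ k).1)
    (fun η θ k => by
      rw [hT]
      refine (h2 η θ k).2.trans (le_of_eq ?_)
      ring)
  rw [hT] at h1
  rw [← div_eq_mul_inv, le_div_iff₀ (by positivity), mul_comm]
  refine h1.trans (le_of_eq ?_)
  ring

section

variable {M : ℝ} {V : E3 → ℝ} (hε : 0 < ε) (a : Fin N → E3)
  (hV : AEStronglyMeasurable V volume) (hM : ∀ᵐ x, ‖V x‖ ≤ M)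

theorem norm_intCLM_intCLM_packetL2_le {s σ D : ℝ} {p : Params N} {x y : Fin N → ℝ}
    (h : ∀ i j, ‖pairCLM hε hV hM i (freeProp ε a (s - σ)
      (pairCLM hε hV hM j (packetL2 hε a σ p)))‖ ≤ D * x i * y j) :
    ‖intCLM hε a hV hM s (intCLM hε a hV hM σ (packetL2 hε a 0 p))‖ ≤
      D * (∑ i, x i) * ∑ j, y j := by
  have hW := isFreeGroup_freeProp hε a
  have e1 : intCLM hε a hV hM s (intCLM hε a hV hM σ (packetL2 hε a 0 p)) = freeProp ε a (-s)
      (∑ j, ∑ i, pairCLM hε hV hM i (freeProp ε a (s - σ)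
        (pairCLM hε hV hM j (packetL2 hε a σ p)))) := by
    change freeProp ε a (-s) ((∑ i, pairCLM hε hV hM i) (freeProp ε a s (freeProp ε a (-σ)
      ((∑ j, pairCLM hε hV hM j) (freeProp ε a σ (packetL2 hε a 0 p)))))) = _
    rw [← hW.add, hW.map_packet, zero_add, ← sub_eq_add_neg]
    simp only [sum_apply, map_sum]
  rw [e1, LinearIsometryEquiv.norm_map, Finset.mul_sum, Finset.mul_sum]
  refine (norm_sum_le _ _).trans (Finset.sum_le_sum fun j _ => (norm_sum_le _ _).trans ?_)
  rw [Finset.sum_mul]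
  exact Finset.sum_le_sum fun i _ => h i j

include hε hV hM in
theorem norm_J_le_of_norm_intCLM_le {t D : ℝ} (hD : 0 ≤ D) (Φ : L2 N) {g h : ℝ → ℝ}
    (hg : Continuous g) (hg0 : ∀ s, 0 ≤ g s) (hh : Continuous h) {H : ℝ} (hH0 : 0 ≤ H)
    (hH : ∀ s ∈ Icc 0 t, ∫ σ in (0 : ℝ)..s, h σ ≤ H)
    (hI : ∀ s ∈ Icc 0 t, ∀ σ ∈ Icc 0 t,
      ‖intCLM hε a hV hM s (intCLM hε a hV hM σ Φ)‖ ≤ D * g s * h σ) {r : ℝ} (hr : r ∈ Icc 0 t) :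
    ‖J ε a V r Φ‖ ≤ D * H * ∫ s in (0 : ℝ)..t, g s := by
  have h2 : ∀ s ∈ Icc 0 t, ‖intCLM hε a hV hM s (∫ σ in (0 : ℝ)..s, intCLM hε a hV hM σ Φ)‖ ≤
      D * H * g s := by
    intro s hs
    have hc : Continuous fun σ => intCLM hε a hV hM σ Φ :=
      continuous_intCLM_apply hε a hV hM continuous_const
    rw [← ContinuousLinearMap.intervalIntegral_comp_comm _ (hc.intervalIntegrable _ _)]
    have h3 := intervalIntegral.norm_integral_le_of_norm_le (a := 0) (b := s) (μ := volume)
      (f := fun σ => intCLM hε a hV hM s (intCLM hε a hV hM σ Φ))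
      (g := fun σ => D * g s * h σ) hs.1
      (Eventually.of_forall fun σ hσ => hI s hs σ ⟨hσ.1.le, hσ.2.trans hs.2⟩)
      ((hh.const_mul _).intervalIntegrable _ _)
    refine h3.trans ?_
    rw [intervalIntegral.integral_const_mul]
    have h5 : 0 ≤ D * g s := mul_nonneg hD (hg0 s)
    calc _ ≤ D * g s * H := mul_le_mul_of_nonneg_left (hH s hs) h5
      _ = _ := by ring
  rw [J_eq hε a hV hM, norm_neg]
  have h3 := intervalIntegral.norm_integral_le_of_norm_le (a := 0) (b := r) (μ := volume)
    (f := fun s => intCLM hε a hV hM s (∫ σ in (0 : ℝ)..s, intCLM hε a hV hM σ Φ))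
    (g := fun s => D * H * g s) hr.1
    (Eventually.of_forall fun s hs => h2 s ⟨hs.1.le, hs.2.trans hr.2⟩)
    ((hg.const_mul _).intervalIntegrable _ _)
  refine h3.trans ?_
  rw [intervalIntegral.integral_const_mul]
  exact mul_le_mul_of_nonneg_left (intervalIntegral.integral_mono_interval le_rfl hr.1 hr.2
    (Eventually.of_forall hg0) (hg.intervalIntegrable _ _)) (mul_nonneg hD hH0)

end

/-- The inner time integral yields its `ε` for every direction `u`. The outer one is left untouched
because its gain appears only after averaging over `u`. -/
theorem exists_norm_J_packet_le (N : ℕ) {v₀ t : ℝ} (hv₀ : 0 < v₀) (ht : 0 ≤ t) : ∃ C > 0,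
    ∀ {V : E3 → ℝ} {ε : ℝ} (hε : 0 < ε) (_ : Integrable V)
      (_ : MemWeightedSobolev 4 4 (fourierT V)) (a : Fin N → E3) (u : E3) (_ : ‖u‖ = 1),
      ∀ r ∈ Icc 0 t, ‖J ε a V r (packetL2 hε a 0 (waveParams ε v₀ u))‖ ≤
      C * weightedSobolevNorm 4 4 (fourierT V) ^ 2 * ε * scaleNorm N ε *
        ∫ s in (0 : ℝ)..t, ∑ i, ((1 + ‖impact ε v₀ u (a i) s‖ ^ 2) ^ 2)⁻¹ := by
  obtain ⟨C, hC, h⟩ := exists_norm_two_interactions_le N ht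
  have hpi := Real.pi_pos
  refine ⟨C * N * (Real.pi / v₀) + 1, by positivity, ?_⟩
  intro V ε hε hV hS a u hu r hr
  obtain ⟨-, hM⟩ := supNorm_le hV hS
  have hVm := hV.aestronglyMeasurable
  have hs0 : 0 ≤ scaleNorm N ε := Real.sqrt_nonneg _
  set S := weightedSobolevNorm 4 4 (fourierT V) with hSd
  have hg0 : ∀ s, 0 ≤ ∑ i, ((1 + ‖impact ε v₀ u (a i) s‖ ^ 2) ^ 2)⁻¹ := fun s =>
    Finset.sum_nonneg fun i _ => by positivity
  have h1 := norm_J_le_of_norm_intCLM_le hε a hVm hM (t := t) (D := C * S ^ 2 * scaleNorm N ε)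
    (by positivity) (packetL2 hε a 0 (waveParams ε v₀ u))
    (g := fun s => ∑ i, ((1 + ‖impact ε v₀ u (a i) s‖ ^ 2) ^ 2)⁻¹)
    (h := fun s => ∑ i, (1 + ‖impact ε v₀ u (a i) s‖ ^ 2)⁻¹)
    (continuous_finsetSum _ fun i _ => continuous_inv_sq_impact ε v₀ u (a i)) hg0
    (continuous_finsetSum _ fun i _ => continuous_inv_one_add_impact ε v₀ u (a i))
    (H := N * (Real.pi * ε / v₀)) (by positivity)
    (fun s hs => by
      rw [intervalIntegral.integral_finsetSum
        (fun j _ => (continuous_inv_one_add_impact ε v₀ u (a j)).intervalIntegrable _ _)]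
      refine (Finset.sum_le_sum fun j _ =>
        integral_inv_one_add_impact_le hε hv₀ hu (a j) hs.1).trans (le_of_eq ?_)
      simp)
    (fun s hs σ hσ => norm_intCLM_intCLM_packetL2_le hε a hVm hM fun i j =>
      h hε hV hVm hS hM v₀ a u i j σ hσ s hs) hr
  refine h1.trans ?_
  have h6 : 0 ≤ ∫ s in (0 : ℝ)..t, ∑ i, ((1 + ‖impact ε v₀ u (a i) s‖ ^ 2) ^ 2)⁻¹ :=
    intervalIntegral.integral_nonneg ht fun s _ => hg0 s
  set I := ∫ s in (0 : ℝ)..t, ∑ i, ((1 + ‖impact ε v₀ u (a i) s‖ ^ 2) ^ 2)⁻¹ with hI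
  calc C * S ^ 2 * scaleNorm N ε * (N * (Real.pi * ε / v₀)) * I
      = (C * N * (Real.pi / v₀)) * (S ^ 2 * ε * scaleNorm N ε * I) := by ring
    _ ≤ (C * N * (Real.pi / v₀) + 1) * (S ^ 2 * ε * scaleNorm N ε * I) := by
      gcongr
      linarith
    _ = _ := by ring

end

/-! ### Polar coordinates, spherical caps and averages over directions. -/

section

section Polar

open Measure

open scoped Pointwise

/-- Integration in polar coordinates. -/
theorem lintegral_eq_lintegral_sphere {f : E3 → ℝ≥0∞} (hf : Measurable f) :
    ∫⁻ x, f x = ∫⁻ u, (∫⁻ r in Ioi (0 : ℝ),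
      ENNReal.ofReal (r ^ 2) * f (r • (u : E3))) ∂(volume : Measure E3).toSphere := by
  have hg : Measurable fun y : Metric.sphere (0 : E3) 1 × Ioi (0 : ℝ) =>
      f ((y.2 : ℝ) • (y.1 : E3)) := by fun_prop
  have h0 : ∫⁻ x, f x = ∫⁻ x : ({(0)}ᶜ : Set E3), f x ∂((volume : Measure E3).comap (↑)) := by
    rw [lintegral_subtype_comap (measurableSet_singleton _).compl, restrict_compl_singleton]
  have h1 := (volume : Measure E3).measurePreserving_homeomorphUnitSphereProd.lintegral_comp hg
  have h2 : ∀ x : ({(0)}ᶜ : Set E3), f (((homeomorphUnitSphereProd E3 x).2 : ℝ) •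
      ((homeomorphUnitSphereProd E3 x).1 : E3)) = f x := by
    intro x
    have hx : ‖(x : E3)‖ ≠ 0 := norm_ne_zero_iff.2 x.2
    simp [smul_smul, hx]
  simp only [h2] at h1
  rw [h0, h1, lintegral_prod _ hg.aemeasurable, finrank_euclideanSpace_fin]
  refine lintegral_congr fun u => ?_
  rw [volumeIoiPow, lintegral_withDensity_eq_lintegral_mul _ (by fun_prop) (by fun_prop)]
  exact lintegral_subtype_comap measurableSet_Ioi
    (fun r : ℝ => ENNReal.ofReal (r ^ 2) * f (r • (u : E3)))

/-- The measure of a spherical cap of radius `δ` is at least of order `δ²`. -/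
theorem exists_le_toSphere_ball : ∃ c > 0, ∀ δ : ℝ, 0 < δ → δ ≤ 1 →
    ∀ w : Metric.sphere (0 : E3) 1,
      c * δ ^ 2 ≤ (volume : Measure E3).toSphere.real (Metric.ball w δ) := by
  have hb : 0 < (volume : Measure E3).real (Metric.ball 0 1) :=
    ENNReal.toReal_pos (Metric.measure_ball_pos _ _ one_pos).ne' measure_ball_lt_top.ne
  -- The sphere measure is `3` times the volume of the cone, which is at least `η²/8` unit-ball
  -- volumes with `η = δ/16`.
  refine ⟨(volume : Measure E3).real (Metric.ball 0 1) * 3 / 2048, by positivity, ?_⟩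
  intro δ hδ hδ1 w
  have hw : ‖(w : E3)‖ = 1 := by simp
  set η := δ / 16 with hη
  have hη0 : 0 < η := by positivity
  set K : Set E3 := Ioo (0 : ℝ) 1 • ((↑) '' (Metric.ball w δ)) with hK
  have hKo : IsOpen K := isOpen_Ioo.smul_sphere one_ne_zero (by simp) Metric.isOpen_ball
  have hKf : volume K ≠ ⊤ := by
    refine ne_top_of_le_ne_top (measure_ball_lt_top (x := (0 : E3)) (r := 1)).ne (measure_mono ?_)
    rintro _ ⟨r, hr, _, ⟨u, -, rfl⟩, rfl⟩
    simpa [norm_smul, abs_of_pos hr.1] using hr.2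
  have hsub : ∀ ρ ∈ Ioo (1 / 4 : ℝ) (1 / 2), Metric.ball (ρ • (w : E3)) η ⊆ K := by
    intro ρ hρ y hy
    rw [Metric.mem_ball, dist_eq_norm] at hy
    have hρw : ‖ρ • (w : E3)‖ = ρ := by
      rw [norm_smul, hw, mul_one, Real.norm_of_nonneg (by linarith [hρ.1])]
    have h1 := abs_norm_sub_norm_le y (ρ • (w : E3))
    rw [hρw, abs_le] at h1
    have hy0 : 3 / 16 < ‖y‖ := by linarith [hρ.1, h1.1]
    have hy1 : ‖y‖ < 1 := by linarith [hρ.2, h1.2]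
    have hu : ‖‖y‖⁻¹ • y‖ = 1 := by
      rw [norm_smul, norm_inv, norm_norm, inv_mul_cancel₀ (by positivity)]
    refine ⟨‖y‖, ⟨by linarith, hy1⟩, ‖y‖⁻¹ • y, ⟨⟨‖y‖⁻¹ • y, by simpa using hu⟩, ?_, rfl⟩, ?_⟩
    · rw [Metric.mem_ball, Subtype.dist_eq, dist_eq_norm]
      have h2 : ‖y‖⁻¹ • y - (w : E3) = ‖y‖⁻¹ • ((y - ρ • (w : E3)) + (ρ - ‖y‖) • (w : E3)) := by
        rw [sub_smul, smul_add, smul_sub, smul_sub, smul_smul ‖y‖⁻¹ ‖y‖,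
          inv_mul_cancel₀ (by positivity)]
        simp
      have h3 : ‖(y - ρ • (w : E3)) + (ρ - ‖y‖) • (w : E3)‖ ≤ 2 * η := by
        refine (norm_add_le _ _).trans ?_
        rw [norm_smul, hw, mul_one, Real.norm_eq_abs]
        have : |ρ - ‖y‖| ≤ η := abs_le.2 ⟨by linarith, by linarith⟩
        linarith
      change ‖‖y‖⁻¹ • y - (w : E3)‖ < δ
      rw [h2, norm_smul, norm_inv, norm_norm, inv_mul_lt_iff₀ (by positivity)]
      nlinarith
    · simp [smul_smul, (by positivity : ‖y‖ ≠ 0)]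
  have hA : MeasurableSet {p : ℝ × E3 | dist p.2 (p.1 • (w : E3)) < η} :=
    (isOpen_lt (by fun_prop) continuous_const).measurableSet
  -- A ball of radius `η` slides along the ray through `w` inside the cone. The pairs `(ρ, x)` with
  -- `x` in the ball at `ρ • w` are measured in two ways: each `ρ` contributes a ball, while each
  -- `x` is covered only for `ρ` in an interval of length `2η`.
  have h1 : ∫⁻ ρ in Ioo (1 / 4 : ℝ) (1 / 2), ∫⁻ x in K,
      {p : ℝ × E3 | dist p.2 (p.1 • (w : E3)) < η}.indicator 1 (ρ, x) =
      ENNReal.ofReal (1 / 4) * (ENNReal.ofReal (η ^ 3) * volume (Metric.ball (0 : E3) 1)) := by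
    have h2 : ∀ ρ ∈ Ioo (1 / 4 : ℝ) (1 / 2), ∫⁻ x in K,
        {p : ℝ × E3 | dist p.2 (p.1 • (w : E3)) < η}.indicator (1 : ℝ × E3 → ℝ≥0∞) (ρ, x) =
        ENNReal.ofReal (η ^ 3) * volume (Metric.ball (0 : E3) 1) := by
      intro ρ hρ
      have h3 : ∀ x, {p : ℝ × E3 | dist p.2 (p.1 • (w : E3)) < η}.indicator
          (1 : ℝ × E3 → ℝ≥0∞) (ρ, x) = (Metric.ball (ρ • (w : E3)) η).indicator 1 x :=
        fun x => rfl
      simp_rw [h3]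
      rw [lintegral_indicator_one Metric.isOpen_ball.measurableSet,
        Measure.restrict_apply Metric.isOpen_ball.measurableSet, inter_eq_left.2 (hsub ρ hρ),
        addHaar_ball_of_pos _ _ hη0, finrank_euclideanSpace_fin]
    rw [setLIntegral_congr_fun measurableSet_Ioo h2, setLIntegral_const, Real.volume_Ioo, mul_comm]
    norm_num
  have h4 : ∫⁻ ρ in Ioo (1 / 4 : ℝ) (1 / 2), ∫⁻ x in K,
      {p : ℝ × E3 | dist p.2 (p.1 • (w : E3)) < η}.indicator (1 : ℝ × E3 → ℝ≥0∞) (ρ, x) ≤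
      ENNReal.ofReal (2 * η) * volume K := by
    rw [lintegral_lintegral_swap (f := fun ρ x => {p : ℝ × E3 |
      dist p.2 (p.1 • (w : E3)) < η}.indicator (1 : ℝ × E3 → ℝ≥0∞) (ρ, x))
      (measurable_one.indicator hA).aemeasurable]
    rw [← setLIntegral_const]
    refine lintegral_mono fun x => ?_
    refine (setLIntegral_le_lintegral _ _).trans ?_
    have h5 : ∀ ρ : ℝ, {p : ℝ × E3 | dist p.2 (p.1 • (w : E3)) < η}.indicator
        (1 : ℝ × E3 → ℝ≥0∞) (ρ, x) ≤
        (Ioo (inner ℝ (w : E3) x - η) (inner ℝ (w : E3) x + η)).indicator 1 ρ := by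
      intro ρ
      by_cases hm : (ρ, x) ∈ {p : ℝ × E3 | dist p.2 (p.1 • (w : E3)) < η}
      · have hm' := hm
        simp only [mem_ofPred_eq, dist_eq_norm] at hm'
        have h6 : |inner ℝ (w : E3) x - ρ| < η := by
          have h7 := abs_real_inner_le_norm (w : E3) (x - ρ • (w : E3))
          rw [inner_sub_right, inner_smul_right, real_inner_self_eq_norm_sq, hw] at h7
          simp only [one_pow, mul_one, one_mul] at h7
          linarith
        rw [abs_lt] at h6
        rw [indicator_of_mem hm, indicator_of_mem (by constructor <;> linarith)]
        exact le_rfl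
      · rw [indicator_of_notMem hm]
        exact zero_le
    refine (lintegral_mono h5).trans ?_
    rw [lintegral_indicator_one measurableSet_Ioo, Real.volume_Ioo]
    exact ENNReal.ofReal_le_ofReal (by linarith)
  have h8 := ENNReal.toReal_mono (ENNReal.mul_ne_top ENNReal.ofReal_ne_top hKf) (h1.symm.le.trans h4)
  simp only [ENNReal.toReal_mul, ENNReal.toReal_ofReal (by positivity : (0:ℝ) ≤ 1 / 4),
    ENNReal.toReal_ofReal (by positivity : (0:ℝ) ≤ η ^ 3),
    ENNReal.toReal_ofReal (by positivity : (0:ℝ) ≤ 2 * η)] at h8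
  change _ ≤ (toSphere volume (Metric.ball w δ)).toReal
  rw [toSphere_apply' _ Metric.isOpen_ball.measurableSet, ENNReal.toReal_mul,
    finrank_euclideanSpace_fin, ← hK]
  change 1 / 4 * (η ^ 3 * (volume : Measure E3).real (Metric.ball 0 1)) ≤ _ at h8
  have h9 : 1 / 8 * (η ^ 2 * (volume : Measure E3).real (Metric.ball 0 1)) ≤ (volume K).toReal := by
    rw [← mul_le_mul_iff_right₀ (by positivity : 0 < 2 * η)]
    refine le_trans (le_of_eq ?_) h8
    ring
  rw [hη] at h9
  simp only [ENNReal.toReal_natCast]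
  push_cast
  nlinarith

variable {ε v₀ t : ℝ}

theorem continuous_impact_sphere (ε v₀ : ℝ) (x : E3) :
    Continuous fun p : Metric.sphere (0 : E3) 1 × ℝ =>
      ((1 + ‖impact ε v₀ p.1 x p.2‖ ^ 2) ^ 2)⁻¹ := by
  unfold impact
  exact Continuous.inv₀ (by fun_prop) fun p =>
    (by positivity : (1 + ‖ε⁻¹ • ((p.2 * v₀) • (p.1 : E3) - x)‖ ^ 2) ^ 2 ≠ 0)

theorem continuous_integral_impact (ε v₀ t : ℝ) (x : E3) :
    Continuous fun u : Metric.sphere (0 : E3) 1 =>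
      ∫ s in (0 : ℝ)..t, ((1 + ‖impact ε v₀ u x s‖ ^ 2) ^ 2)⁻¹ :=
  intervalIntegral.continuous_parametric_intervalIntegral_of_continuous'
    (continuous_impact_sphere ε v₀ x) _ _

theorem integrable_sphere {E : Type*} [NormedAddCommGroup E]
    {f : Metric.sphere (0 : E3) 1 → E} (hf : Continuous f) :
    Integrable f (volume : Measure E3).toSphere :=
  hf.integrable_of_hasCompactSupport (HasCompactSupport.of_compactSpace f)

theorem integrable_inv_sq_one_add_norm_sq :
    Integrable fun y : E3 => ((1 + ‖y‖ ^ 2) ^ 2)⁻¹ := by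
  have h := integrable_rpow_neg_one_add_norm_sq (E := E3) (μ := volume) (r := 4)
    (by rw [finrank_euclideanSpace_fin]; norm_num)
  refine h.congr (Eventually.of_forall fun y => ?_)
  have : (-4 / 2 : ℝ) = -((2 : ℕ) : ℝ) := by norm_num
  simp only [this]
  rw [Real.rpow_neg (by positivity), Real.rpow_natCast]

/-- Inserts the Jacobian `s²` of polar coordinates. It is bounded below once the particle has
covered half the distance to `x`; before that the impact vector has length at least `‖x‖ / (2ε)` and
the integrand is already `O(ε³)`. -/
theorem inv_sq_impact_le (hε : 0 < ε) (hv₀ : 0 < v₀) {u x : E3} (hu : ‖u‖ = 1) (hx : x ≠ 0)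
    {s : ℝ} (hs : 0 ≤ s) : ((1 + ‖impact ε v₀ u x s‖ ^ 2) ^ 2)⁻¹ ≤
      4 * v₀ ^ 2 / ‖x‖ ^ 2 * (s ^ 2 * ((1 + ‖impact ε v₀ u x s‖ ^ 2) ^ 2)⁻¹) +
        8 * ε ^ 3 / ‖x‖ ^ 3 := by
  have hx0 : 0 < ‖x‖ := norm_pos_iff.2 hx
  set g := ((1 + ‖impact ε v₀ u x s‖ ^ 2) ^ 2)⁻¹ with hg
  have hg0 : 0 ≤ g := by positivity
  rcases le_or_gt ‖x‖ (2 * v₀ * s) with h | h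
  · have h1 : 1 ≤ 4 * v₀ ^ 2 / ‖x‖ ^ 2 * s ^ 2 := by
      rw [div_mul_eq_mul_div, one_le_div (by positivity)]
      nlinarith
    have h2 : 0 ≤ 8 * ε ^ 3 / ‖x‖ ^ 3 := by positivity
    nlinarith
  · have h1 : ‖x‖ / (2 * ε) ≤ ‖impact ε v₀ u x s‖ := by
      rw [impact, norm_smul, norm_inv, Real.norm_of_nonneg hε.le, norm_sub_rev]
      have h2 := norm_sub_norm_le x ((s * v₀) • u)
      rw [norm_smul, hu, mul_one, Real.norm_of_nonneg (by positivity)] at h2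
      rw [div_le_iff₀ (by positivity)]
      field_simp
      nlinarith
    have h2 : g ≤ ((‖x‖ / (2 * ε)) ^ 3)⁻¹ := by
      rw [hg]
      refine inv_anti₀ (by positivity) ?_
      set A := ‖impact ε v₀ u x s‖ with hA
      have hA0 : 0 ≤ A := norm_nonneg _
      calc (‖x‖ / (2 * ε)) ^ 3 ≤ A ^ 3 := by gcongr
        _ ≤ (1 + A ^ 2) ^ 2 := by nlinarith [sq_nonneg (A ^ 2 - A), sq_nonneg A]
    have h3 : ((‖x‖ / (2 * ε)) ^ 3)⁻¹ = 8 * ε ^ 3 / ‖x‖ ^ 3 := by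
      field_simp
      ring
    have h4 : 0 ≤ 4 * v₀ ^ 2 / ‖x‖ ^ 2 * (s ^ 2 * g) := by positivity
    linarith

/-- The time which a particle with random direction spends in an `ε`-neighbourhood of `x ≠ 0` is
of order `ε³`. -/
theorem exists_integral_impact_le (hv₀ : 0 < v₀) (ht : 0 ≤ t) {x : E3} (hx : x ≠ 0) :
    ∃ C > 0, ∀ ε : ℝ, 0 < ε →
      ∫ u, (∫ s in (0 : ℝ)..t, ((1 + ‖impact ε v₀ (u : E3) x s‖ ^ 2) ^ 2)⁻¹)
        ∂(volume : Measure E3).toSphere ≤ C * ε ^ 3 := by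
  have hx0 : 0 < ‖x‖ := norm_pos_iff.2 hx
  obtain ⟨I, hI⟩ : ∃ I : ℝ, I = ∫ y : E3, ((1 + ‖y‖ ^ 2) ^ 2)⁻¹ := ⟨_, rfl⟩
  have hI0 : 0 ≤ I := hI ▸ integral_nonneg fun y => inv_nonneg.2 (sq_nonneg _)
  obtain ⟨m, hm⟩ : ∃ m : ℝ, m = (volume : Measure E3).toSphere.real univ := ⟨_, rfl⟩
  have hm0 : 0 ≤ m := hm ▸ measureReal_nonneg
  obtain ⟨C, hC⟩ : ∃ C, C = 4 * v₀ ^ 2 / ‖x‖ ^ 2 * (|(v₀ ^ 3)⁻¹| * I) +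
    m * t * (8 / ‖x‖ ^ 3) + 1 := ⟨_, rfl⟩
  have hC0 : 0 < C := by rw [hC]; positivity
  refine ⟨C, hC0, fun ε hε => ?_⟩
  obtain ⟨G, hG⟩ : ∃ G : Metric.sphere (0 : E3) 1 → ℝ → ℝ, ∀ u s, G u s =
    ((1 + ‖impact ε v₀ u x s‖ ^ 2) ^ 2)⁻¹ := ⟨_, fun _ _ => rfl⟩
  have hG0 : ∀ u s, 0 ≤ G u s := fun u s => (hG u s).symm ▸ inv_nonneg.2 (sq_nonneg _)
  have hGc : Continuous fun p : Metric.sphere (0 : E3) 1 × ℝ => G p.1 p.2 := by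
    simpa only [hG] using continuous_impact_sphere ε v₀ x
  have hGi : Continuous fun u => ∫ s in (0 : ℝ)..t, G u s := by
    simpa only [hG] using continuous_integral_impact ε v₀ t x
  simp only [← hG]
  have hGu : ∀ u, Continuous (G u) := fun u => hGc.comp (Continuous.prodMk_right u)
  -- At `y = s u` this is the integrand, so the average with weight `s²` is at most the integral of
  -- `f` over `ℝ³`, which scales like `ε³`; the exponent `-2` makes it converge.
  obtain ⟨f, hf⟩ : ∃ f : E3 → ℝ≥0∞, f = fun y =>
    ENNReal.ofReal ((1 + ‖ε⁻¹ • (v₀ • y - x)‖ ^ 2) ^ 2)⁻¹ := ⟨_, rfl⟩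
  have hfm : Measurable f := by rw [hf]; fun_prop
  have hfI : ∫⁻ y, f y = ENNReal.ofReal (|(v₀ ^ 3)⁻¹| * I * ε ^ 3) := by
    have e : ∀ y : E3, ε⁻¹ • (v₀ • y - x) = (ε⁻¹ * v₀) • y - ε⁻¹ • x := fun y => by
      rw [smul_sub, smul_smul]
    have hi : Integrable fun y : E3 => ((1 + ‖(ε⁻¹ * v₀) • y - ε⁻¹ • x‖ ^ 2) ^ 2)⁻¹ :=
      (integrable_inv_sq_one_add_norm_sq.comp_sub_right (ε⁻¹ • x)).comp_smul (by positivity)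
    simp only [hf, e]
    rw [← ofReal_integral_eq_lintegral_ofReal hi (Eventually.of_forall fun y => by positivity),
      Measure.integral_comp_smul volume (fun y : E3 => ((1 + ‖y - ε⁻¹ • x‖ ^ 2) ^ 2)⁻¹),
      integral_sub_right_eq_self (fun y : E3 => ((1 + ‖y‖ ^ 2) ^ 2)⁻¹), finrank_euclideanSpace_fin,
      ← hI, smul_eq_mul, mul_pow, inv_pow, mul_inv, inv_inv, abs_mul, abs_of_pos (by positivity :
      0 < ε ^ 3)]
    congr 1
    ring
  have h1 : ENNReal.ofReal (∫ u, (∫ s in (0 : ℝ)..t, G u s) ∂(volume : Measure E3).toSphere) =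
      ∫⁻ u, (∫⁻ s in Ioc 0 t, ENNReal.ofReal (G u s)) ∂(volume : Measure E3).toSphere := by
    rw [ofReal_integral_eq_lintegral_ofReal
      (integrable_sphere hGi) (Eventually.of_forall fun u =>
        intervalIntegral.integral_nonneg ht fun s _ => hG0 u s)]
    refine lintegral_congr fun u => ?_
    rw [intervalIntegral.integral_of_le ht, ofReal_integral_eq_lintegral_ofReal
      ((hGu u).integrableOn_Ioc) (Eventually.of_forall (hG0 u))]
  have h2 : ∀ u, ∫⁻ s in Ioc 0 t, ENNReal.ofReal (G u s) ≤
      ENNReal.ofReal (4 * v₀ ^ 2 / ‖x‖ ^ 2) *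
        (∫⁻ r in Ioi (0 : ℝ), ENNReal.ofReal (r ^ 2) * f (r • (u : E3))) +
        ENNReal.ofReal (8 * ε ^ 3 / ‖x‖ ^ 3 * t) := by
    intro u
    have hfG : ∀ s : ℝ, f (s • (u : E3)) = ENNReal.ofReal (G u s) := fun s => by
      simp only [hf, hG, impact, smul_smul, mul_comm]
    have hmeas : Measurable fun r : ℝ => ENNReal.ofReal (r ^ 2) * f (r • (u : E3)) := by
      fun_prop
    calc _ ≤ ∫⁻ s in Ioc 0 t, (ENNReal.ofReal (4 * v₀ ^ 2 / ‖x‖ ^ 2) *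
          (ENNReal.ofReal (s ^ 2) * f (s • (u : E3))) + ENNReal.ofReal (8 * ε ^ 3 / ‖x‖ ^ 3)) := by
          refine setLIntegral_mono' measurableSet_Ioc fun s hs => ?_
          rw [hfG, ← ENNReal.ofReal_mul (by positivity), ← ENNReal.ofReal_mul (by positivity),
            ← ENNReal.ofReal_add (mul_nonneg (by positivity) (mul_nonneg (sq_nonneg _) (hG0 u s)))
            (by positivity)]
          exact ENNReal.ofReal_le_ofReal (by
            rw [hG]
            exact inv_sq_impact_le hε hv₀ (by simp) hx hs.1.le)
      _ = ENNReal.ofReal (4 * v₀ ^ 2 / ‖x‖ ^ 2) *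
          (∫⁻ s in Ioc 0 t, ENNReal.ofReal (s ^ 2) * f (s • (u : E3))) +
          ENNReal.ofReal (8 * ε ^ 3 / ‖x‖ ^ 3 * t) := by
          rw [lintegral_add_right _ measurable_const, lintegral_const_mul _ hmeas,
            setLIntegral_const, Real.volume_Ioc, sub_zero,
            ← ENNReal.ofReal_mul (by positivity)]
      _ ≤ _ := by
          gcongr
          exact fun s hs => hs.1
  have h3 : ENNReal.ofReal (∫ u, (∫ s in (0 : ℝ)..t, G u s) ∂(volume : Measure E3).toSphere) ≤
      ENNReal.ofReal (4 * v₀ ^ 2 / ‖x‖ ^ 2 * (|(v₀ ^ 3)⁻¹| * I * ε ^ 3) +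
        8 * ε ^ 3 / ‖x‖ ^ 3 * t * m) := by
    rw [h1]
    refine (lintegral_mono h2).trans ?_
    rw [lintegral_add_right _ measurable_const, lintegral_const_mul', lintegral_const,
      ← lintegral_eq_lintegral_sphere hfm, hfI, ← ENNReal.ofReal_mul (by positivity),
      ENNReal.ofReal_add (by positivity) (by positivity),
      ENNReal.ofReal_mul (p := 8 * ε ^ 3 / ‖x‖ ^ 3 * t) (by positivity), hm, measureReal_def,
      ENNReal.ofReal_toReal (measure_ne_top _ _)]
    exact ENNReal.ofReal_ne_top
  rw [ENNReal.ofReal_le_ofReal_iff (by positivity)] at h3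
  refine h3.trans ?_
  have : 0 < ε ^ 3 := by positivity
  have e : 8 * ε ^ 3 / ‖x‖ ^ 3 * t * m = m * t * (8 / ‖x‖ ^ 3) * ε ^ 3 := by ring
  rw [e, hC]
  nlinarith

end Polar

end

/-! ### The normalization constant of the spherical wave. -/

section

section NormConst

open Measure

variable {ε v₀ : ℝ}

theorem integrable_exp_neg_mul_norm_sq {b : ℝ} (hb : 0 < b) :
    Integrable fun R : E3 => Real.exp (-b * ‖R‖ ^ 2) := by
  have h1 := (GaussianFourier.integrable_cexp_neg_mul_sq_norm_add (V := E3)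
    (by simpa using hb : 0 < (b : ℂ).re) 0 0).norm
  refine h1.congr (Eventually.of_forall fun R => ?_)
  simp only [zero_mul, add_zero, Complex.norm_exp]
  norm_cast

theorem exists_integral_gaussian_phase : ∃ K : ℝ, 0 < K ∧ ∀ ε : ℝ, 0 < ε → ∀ w : E3,
    ∫ R : E3, Complex.exp (-((ε ^ 2)⁻¹ : ℝ) * ‖R‖ ^ 2 + Complex.I * (inner ℝ w R : ℝ)) =
      ((K * ε ^ 3 * Real.exp (-(ε ^ 2 * ‖w‖ ^ 2 / 4)) : ℝ) : ℂ) := by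
  have hi : Integrable fun R : E3 => Real.exp (-‖R‖ ^ 2) := by
    simpa using integrable_exp_neg_mul_norm_sq one_pos
  refine ⟨∫ R : E3, Real.exp (-‖R‖ ^ 2), integral_exp_pos hi, fun ε hε w => ?_⟩
  have hb : 0 < (((ε ^ 2)⁻¹ : ℝ) : ℂ).re := by
    rw [Complex.ofReal_re]
    positivity
  have h1 := GaussianFourier.integral_cexp_neg_mul_sq_norm_add hb Complex.I w
  have h2 := GaussianFourier.integral_cexp_neg_mul_sq_norm hb (V := E3)
  rw [h1, ← h2]
  have h3 : ∫ R : E3, Complex.exp (-(((ε ^ 2)⁻¹ : ℝ) : ℂ) * ‖R‖ ^ 2) =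
      ((ε ^ 3 * ∫ R : E3, Real.exp (-‖R‖ ^ 2) : ℝ) : ℂ) := by
    have h4 := integral_comp_smul volume (fun R : E3 => Real.exp (-‖R‖ ^ 2)) ε⁻¹
    rw [finrank_euclideanSpace_fin, inv_pow, inv_inv, abs_of_pos (by positivity), smul_eq_mul] at h4
    rw [← h4, ← integral_complex_ofReal]
    refine integral_congr_ae (Eventually.of_forall fun R => ?_)
    simp only [norm_smul, norm_inv, Real.norm_of_nonneg hε.le]
    push_cast
    congr 1
    ring
  rw [h3, Complex.I_sq]
  push_cast
  have e : (-1 : ℂ) * (‖w‖ : ℂ) ^ 2 / (4 * ((ε : ℂ) ^ 2)⁻¹) =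
      -((ε : ℂ) ^ 2 * (‖w‖ : ℂ) ^ 2 / 4) := by
    have : (ε : ℂ) ≠ 0 := by exact_mod_cast hε.ne'
    field_simp
  rw [e]
  ring

/-- Write the squared modulus as a double integral over directions. The `R` integral is the Fourier
transform of a Gaussian at `v₀ (u - u') / ε²`, which couples only directions within distance of
order `ε`. -/
theorem exists_integral_norm_waveShape_sq : ∃ K : ℝ, 0 < K ∧ ∀ ε v₀ : ℝ, 0 < ε →
    ∫ R : E3, ‖waveShape ε v₀ R‖ ^ 2 = K * (ε ^ 2)⁻¹ * ∫ z, Real.exp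
      (-(v₀ ^ 2 / (4 * ε ^ 2) * ‖(z.1 : E3) - z.2‖ ^ 2))
        ∂((volume : Measure E3).toSphere.prod (volume : Measure E3).toSphere) := by
  obtain ⟨K, hK, h⟩ := exists_integral_gaussian_phase
  set κ : ℝ := (Real.pi ^ (-(3 / 4) : ℝ)) ^ 2 with hκ
  refine ⟨κ * K, by positivity, fun ε v₀ hε => ?_⟩
  set μ : Measure (Metric.sphere (0 : E3) 1) := (volume : Measure E3).toSphere with hμ
  have h5 : (ε ^ (-(5 / 2) : ℝ)) ^ 2 = (ε ^ 5)⁻¹ := by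
    rw [← Real.rpow_natCast, ← Real.rpow_mul hε.le, ← Real.rpow_natCast, ← Real.rpow_neg hε.le]
    norm_num
  have h1 : ∀ R : E3, ((‖waveShape ε v₀ R‖ ^ 2 : ℝ) : ℂ) = ((κ * (ε ^ 5)⁻¹ : ℝ) : ℂ) *
      ∫ z, Complex.exp (-((ε ^ 2)⁻¹ : ℝ) * ‖R‖ ^ 2 + Complex.I *
        (inner ℝ ((v₀ / ε ^ 2) • ((z.1 : E3) - z.2)) R : ℝ)) ∂(μ.prod μ) := by
    intro R
    have e1 : ((‖waveShape ε v₀ R‖ ^ 2 : ℝ) : ℂ) = waveShape ε v₀ R *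
        (starRingEnd ℂ) (waveShape ε v₀ R) := by
      rw [Complex.mul_conj, Complex.normSq_eq_norm_sq]
    rw [e1, waveShape, map_mul, Complex.conj_ofReal, ← integral_conj]
    have e2 : ∀ x y : ℂ, ∀ r : ℝ, (r : ℂ) * x * (r * y) = ((r ^ 2 : ℝ) : ℂ) * (x * y) := by
      intro x y r; push_cast; ring
    rw [e2, ← integral_prod_mul, mul_pow, h5, gauss, mul_pow, ← hκ, ← Real.exp_nat_mul]
    have e3 : (ε ^ 5)⁻¹ * (κ * Real.exp (((2 : ℕ) : ℝ) * -(‖ε⁻¹ • R‖ ^ 2 / 2))) =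
        κ * (ε ^ 5)⁻¹ * Real.exp (-(ε ^ 2)⁻¹ * ‖R‖ ^ 2) := by
      have : ((2 : ℕ) : ℝ) * -(‖ε⁻¹ • R‖ ^ 2 / 2) = -(ε ^ 2)⁻¹ * ‖R‖ ^ 2 := by
        rw [norm_smul, norm_inv, Real.norm_of_nonneg hε.le]
        push_cast
        ring
      rw [this]
      ring
    rw [e3, Complex.ofReal_mul, mul_assoc, ← integral_const_mul]
    congr 1
    refine integral_congr_ae (Eventually.of_forall fun z => ?_)
    simp only
    rw [← Complex.exp_conj, ← Complex.exp_add, Complex.ofReal_exp, ← Complex.exp_add]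
    congr 1
    simp only [inner_smul_left, inner_sub_left, map_mul, Complex.conj_I, Complex.conj_ofReal,
      conj_trivial]
    push_cast
    ring
  have h2 : ((∫ R : E3, ‖waveShape ε v₀ R‖ ^ 2 : ℝ) : ℂ) = ((κ * (ε ^ 5)⁻¹ : ℝ) : ℂ) *
      ∫ z, (∫ R : E3, Complex.exp (-((ε ^ 2)⁻¹ : ℝ) * ‖R‖ ^ 2 + Complex.I *
        (inner ℝ ((v₀ / ε ^ 2) • ((z.1 : E3) - z.2)) R : ℝ))) ∂(μ.prod μ) := by
    rw [← integral_complex_ofReal]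
    simp only [h1]
    rw [integral_const_mul, integral_integral_swap]
    have h6 := (integrable_exp_neg_mul_norm_sq (by positivity : 0 < (ε ^ 2)⁻¹)).mul_prod
      (integrable_const (1 : ℝ) (μ := μ.prod μ))
    refine h6.mono (Continuous.aestronglyMeasurable (by unfold Function.uncurry; fun_prop))
      (Eventually.of_forall fun y => le_of_eq ?_)
    rw [Function.uncurry, Complex.exp_add, norm_mul, norm_cexp_I_mul, mul_one, mul_one,
      Real.norm_of_nonneg (Real.exp_pos _).le, Complex.norm_exp]
    congr 1
    norm_cast
  simp only [h _ hε] at h2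
  rw [integral_complex_ofReal, ← Complex.ofReal_mul, Complex.ofReal_inj] at h2
  rw [h2, integral_const_mul]
  have e4 : ∀ z : Metric.sphere (0 : E3) 1 × Metric.sphere (0 : E3) 1,
      ε ^ 2 * ‖(v₀ / ε ^ 2) • ((z.1 : E3) - z.2)‖ ^ 2 / 4 =
      v₀ ^ 2 / (4 * ε ^ 2) * ‖(z.1 : E3) - z.2‖ ^ 2 := fun z => by
    rw [norm_smul, mul_pow, Real.norm_eq_abs, sq_abs]
    field_simp
  simp only [e4]
  field_simp

/-- The normalization constant of the spherical wave stays bounded as `ε → 0`. -/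
theorem exists_normConst_le (v₀ : ℝ) : ∃ C : ℝ, 0 < C ∧ ∀ ε : ℝ, 0 < ε →
    normConst ε v₀ ≤ C * (1 + ε) := by
  obtain ⟨K, hK, h⟩ := exists_integral_norm_waveShape_sq
  obtain ⟨c, hc, hcap⟩ := exists_le_toSphere_ball
  set μ : Measure (Metric.sphere (0 : E3) 1) := (volume : Measure E3).toSphere with hμ
  have hm : 0 < μ.real univ := by
    rw [hμ, toSphere_real_apply_univ]
    exact mul_pos (by simp) (ENNReal.toReal_pos (Metric.measure_ball_pos _ _ one_pos).ne'
      measure_ball_lt_top.ne)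
  set q : ℝ := K * (Real.exp (-(v₀ ^ 2 / 4)) * (c * μ.real univ)) with hq
  have hq0 : 0 < q := by positivity
  refine ⟨(Real.sqrt q)⁻¹, by positivity, fun ε hε => ?_⟩
  -- Caps of radius `ε` dominate the double integral, but the cap estimate is available only up to
  -- radius `1`; afterwards `ε / (1 + ε) ≤ δ`.
  set δ := min ε 1 with hδ
  have hδ0 : 0 < δ := lt_min hε one_pos
  have h1 : Real.exp (-(v₀ ^ 2 / 4)) * (c * δ ^ 2 * μ.real univ) ≤ ∫ z, Real.exp
      (-(v₀ ^ 2 / (4 * ε ^ 2) * ‖(z.1 : E3) - z.2‖ ^ 2)) ∂(μ.prod μ) := by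
    have hcont : Continuous fun z : Metric.sphere (0 : E3) 1 × Metric.sphere (0 : E3) 1 =>
        Real.exp (-(v₀ ^ 2 / (4 * ε ^ 2) * ‖(z.1 : E3) - z.2‖ ^ 2)) := by fun_prop
    have hint : Integrable (fun z : Metric.sphere (0 : E3) 1 × Metric.sphere (0 : E3) 1 =>
        Real.exp (-(v₀ ^ 2 / (4 * ε ^ 2) * ‖(z.1 : E3) - z.2‖ ^ 2))) (μ.prod μ) :=
      hcont.integrable_of_hasCompactSupport (HasCompactSupport.of_compactSpace _)
    rw [integral_prod _ hint]
    have h2 : ∀ w : Metric.sphere (0 : E3) 1, Real.exp (-(v₀ ^ 2 / 4)) * (c * δ ^ 2) ≤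
        ∫ u, Real.exp (-(v₀ ^ 2 / (4 * ε ^ 2) * ‖(w : E3) - u‖ ^ 2)) ∂μ := by
      intro w
      have hiw : Integrable (fun u : Metric.sphere (0 : E3) 1 =>
          Real.exp (-(v₀ ^ 2 / (4 * ε ^ 2) * ‖(w : E3) - u‖ ^ 2))) μ :=
        integrable_sphere (by fun_prop)
      calc _ ≤ Real.exp (-(v₀ ^ 2 / 4)) * μ.real (Metric.ball w δ) := by
            gcongr
            exact hcap δ hδ0 (min_le_right _ _) w
        _ = ∫ u in Metric.ball w δ, Real.exp (-(v₀ ^ 2 / 4)) ∂μ := by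
            rw [setIntegral_const, smul_eq_mul, mul_comm]
        _ ≤ ∫ u in Metric.ball w δ, Real.exp (-(v₀ ^ 2 / (4 * ε ^ 2) * ‖(w : E3) - u‖ ^ 2)) ∂μ := by
            refine setIntegral_mono_on (integrable_const _).integrableOn hiw.integrableOn
              Metric.isOpen_ball.measurableSet fun u hu => Real.exp_le_exp.2 (neg_le_neg ?_)
            rw [Metric.mem_ball, dist_comm, Subtype.dist_eq, dist_eq_norm] at hu
            have h3 : ‖(w : E3) - u‖ ^ 2 ≤ ε ^ 2 := by
              have := hu.le.trans (min_le_left ε 1)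
              gcongr
            calc _ ≤ v₀ ^ 2 / (4 * ε ^ 2) * ε ^ 2 := by gcongr
              _ = _ := by field_simp
        _ ≤ _ := setIntegral_le_integral hiw (Eventually.of_forall fun u => (Real.exp_pos _).le)
    calc _ = ∫ _w : Metric.sphere (0 : E3) 1, Real.exp (-(v₀ ^ 2 / 4)) * (c * δ ^ 2) ∂μ := by
          rw [integral_const, smul_eq_mul]; ring
      _ ≤ _ := integral_mono (integrable_const _) hint.integral_prod_left h2
  have h4 : q * ((1 + ε) ^ 2)⁻¹ ≤ ∫ R : E3, ‖waveShape ε v₀ R‖ ^ 2 := by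
    rw [h ε v₀ hε]
    have h5 : ε ^ 2 * ((1 + ε) ^ 2)⁻¹ ≤ δ ^ 2 := by
      rw [← div_eq_mul_inv, ← div_pow]
      refine pow_le_pow_left₀ (by positivity) (le_min ?_ ?_) 2
      · exact div_le_self hε.le (by linarith)
      · exact (div_le_one (by positivity)).2 (by linarith)
    calc q * ((1 + ε) ^ 2)⁻¹ = K * (ε ^ 2)⁻¹ * (Real.exp (-(v₀ ^ 2 / 4)) *
          (c * (ε ^ 2 * ((1 + ε) ^ 2)⁻¹) * μ.real univ)) := by
          rw [hq]; field_simp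
      _ ≤ K * (ε ^ 2)⁻¹ * (Real.exp (-(v₀ ^ 2 / 4)) * (c * δ ^ 2 * μ.real univ)) := by gcongr
      _ ≤ _ := by gcongr
  rw [normConst]
  calc _ ≤ (Real.sqrt (q * ((1 + ε) ^ 2)⁻¹))⁻¹ := by
        refine inv_anti₀ (Real.sqrt_pos.2 (by positivity)) (Real.sqrt_le_sqrt h4)
    _ = _ := by
        rw [Real.sqrt_mul hq0.le, mul_inv, Real.sqrt_inv, inv_inv, Real.sqrt_sq (by positivity)]

end NormConst

end

/-! ### The initial state as a superposition of packets. -/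

section

section InitialState

variable {N : ℕ} {ε : ℝ}

/-- The amplitude of the wave packets which make up the initial state. -/
def initialAmplitude (N : ℕ) (ε v₀ : ℝ) : ℝ :=
  normConst ε v₀ * (ε ^ (-(5 / 2) : ℝ) * Real.pi ^ (-(3 / 4) : ℝ)) *
    (ε ^ (-(3 / 2) : ℝ) * Real.pi ^ (-(3 / 4) : ℝ)) ^ N

theorem normConst_nonneg (ε v₀ : ℝ) : 0 ≤ normConst ε v₀ := inv_nonneg.2 (Real.sqrt_nonneg _)

theorem initialAmplitude_nonneg (hε : 0 < ε) (v₀ : ℝ) : 0 ≤ initialAmplitude N ε v₀ := by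
  have := normConst_nonneg ε v₀
  unfold initialAmplitude
  positivity

/-- The powers of `ε` cancel for the oscillators. The spherical wave is scaled with `ε^(-5/2)`
instead of `ε^(-3/2)`, so a single `ε⁻¹` remains. -/
theorem initialAmplitude_mul_scaleNorm (hε : 0 < ε) (v₀ : ℝ) :
    initialAmplitude N ε v₀ * scaleNorm N ε =
      (Real.pi ^ (-(3 / 4) : ℝ)) ^ (N + 1) * (normConst ε v₀ * ε⁻¹) := by
  have h1 : scaleNorm N ε = (ε ^ (3 / 2 : ℝ)) ^ (N + 1) := by
    rw [scaleNorm, ← Real.sqrt_sq (by positivity : 0 ≤ (ε ^ (3 / 2 : ℝ)) ^ (N + 1)), ← pow_mul,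
      mul_comm (N + 1) 2, pow_mul, ← Real.rpow_natCast (ε ^ (3 / 2 : ℝ)) 2, ← Real.rpow_mul hε.le]
    norm_num
    rw [← pow_mul]
    congr 1
  have h2 : ε ^ (-(5 / 2) : ℝ) = ε⁻¹ * ε ^ (-(3 / 2) : ℝ) := by
    rw [← Real.rpow_neg_one, ← Real.rpow_add hε]
    norm_num
  have h3 : ε ^ (-(3 / 2) : ℝ) * ε ^ (3 / 2 : ℝ) = 1 := by
    rw [← Real.rpow_add hε]
    norm_num
  have h4 : (ε ^ (-(3 / 2) : ℝ)) ^ (N + 1) * (ε ^ (3 / 2 : ℝ)) ^ (N + 1) = 1 := by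
    rw [← mul_pow, h3, one_pow]
  rw [initialAmplitude, h1, h2]
  calc _ = (Real.pi ^ (-(3 / 4) : ℝ)) ^ (N + 1) * (normConst ε v₀ * ε⁻¹) *
        ((ε ^ (-(3 / 2) : ℝ)) ^ (N + 1) * (ε ^ (3 / 2 : ℝ)) ^ (N + 1)) := by ring
    _ = _ := by rw [h4, mul_one]

theorem norm_exp_packetExp_waveParams (hε : 0 < ε) (a : Fin N → E3) (v₀ : ℝ) (u : E3)
    (X : Config N) : ‖Complex.exp (packetExp ε a 0 (waveParams ε v₀ u) X)‖ =
      Real.exp (-(‖X.1‖ ^ 2 / (2 * ε ^ 2)) - ∑ j, ‖X.2 j - a j‖ ^ 2 / (2 * ε ^ 2)) := by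
  rw [Complex.norm_exp, re_packetExp hε, packetMass_waveParams, freeCenter_waveParams hε]
  simp [oscCenter_waveParams]

theorem norm_packetL2_waveParams_le (hε : 0 < ε) (a : Fin N → E3) (v₀ : ℝ) (u : E3) :
    ‖packetL2 hε a 0 (waveParams ε v₀ u)‖ ≤ scaleNorm N ε * gaussNorm N 1 := by
  have h := norm_le_of_gaussian_bound (N := N) (κ := 1) (D := 1) hε one_pos zero_le_one (0, a)
    (packetL2 hε a 0 (waveParams ε v₀ u)) (by
      filter_upwards [packetL2_coe hε a 0 (waveParams ε v₀ u)] with X hX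
      rw [hX, norm_exp_packetExp_waveParams hε, one_mul]
      refine Real.exp_le_exp.2 ?_
      have h1 := norm_sq_config_le (ε⁻¹ • (X - ((0, a) : Config N)))
      have h2 : ‖(ε⁻¹ • (X - ((0, a) : Config N))).1‖ ^ 2 = 2 * (‖X.1‖ ^ 2 / (2 * ε ^ 2)) := by
        rw [Prod.smul_fst, Prod.fst_sub, norm_smul, norm_inv, Real.norm_of_nonneg hε.le, sub_zero]
        field_simp
      have h3 : ∑ j, ‖(ε⁻¹ • (X - ((0, a) : Config N))).2 j‖ ^ 2 =
          2 * ∑ j, ‖X.2 j - a j‖ ^ 2 / (2 * ε ^ 2) := by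
        rw [Finset.mul_sum]
        refine Finset.sum_congr rfl fun j _ => ?_
        rw [Prod.smul_snd, Prod.snd_sub, Pi.smul_apply, Pi.sub_apply, norm_smul, norm_inv,
          Real.norm_of_nonneg hε.le]
        field_simp
      linarith)
  rwa [one_mul] at h

theorem continuous_exp_packetExp_sphere (ε v₀ : ℝ) (a : Fin N → E3) (c : ℂ) :
    Continuous fun z : Metric.sphere (0 : E3) 1 × Config N =>
      c * Complex.exp (packetExp ε a 0 (waveParams ε v₀ (z.1 : E3)) z.2) := by
  simp only [packetExp_zero, cdot, waveParams]
  fun_prop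

theorem wave_mul_prod_groundState (hε : 0 < ε) (v₀ : ℝ) (a : Fin N → E3) (X : Config N) :
    wave ε v₀ X.1 * ∏ j, ((groundState ε (a j) (X.2 j) : ℝ) : ℂ) =
      ∫ u, (initialAmplitude N ε v₀ : ℂ) *
        Complex.exp (packetExp ε a 0 (waveParams ε v₀ (u : E3)) X)
          ∂(volume : Measure E3).toSphere := by
  have h0 : ∀ y : E3, ‖ε⁻¹ • y‖ ^ 2 / 2 = (ε ^ 2)⁻¹ / 2 * ‖y‖ ^ 2 := fun y => by
    rw [norm_smul, norm_inv, Real.norm_of_nonneg hε.le]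
    ring
  have h1 : ∀ u : E3, cdot (waveParams (N := N) ε v₀ u).1 X.1 =
      Complex.I * ((v₀ / ε ^ 2 * inner ℝ u X.1 : ℝ) : ℂ) := fun u => by
    rw [PiLp.inner_apply, cdot, Finset.mul_sum]
    push_cast
    rw [Finset.mul_sum]
    refine Finset.sum_congr rfl fun k _ => ?_
    simp only [waveParams, RCLike.inner_apply, conj_trivial]
    push_cast
    ring
  have h2 : ∏ j, ((groundState ε (a j) (X.2 j) : ℝ) : ℂ) =
      ((ε ^ (-(3 / 2) : ℝ) * Real.pi ^ (-(3 / 4) : ℝ)) ^ N : ℝ) *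
        ∏ j, Complex.exp (-((ε : ℂ) ^ 2)⁻¹ / 2 * ((‖X.2 j - a j‖ ^ 2 : ℝ) : ℂ)) := by
    have e : ∀ j, ((groundState ε (a j) (X.2 j) : ℝ) : ℂ) =
        ((ε ^ (-(3 / 2) : ℝ) * Real.pi ^ (-(3 / 4) : ℝ) : ℝ) : ℂ) *
          Complex.exp (-((ε : ℂ) ^ 2)⁻¹ / 2 * ((‖X.2 j - a j‖ ^ 2 : ℝ) : ℂ)) := fun j => by
      rw [groundState, gauss, h0]
      push_cast
      rw [mul_assoc]
      congr 3
      ring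
    simp only [e]
    rw [Finset.prod_mul_distrib, Finset.prod_const, Finset.card_univ, Fintype.card_fin,
      Complex.ofReal_pow]
  have h3 : ∀ u : E3, Complex.exp (packetExp ε a 0 (waveParams ε v₀ u) X) =
      Complex.exp (-((ε : ℂ) ^ 2)⁻¹ / 2 * ((‖X.1‖ ^ 2 : ℝ) : ℂ)) *
      (∏ j, Complex.exp (-((ε : ℂ) ^ 2)⁻¹ / 2 * ((‖X.2 j - a j‖ ^ 2 : ℝ) : ℂ))) *
      Complex.exp (Complex.I * ((v₀ / ε ^ 2 * inner ℝ u X.1 : ℝ) : ℂ)) := fun u => by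
    rw [← Complex.exp_sum, ← Complex.exp_add, ← Complex.exp_add, packetExp_zero, h1]
    congr 1
    simp [waveParams, cdot]
    ring
  simp only [h3]
  rw [integral_const_mul, integral_const_mul, h2, wave, waveShape, initialAmplitude, gauss, h0]
  have h4 : ((Real.exp (-((ε ^ 2)⁻¹ / 2 * ‖X.1‖ ^ 2)) : ℝ) : ℂ) =
      Complex.exp (-((ε : ℂ) ^ 2)⁻¹ / 2 * ((‖X.1‖ ^ 2 : ℝ) : ℂ)) := by
    push_cast
    congr 1
    ring
  rw [← h4]
  push_cast
  ring

theorem aestronglyMeasurable_integral_sphere {F : Metric.sphere (0 : E3) 1 → Config N → ℂ}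
    (hF : Continuous fun z : Metric.sphere (0 : E3) 1 × Config N => F z.1 z.2) :
    AEStronglyMeasurable (fun X => ∫ u, F u X ∂(volume : Measure E3).toSphere) volume :=
  (hF.stronglyMeasurable.integral_prod_left' (μ := (volume : Measure E3).toSphere)
    ).aestronglyMeasurable

theorem initialState_coe (hε : 0 < ε) (v₀ : ℝ) (a : Fin N → E3) :
    (initialState ε v₀ a : Config N → ℂ) =ᵐ[volume] fun X =>
      ∫ u, (initialAmplitude N ε v₀ : ℂ) *
        Complex.exp (packetExp ε a 0 (waveParams ε v₀ (u : E3)) X)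
          ∂(volume : Measure E3).toSphere := by
  have hmem : MemLp (fun X : Config N => ∫ u, (initialAmplitude N ε v₀ : ℂ) *
        Complex.exp (packetExp ε a 0 (waveParams ε v₀ (u : E3)) X)
          ∂(volume : Measure E3).toSphere) 2 volume := by
    have h1 := (memLp_congr_ae (packetL2_coe hε a 0 (waveParams ε v₀ 0))).1
      (Lp.memLp (packetL2 hε a 0 (waveParams ε v₀ 0)))
    refine (h1.const_mul (((volume : Measure E3).toSphere.real univ *
      initialAmplitude N ε v₀ : ℝ) : ℂ)).mono ?_ (Eventually.of_forall fun X => ?_)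
    · exact aestronglyMeasurable_integral_sphere (continuous_exp_packetExp_sphere ε v₀ a _)
    · refine (norm_integral_le_integral_norm _).trans (le_of_eq ?_)
      simp only [norm_mul, norm_exp_packetExp_waveParams hε, Complex.norm_real]
      rw [integral_const, smul_eq_mul, Real.norm_of_nonneg measureReal_nonneg]
      ring
  have hfun : initialState ε v₀ a = toL2 (fun X : Config N => ∫ u, (initialAmplitude N ε v₀ : ℂ) *
        Complex.exp (packetExp ε a 0 (waveParams ε v₀ (u : E3)) X)
          ∂(volume : Measure E3).toSphere) := by
    rw [initialState]
    congr 1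
    funext X
    exact wave_mul_prod_groundState hε v₀ a X
  rw [hfun]
  exact toL2_coe hmem

/-- The initial state is a superposition of the wave packets with momenta on a sphere. -/
theorem norm_apply_initialState_le (hε : 0 < ε) (v₀ : ℝ) (a : Fin N → E3) (T : L2 N →L[ℂ] L2 N)
    {g : Metric.sphere (0 : E3) 1 → ℝ} (hg : Integrable g (volume : Measure E3).toSphere)
    (hT : ∀ u : Metric.sphere (0 : E3) 1, ‖T (packetL2 hε a 0 (waveParams ε v₀ u))‖ ≤ g u) :
    ‖T (initialState ε v₀ a)‖ ≤
      initialAmplitude N ε v₀ * ∫ u, g u ∂(volume : Measure E3).toSphere := by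
  have hA := initialAmplitude_nonneg (N := N) hε v₀
  have hn : ∀ x : L2 N, ‖(initialAmplitude N ε v₀ : ℂ) • x‖ = initialAmplitude N ε v₀ * ‖x‖ :=
    fun x => by rw [norm_smul, Complex.norm_real, Real.norm_of_nonneg hA]
  rw [← integral_const_mul]
  refine norm_apply_le_integral (ν := (volume : Measure E3).toSphere) T (F := fun u X => (initialAmplitude N ε v₀ : ℂ) *
      Complex.exp (packetExp ε a 0 (waveParams ε v₀ (u : E3)) X))
    (Φ := fun u => (initialAmplitude N ε v₀ : ℂ) • packetL2 hε a 0 (waveParams ε v₀ (u : E3))) ?_ ?_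
    (initialState_coe hε v₀ a)
    (B := fun _ => initialAmplitude N ε v₀ * (scaleNorm N ε * gaussNorm N 1))
    (integrable_const (initialAmplitude N ε v₀ * (scaleNorm N ε * gaussNorm N 1))) (fun u => ?_)
    (g := fun u => initialAmplitude N ε v₀ * g u) (hg.const_mul _) (fun u => ?_)
  · exact (continuous_exp_packetExp_sphere ε v₀ a _).aestronglyMeasurable
  · intro u
    filter_upwards [Lp.coeFn_smul (initialAmplitude N ε v₀ : ℂ)
      (packetL2 hε a 0 (waveParams ε v₀ (u : E3))), packetL2_coe hε a 0 (waveParams ε v₀ (u : E3))]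
      with X h1 h2
    rw [h1, Pi.smul_apply, h2, smul_eq_mul]
  · rw [hn]
    exact mul_le_mul_of_nonneg_left (norm_packetL2_waveParams_le hε a v₀ u) hA
  · rw [map_smul, hn]
    exact mul_le_mul_of_nonneg_left (hT u) hA

end InitialState

end

/-! ### The second-order term on the initial state. -/

section

section SecondOrder

variable {N : ℕ}

/-- For `ε ≤ 1` the powers are `ε⁻¹` from the amplitude, `ε` from the first interaction time and
`ε³` from the directional average. For `ε > 1` the operator norm bound is enough, since the
amplitude factor is bounded and `1 ≤ ε³`. The two products in the constant serve these two cases. -/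
theorem exists_norm_J_initialState_le {v₀ t : ℝ} (hv₀ : 0 < v₀) (ht : 0 ≤ t) {a : Fin N → E3}
    (ha : ∀ j, a j ≠ 0) : ∃ C : ℝ, 0 < C ∧
      ∀ {V : E3 → ℝ} {ε : ℝ}, 0 < ε → Integrable V → MemWeightedSobolev 4 4 (fourierT V) →
        ∀ r ∈ Icc 0 t, ‖J ε a V r (initialState ε v₀ a)‖ ≤
          C * weightedSobolevNorm 4 4 (fourierT V) ^ 2 * ε ^ 3 := by
  obtain ⟨C₁, hC₁, h₁⟩ := exists_norm_J_packet_le N hv₀ ht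
  obtain ⟨C₂, hC₂, h₂⟩ := exists_normConst_le v₀
  have h3 := fun i => exists_integral_impact_le hv₀ ht (ha i)
  choose C₃ hC₃ h₃ using h3
  obtain ⟨m, hm⟩ : ∃ m : ℝ, m = (volume : Measure E3).toSphere.real univ := ⟨_, rfl⟩
  have hm0 : 0 ≤ m := hm ▸ measureReal_nonneg
  obtain ⟨p, hp⟩ : ∃ p : ℝ, p = (Real.pi ^ (-(3 / 4) : ℝ)) ^ (N + 1) := ⟨_, rfl⟩
  have hp0 : 0 ≤ p := hp ▸ by positivity
  have hγ : 0 ≤ gaussNorm N 1 := Real.sqrt_nonneg _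
  have hC3 : 0 ≤ ∑ i, C₃ i := Finset.sum_nonneg fun i _ => (hC₃ i).le
  refine ⟨2 * C₂ * p * (C₁ * ∑ i, C₃ i) + 2 * C₂ * p * ((t * (N * 16)) ^ 2 * gaussNorm N 1 * m) + 1,
    by positivity, ?_⟩
  intro V ε hε hV hS r hr
  obtain ⟨hsup, hM⟩ := supNorm_le hV hS
  have hsup0 : 0 ≤ supNorm V := ENNReal.toReal_nonneg
  obtain ⟨S, hSd⟩ : ∃ S, S = weightedSobolevNorm 4 4 (fourierT V) := ⟨_, rfl⟩
  rw [← hSd] at hsup ⊢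
  obtain ⟨T, hT⟩ := exists_JCLM hε a hV.aestronglyMeasurable hM r
  have hA := initialAmplitude_nonneg (N := N) hε v₀
  have hAs := initialAmplitude_mul_scaleNorm (N := N) hε v₀
  rw [← hp] at hAs
  have hs0 : 0 ≤ scaleNorm N ε := Real.sqrt_nonneg _
  have hn0 := normConst_nonneg ε v₀
  have hε3 : 0 < ε ^ 3 := by positivity
  have hN := h₂ ε hε
  rw [← hT]
  rcases le_or_gt ε 1 with hε1 | hε1
  · have hint : ∀ i, Integrable (fun u : Metric.sphere (0 : E3) 1 =>
        ∫ s in (0 : ℝ)..t, ((1 + ‖impact ε v₀ u (a i) s‖ ^ 2) ^ 2)⁻¹)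
        (volume : Measure E3).toSphere := fun i =>
      integrable_sphere (continuous_integral_impact ε v₀ t (a i))
    have h4 := norm_apply_initialState_le hε v₀ a T
      (g := fun u => C₁ * S ^ 2 * ε * scaleNorm N ε *
        ∑ i, ∫ s in (0 : ℝ)..t, ((1 + ‖impact ε v₀ u (a i) s‖ ^ 2) ^ 2)⁻¹)
      ((integrable_finsetSum _ fun i _ => hint i).const_mul _) (fun u => by
        have h5 := h₁ hε hV hS a u (by simp) r hr
        rw [intervalIntegral.integral_finsetSum
          (fun i _ => (continuous_inv_sq_impact ε v₀ u (a i)).intervalIntegrable _ _), ← hSd] at h5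
        rw [hT]
        exact h5)
    refine h4.trans ?_
    rw [integral_const_mul, integral_finsetSum _ fun i _ => hint i]
    have h6 : ∑ i, ∫ u, (∫ s in (0 : ℝ)..t, ((1 + ‖impact ε v₀ (u : E3) (a i) s‖ ^ 2) ^ 2)⁻¹)
        ∂(volume : Measure E3).toSphere ≤ (∑ i, C₃ i) * ε ^ 3 := by
      rw [Finset.sum_mul]
      exact Finset.sum_le_sum fun i _ => h₃ i ε hε
    calc _ ≤ initialAmplitude N ε v₀ *
          (C₁ * S ^ 2 * ε * scaleNorm N ε * ((∑ i, C₃ i) * ε ^ 3)) := by gcongr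
      _ = (initialAmplitude N ε v₀ * scaleNorm N ε) * (C₁ * (∑ i, C₃ i) * S ^ 2 * ε * ε ^ 3) := by
          ring
      _ = normConst ε v₀ * (p * (C₁ * (∑ i, C₃ i) * S ^ 2 * ε ^ 3)) := by
          rw [hAs]
          field_simp
      _ ≤ (2 * C₂) * (p * (C₁ * (∑ i, C₃ i) * S ^ 2 * ε ^ 3)) := by
          gcongr
          nlinarith
      _ = 2 * C₂ * p * (C₁ * ∑ i, C₃ i) * S ^ 2 * ε ^ 3 := by ring
      _ ≤ _ := by
          gcongr
          have : 0 ≤ 2 * C₂ * p * ((t * (N * 16)) ^ 2 * gaussNorm N 1 * m) := by positivity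
          linarith
  · have h4 := norm_apply_initialState_le hε v₀ a T
      (g := fun _ => (t * (N * (16 * S))) ^ 2 * (scaleNorm N ε * gaussNorm N 1))
      (integrable_const _) (fun u => by
        rw [hT]
        refine (norm_J_le_sq hε a hV.aestronglyMeasurable hM _ hr.1).trans ?_
        have h5 := norm_packetL2_waveParams_le hε a v₀ (u : E3)
        have h6 := hr.2
        have h7 := hr.1
        gcongr)
    refine h4.trans ?_
    rw [integral_const, ← hm, smul_eq_mul]
    calc _ = (initialAmplitude N ε v₀ * scaleNorm N ε) *
          ((t * (N * 16)) ^ 2 * gaussNorm N 1 * m * S ^ 2) := by ring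
      _ = normConst ε v₀ * ε⁻¹ * (p * ((t * (N * 16)) ^ 2 * gaussNorm N 1 * m * S ^ 2)) := by
          rw [hAs]
          ring
      _ ≤ (2 * C₂) * (p * ((t * (N * 16)) ^ 2 * gaussNorm N 1 * m * S ^ 2)) := by
          refine mul_le_mul_of_nonneg_right ?_ (by positivity)
          rw [← div_eq_mul_inv, div_le_iff₀ hε]
          nlinarith
      _ = 2 * C₂ * p * ((t * (N * 16)) ^ 2 * gaussNorm N 1 * m) * S ^ 2 * 1 := by ring
      _ ≤ _ := by
          gcongr
          · have : 0 ≤ 2 * C₂ * p * (C₁ * ∑ i, C₃ i) := by positivity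
            linarith
          · exact one_le_pow₀ hε1.le

end SecondOrder

end

/-! ### Excitation of two oscillators. -/

section

section Excitation

variable {N : ℕ} {ε : ℝ}

theorem exists_exp_oscExp_zero (hε : 0 < ε) (s : ℝ) : ∃ c : ℂ, ∀ x r : E3,
    Complex.exp (oscExp ε s 0 (r - x)) = c * ((groundState ε x r : ℝ) : ℂ) := by
  have hb : ((ε ^ (-(3 / 2) : ℝ) * Real.pi ^ (-(3 / 4) : ℝ) : ℝ) : ℂ) ≠ 0 := by
    have : 0 < ε ^ (-(3 / 2) : ℝ) * Real.pi ^ (-(3 / 4) : ℝ) := by positivity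
    exact_mod_cast this.ne'
  refine ⟨Complex.exp (-(3 / 2 * Complex.I * s / ε)) *
    ((ε ^ (-(3 / 2) : ℝ) * Real.pi ^ (-(3 / 4) : ℝ) : ℝ) : ℂ)⁻¹, fun x r => ?_⟩
  have h1 : ((groundState ε x r : ℝ) : ℂ) =
      ((ε ^ (-(3 / 2) : ℝ) * Real.pi ^ (-(3 / 4) : ℝ) : ℝ) : ℂ) *
        Complex.exp (-(((ε : ℂ) ^ 2)⁻¹ / 2) * ((‖r - x‖ ^ 2 : ℝ) : ℂ)) := by
    rw [groundState, gauss, norm_smul, norm_inv, Real.norm_of_nonneg hε.le]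
    push_cast
    rw [mul_assoc]
    congr 3
    ring
  rw [h1, mul_assoc, inv_mul_cancel_left₀ hb, ← Complex.exp_add]
  congr 1
  simp [oscExp, quadExp, cdot]
  ring

/-- A packet is a product over the variables, and an oscillator with parameter `0` remains in its
ground state up to a phase and a constant. -/
theorem packetL2_mem_atMostOneExcited (hε : 0 < ε) (a : Fin N → E3) (s : ℝ) {p : Params N}
    {A : Finset (Fin N)} (hA : A.card ≤ 1) (hp : ∀ j ∉ A, p.2 j = 0) :
    packetL2 hε a s p ∈ atMostOneExcited ε a := by
  obtain ⟨c, hc⟩ := exists_exp_oscExp_zero hε s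
  refine Submodule.subset_span ⟨A, hA, fun R y => Complex.exp (freeExp ε s p.1 R) *
    (∏ k : A, Complex.exp (oscExp ε s (p.2 k) (y k - a k))) * c ^ (Finset.univ \ A).card, ?_⟩
  filter_upwards [packetL2_coe hε a s p] with X hX
  rw [hX, packetExp, Complex.exp_add, Complex.exp_sum, ← Finset.prod_sdiff (Finset.subset_univ A)]
  have h1 : ∏ k ∈ Finset.univ \ A, Complex.exp (oscExp ε s (p.2 k) (X.2 k - a k)) =
      c ^ (Finset.univ \ A).card *
        ∏ k ∈ Finset.univ \ A, ((groundState ε (a k) (X.2 k) : ℝ) : ℂ) := by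
    rw [← Finset.prod_const, ← Finset.prod_mul_distrib]
    refine Finset.prod_congr rfl fun k hk => ?_
    rw [hp k (Finset.mem_sdiff.1 hk).2, hc]
  rw [h1, Finset.prod_coe_sort A fun k => Complex.exp (oscExp ε s (p.2 k) (X.2 k - a k))]
  ring

theorem starProjection_orthogonal_eq_zero {a : Fin N → E3} {Ψ : L2 N}
    (h : Ψ ∈ atMostOneExcited ε a) : (atMostOneExcited ε a)ᗮ.starProjection Ψ = 0 := by
  rw [Submodule.starProjection_apply_eq_zero_iff]
  exact Submodule.le_orthogonal_orthogonal _ h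

/-- Freely evolved, the initial state has all oscillators in their ground states. -/
theorem starProjection_freeProp_initialState (hε : 0 < ε) (v₀ : ℝ) (a : Fin N → E3) (t : ℝ) :
    (atMostOneExcited ε a)ᗮ.starProjection (freeProp ε a t (initialState ε v₀ a)) = 0 := by
  obtain ⟨T, hT⟩ : ∃ T : L2 N →L[ℂ] L2 N, ∀ x, T x =
      (atMostOneExcited ε a)ᗮ.starProjection (freeProp ε a t x) :=
    ⟨(atMostOneExcited ε a)ᗮ.starProjection.comp
      (freeProp ε a t).toContinuousLinearEquiv.toContinuousLinearMap, fun _ => rfl⟩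
  have h1 := norm_apply_initialState_le hε v₀ a T (g := fun _ => 0) (integrable_zero _ _ _)
    fun u => by
      rw [hT, (isFreeGroup_freeProp hε a).map_packet, starProjection_orthogonal_eq_zero, norm_zero]
      exact packetL2_mem_atMostOneExcited hε a _ (A := ∅) (by simp) fun j _ => rfl
  rw [integral_zero, mul_zero, hT] at h1
  exact norm_le_zero_iff.1 h1

variable {V : E3 → ℝ} {M : ℝ}

/-- A single interaction excites at most one oscillator. -/
theorem starProjection_freeProp_intCLM (hε : 0 < ε) (v₀ : ℝ) (a : Fin N → E3) (hV : Integrable V)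
    (hVm : AEStronglyMeasurable V volume)
    (hS : MemWeightedSobolev 4 4 (fourierT V)) (hM : ∀ᵐ x, ‖V x‖ ≤ M) {s t : ℝ}
    (hs : s ∈ Icc 0 t) : (atMostOneExcited ε a)ᗮ.starProjection
      (freeProp ε a t (intCLM hε a hVm hM s (initialState ε v₀ a))) = 0 := by
  have hW := isFreeGroup_freeProp hε a
  obtain ⟨C, -, hC⟩ := exists_pairCLM_kicked N (hs.1.trans hs.2)
  have hD := abs_potential_le hV hS
  obtain ⟨T₀, hT₀⟩ : ∃ T : L2 N →L[ℂ] L2 N, ∀ x, T x =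
      (atMostOneExcited ε a)ᗮ.starProjection (freeProp ε a (t - s) x) :=
    ⟨(atMostOneExcited ε a)ᗮ.starProjection.comp
      (freeProp ε a (t - s)).toContinuousLinearEquiv.toContinuousLinearMap, fun _ => rfl⟩
  obtain ⟨T, hT⟩ : ∃ T : L2 N →L[ℂ] L2 N, ∀ x, T x =
      (atMostOneExcited ε a)ᗮ.starProjection (freeProp ε a t (intCLM hε a hVm hM s x)) :=
    ⟨((atMostOneExcited ε a)ᗮ.starProjection.comp
      (freeProp ε a t).toContinuousLinearEquiv.toContinuousLinearMap).comp
        (intCLM hε a hVm hM s), fun _ => rfl⟩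
  have hkick : ∀ (u : E3) (j : Fin N) η θ k, T₀ (kickState ε v₀ a u s j η θ k) = 0 := by
    intro u j η θ k
    obtain ⟨c, hc, -⟩ := exists_kicked hε v₀ a u s j η θ k
    have h1 : kickState ε v₀ a u s j η θ k =
        Complex.exp c • packetL2 hε a s (kicked ε v₀ u s j η θ k) := by
      refine Lp.ext ((kickState_coe hε v₀ a u s j η θ k).trans ?_)
      filter_upwards [Lp.coeFn_smul (Complex.exp c) (packetL2 hε a s (kicked ε v₀ u s j η θ k)),
        packetL2_coe hε a s (kicked ε v₀ u s j η θ k)] with X h1 h2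
      rw [h1, Pi.smul_apply, h2, smul_eq_mul, hc, kickFun]
    rw [h1, map_smul, hT₀, hW.map_packet, starProjection_orthogonal_eq_zero, smul_zero]
    refine packetL2_mem_atMostOneExcited hε a _ (A := {j}) (by simp) fun i hi => ?_
    rw [kicked, kick]
    simp only
    rw [Function.update_of_ne (by simpa using hi)]
    rfl
  have hpair : ∀ (u : E3) (j : Fin N),
      T₀ (pairCLM hε hVm hM j (packetL2 hε a s (waveParams ε v₀ u))) = 0 := by
    intro u j
    -- An estimate with `G = 0` is a vanishing statement: the projected evolution kills every kicked
    -- packet, hence also their superposition.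
    have h1 := norm_apply_pairCLM_le (v₀ := v₀) (a := a) (u := u) (σ := s) (j := j) hε hV hS hM T₀
      (G := 0) (K := C * scaleNorm N ε) (fun η θ k => (hC hε hVm hM hD v₀ a u j j η θ k s hs s hs).1)
      (fun η θ k => by rw [hkick, norm_zero, zero_mul])
    rw [mul_zero, zero_mul] at h1
    refine norm_le_zero_iff.1 (le_of_mul_le_mul_left (h1.trans (le_of_eq (mul_zero _).symm)) ?_)
    positivity
  have h1 := norm_apply_initialState_le hε v₀ a T (g := fun _ => 0) (integrable_zero _ _ _)
    fun u => by
      have e1 : T (packetL2 hε a 0 (waveParams ε v₀ u)) =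
          ∑ j, T₀ (pairCLM hε hVm hM j (packetL2 hε a s (waveParams ε v₀ u))) := by
        rw [← map_sum, hT, hT₀]
        congr 1
        change freeProp ε a t (freeProp ε a (-s) ((∑ j, pairCLM hε hVm hM j)
          (freeProp ε a s (packetL2 hε a 0 (waveParams ε v₀ u))))) = _
        rw [← hW.add, hW.map_packet, zero_add, ← sub_eq_add_neg, sum_apply]
      rw [e1, Finset.sum_eq_zero fun j _ => hpair u j, norm_zero]
  rw [integral_zero, mul_zero, hT] at h1
  exact norm_le_zero_iff.1 h1

/-- The projection annihilates the zeroth- and first-order Duhamel terms and does not increase the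
norm of the remainder. In the fallback case, where `fullProp` is the identity, it annihilates the
initial state itself. -/
theorem probTwoExcited_le (hε : 0 < ε) (v₀ : ℝ) (a : Fin N → E3) (hV : Integrable V)
    (hS : MemWeightedSobolev 4 4 (fourierT V)) {t : ℝ} (ht : 0 ≤ t) :
    probTwoExcited ε a (fullProp ε a V t (initialState ε v₀ a)) ≤
      ‖remainder ε v₀ a V t‖ ^ 2 := by
  obtain ⟨-, hM⟩ := supNorm_le hV hS
  have hVm := hV.aestronglyMeasurable
  rw [probTwoExcited]
  gcongr
  rcases fullProp_cases (ε := ε) a V with hU | hU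
  · obtain ⟨Q, hQ⟩ : ∃ Q : L2 N →L[ℂ] L2 N, ∀ x, Q x =
        (atMostOneExcited ε a)ᗮ.starProjection (freeProp ε a t x) :=
      ⟨(atMostOneExcited ε a)ᗮ.starProjection.comp
        (freeProp ε a t).toContinuousLinearEquiv.toContinuousLinearMap, fun _ => rfl⟩
    have h1 : Q (∫ s in (0 : ℝ)..t, intCLM hε a hVm hM s (initialState ε v₀ a)) = 0 := by
      have hc : Continuous fun s => intCLM hε a hVm hM s (initialState ε v₀ a) :=
        continuous_intCLM_apply hε a hVm hM continuous_const
      rw [← ContinuousLinearMap.intervalIntegral_comp_comm _ (hc.intervalIntegrable _ _)]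
      refine intervalIntegral.integral_zero_ae (Eventually.of_forall fun s hs => ?_)
      rw [uIoc_of_le ht] at hs
      rw [hQ]
      exact starProjection_freeProp_intCLM hε v₀ a hV hVm hS hM ⟨hs.1.le, hs.2⟩
    rw [hQ] at h1
    rw [fullProp_eq hε a hVm hM hU, map_add, map_sub, map_smul, h1,
      starProjection_freeProp_initialState hε, smul_zero, sub_zero, zero_add]
    exact Submodule.norm_starProjection_apply_le _ _
  · have h1 := starProjection_freeProp_initialState hε v₀ a 0
    rw [unitary_zero (isFreeGroup_freeProp hε a).add] at h1
    rw [hU, h1, norm_zero]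
    exact norm_nonneg _

end Excitation

end

end SphericalWave

end

/-! ### Assembly of the estimates. -/

open SphericalWave in
theorem proposition3p3 (N : ℕ) (v₀ : ℝ) (hv₀ : 0 < v₀) (a : Fin N → E3)
    (ha₀ : ∀ j, a j ≠ 0)
    (hB₁ : StrictMono fun j => ‖a j‖)
    (hB₂ : ∀ i j, i ≠ j → inner ℝ (a i) (a j) ≠ ‖a i‖ * ‖a j‖)
    (t : ℝ) (ht : 0 < t) :
    ∃ C : ℝ, 0 < C ∧
      ∀ V : E3 → ℝ, Integrable V volume → MemWeightedSobolev 4 4 (fourierT V) →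
      ∀ ε : ℝ, 0 < ε →
        BddAbove ((fun s => ‖J ε a V s (initialState ε v₀ a)‖) '' Icc 0 t) ∧
        ‖remainder ε v₀ a V t‖ ≤
          (1 + t * (N * supNorm V)) *
            sSup ((fun s => ‖J ε a V s (initialState ε v₀ a)‖) '' Icc 0 t) ∧
        (1 + t * (N * supNorm V)) *
            sSup ((fun s => ‖J ε a V s (initialState ε v₀ a)‖) '' Icc 0 t) ≤
          C * (1 + t * supNorm V) * weightedSobolevNorm 4 4 (fourierT V) ^ 2 * ε ^ 3 ∧
        probTwoExcited ε a (fullProp ε a V t (initialState ε v₀ a)) ≤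
          (C * (1 + t * supNorm V) * weightedSobolevNorm 4 4 (fourierT V) ^ 2 * ε ^ 3) ^ 2 := by
  obtain ⟨C, hC, hJ⟩ := exists_norm_J_initialState_le hv₀ ht.le ha₀
  -- The factor `1 + N` absorbs the number of oscillators, as `1 + t N ‖V‖ ≤ (1 + N) (1 + t ‖V‖)`.
  refine ⟨C * (1 + N), by positivity, fun V hV hS ε hε => ?_⟩
  obtain ⟨-, hM⟩ := supNorm_le hV hS
  have hVm := hV.aestronglyMeasurable
  have hsup0 : 0 ≤ supNorm V := ENNReal.toReal_nonneg
  have h1 := norm_remainder_le hε a hVm hM v₀ ht.le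
  have h2 : (1 + t * (N * supNorm V)) *
      sSup ((fun s => ‖J ε a V s (initialState ε v₀ a)‖) '' Icc 0 t) ≤
      C * (1 + N) * (1 + t * supNorm V) * weightedSobolevNorm 4 4 (fourierT V) ^ 2 * ε ^ 3 := by
    have h3 : sSup ((fun s => ‖J ε a V s (initialState ε v₀ a)‖) '' Icc 0 t) ≤
        C * weightedSobolevNorm 4 4 (fourierT V) ^ 2 * ε ^ 3 := by
      refine csSup_le ((nonempty_Icc.2 ht.le).image _) ?_
      rintro _ ⟨r, hr, rfl⟩
      exact hJ hε hV hS r hr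
    have h4 : 1 + t * (N * supNorm V) ≤ (1 + N) * (1 + t * supNorm V) := by
      have : 0 ≤ t * supNorm V := by positivity
      nlinarith [(Nat.cast_nonneg N : (0 : ℝ) ≤ N)]
    calc _ ≤ (1 + N) * (1 + t * supNorm V) *
          (C * weightedSobolevNorm 4 4 (fourierT V) ^ 2 * ε ^ 3) :=
          mul_le_mul h4 h3 (Real.sSup_nonneg (by rintro _ ⟨r, -, rfl⟩; exact norm_nonneg _))
            (by positivity)
      _ = _ := by ring
  exact ⟨bddAbove_norm_J hε a hVm hM _ t, h1, h2, (probTwoExcited_le hε v₀ a hV hS ht.le).trans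
    (pow_le_pow_left₀ (norm_nonneg _) (h1.trans h2) 2)⟩
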